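/- Let $\mathbb{F}_q$ be a finite field of characteristic $p\ge 5$, let $K=\mathbb{F}_q(t)$, let $d\ge 2$ be an integer coprime to $q$, and let $E_d/K$ be the elliptic curve $y^2+xy-t^d y=x^3$. Its $L$-function is the power series $$L(E_d/K,T)=\prod_{v\text{ good}}\left(1-a_vT^{\deg v}+q_vT^{2\deg v}\right)^{-1}\prod_{v\text{ bad}}\left(1-a_vT^{\deg v}\right)^{-1}\in\mathbb{Z}[[T]],$$ the products being over the places $v$ of $K$, where $q_v$ is the cardinality of the residue field at $v$ and $a_v=q_v+1-N_v$, with $N_v$ the number of $\mathbb{F}_{q_v}$-rational points (singular points included) of the plane cubic obtained by reducing modulo $v$ a minimal integral Weierstrass model of $E_d$ at $v$; $v$ is good if this cubic is smooth, and bad otherwise. Let $Z_d=\mathbb{Z}/d\mathbb{Z}\smallsetminus\{0,d/3,2d/3\}$ if $3\mid d$ and $Z_d=\mathbb{Z}/d\mathbb{Z}\smallsetminus\{0\}$ otherwise, and let $\mathcal{O}_q(Z_d)$ be the set of orbits of multiplication by $q$ on $Z_d$. Fix an algebraic closure $\overline{\mathbb{Q}}$ of $\mathbb{Q}$, a prime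 ideal $\mathfrak{P}$ above $p$ of its ring of integers $\overline{\mathbb{Z}}$, and view each finite field $\mathbb{F}_{q^n}$ inside $\overline{\mathbb{Z}}/\mathfrak{P}=\overline{\mathbb{F}}_p$. Let $\theta$ be the Teichmüller character, that is, the inverse of the isomorphism, given by reduction modulo $\mathfrak{P}$, from the group of roots of unity of order prime to $p$ in $\overline{\mathbb{Z}}$ onto $\overline{\mathbb{F}}_p^\times$. For $m\in Z_d$, identified with its lift in $\{1,\dots,d-1\}$, with orbit $\mathbf{m}$ of size $|\mathbf{m}|$, let $\theta_m(x)=\theta(x)^{(q^{|\mathbf{m}|}-1)m/d}$ for $x\in\mathbb{F}_{q^{|\mathbf{m}|}}^\times$, let $\theta_m(0)=0$, and put $$J(m)=\sum_{\substack{x_1,x_2,x_3\in\mathbb{F}_{q^{|\mathbf{m}|}}\\ x_1+x_2+x_3=1}}\theta_m(x_1)\theta_m(x_2)\theta_m(x_3).$$ Then the product defining $L(E_d/K,T)$ converges in $\mathbb{Z}[[T]]$ for the topology of coefficientwise convergence, $L(E_d/K,T)$ is a polynomial with coefficients in $\mathbb{Z}$, and $$L(E_d/K,T)=\prod_{\mathbf{m}\in\mathcal{O}_q(Z_d)}\left(1-\theta_m(-1)\,J(m)\,T^{|\mathbf{m}|}\right),$$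 for any choice of a representative $m$ of each orbit $\mathbf{m}$. If moreover $d\mid q-1$, then for every character $\chi:\mathbb{F}_q^\times\to\overline{\mathbb{Q}}^\times$ of exact order $d$, $$L(E_d/K,T)=\prod_{\substack{1\le k\le d-1\\ d\,\nmid\, 3k}}(1-J_kT),\qquad J_k=\sum_{\substack{x_1,x_2,x_3\in\mathbb{F}_q\\ x_1+x_2+x_3=1}}\chi^k(-x_1x_2x_3),\quad \chi^k(0)=0.$$ -/

import Mathlib

open scoped PowerSeries.WithPiTopology WithZero

namespace Hessian

noncomputable section

open Polynomial

/-! ### Places of the rational function field -/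

/-- The places of `F(t)`: the maximal ideals of `F[t]` (monic irreducible polynomials), and the
place at infinity. -/
inductive Place (F : Type*) [Field F] : Type _
  | finite (P : IsDedekindDomain.HeightOneSpectrum F[X]) : Place F
  | infinity : Place F

namespace Place

variable {F : Type*} [Field F]

open Classical in
/-- The normalised discrete valuation of `F(t)` attached to a place: the `P`-adic valuation, or
`f / g ↦ exp (deg f - deg g)` at infinity. -/
def valuation : Place F → Valuation (RatFunc F) ℤᵐ⁰
  | finite P => P.valuation (RatFunc F)
  | infinity => RatFunc.inftyValuation F

/-- The valuation ring `O_v` of the place `v`. -/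
abbrev integers (v : Place F) : ValuationSubring (RatFunc F) := v.valuation.valuationSubring

instance (v : Place F) : v.valuation.IsNontrivial := by
  classical
  cases v with
  | finite P =>
    obtain ⟨x, hx⟩ := P.valuation_exists_uniformizer (RatFunc F)
    refine ⟨x, ?_, ?_⟩
    · simp [valuation, hx]
    · rw [valuation, hx, ← WithZero.exp_zero, Ne, WithZero.exp_inj]
      decide
  | infinity => exact inferInstanceAs (RatFunc.inftyValuation F).IsNontrivial

instance (v : Place F) : IsDiscreteValuationRing v.integers :=
  v.valuation.valuationSubring_isDiscreteValuationRing

theorem algebraMap_mem_integers (v : Place F) (c : F) :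
    algebraMap F (RatFunc F) c ∈ v.integers := by
  classical
  rw [Valuation.mem_valuationSubring_iff]
  cases v with
  | finite P =>
    rw [IsScalarTower.algebraMap_apply F F[X] (RatFunc F)]
    exact P.valuation_le_one _
  | infinity =>
    by_cases hc : c = 0
    · simp [hc]
    · exact (RatFunc.inftyValuation.C F hc).le

/-- The residue field `O_v / m_v`. -/
abbrev residueField (v : Place F) : Type _ := IsLocalRing.ResidueField v.integers

/-- The inclusion of the constant field `F` into the residue field at `v`. -/
def constants (v : Place F) : F →+* v.residueField :=
  (IsLocalRing.residue v.integers).comp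
    ((algebraMap F (RatFunc F)).codRestrict v.integers v.algebraMap_mem_integers)

/-- The degree of `v`: the degree of the residue field at `v` over `F`. -/
def degree (v : Place F) : ℕ :=
  letI := v.constants.toAlgebra
  Module.finrank F v.residueField

/-- `q_v`, the cardinality of the residue field. -/
def norm (v : Place F) : ℕ := Nat.card v.residueField

end Place

/-! ### The `L`-function of a Weierstrass curve over `F(t)`, with `F` finite -/

/-- The number of `k`-rational points of the projective plane cubic defined by a Weierstrass
equation (singular or not): the affine solutions, singular points included, together with the
single point at infinity. -/
def numPoints {k : Type*} [Field k] (W : WeierstrassCurve k) : ℕ :=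
  Nat.card {P : k × k // W.toAffine.Equation P.1 P.2} + 1

section LFunction

variable {F : Type*} [Field F] (W : WeierstrassCurve (RatFunc F)) (v : Place F)

/-- `a_v = q_v + 1 - N_v`, where `N_v` is the number of rational points of the reduction at `v` of
a minimal integral model. -/
def traceAt : ℤ :=
  (v.norm : ℤ) + 1 - numPoints ((W.minimal v.integers).reduction v.integers)

open Classical in
/-- The polynomial `1 - a_v T ^ deg v + q_v T ^ (2 deg v)` if `W` has good reduction at `v`,
and `1 - a_v T ^ deg v` if `W` has bad reduction at `v`. -/
def localPolynomial : ℤ[X] :=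
  if (W.minimal v.integers).HasGoodReduction v.integers then
    1 - C (traceAt W v) * X ^ v.degree + C (v.norm : ℤ) * X ^ (2 * v.degree)
  else
    1 - C (traceAt W v) * X ^ v.degree

/-- The Euler factor at `v`: the inverse in `ℤ⟦T⟧` of the local polynomial (whose constant
coefficient is `1`). -/
def eulerFactor : PowerSeries ℤ :=
  PowerSeries.invOfUnit (localPolynomial W v : PowerSeries ℤ) 1

/-- The `L`-function of `W`, as the Euler product over all places of `F(t)`, converging for the
coefficientwise topology on `ℤ⟦T⟧`. -/
def lFunction : PowerSeries ℤ := ∏' v : Place F, eulerFactor W v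

end LFunction

/-- The Hessian curve `E_d : y ^ 2 + x y - t ^ d y = x ^ 3` over `F(t)`. -/
def hessianCurve (F : Type*) [Field F] (d : ℕ) : WeierstrassCurve (RatFunc F) where
  a₁ := 1
  a₂ := 0
  a₃ := -RatFunc.X ^ d
  a₄ := 0
  a₆ := 0

/-! ### Multiplication by `q` on `ℤ/dℤ` -/

section Orbits

variable (d : ℕ) [NeZero d]

/-- `ℤ/dℤ` without `0`, and also without `d/3` and `2d/3` when `3` divides `d`. -/
def zSet : Finset (ZMod d) :=
  if 3 ∣ d then Finset.univ \ {0, ((d / 3 : ℕ) : ZMod d), ((2 * d / 3 : ℕ) : ZMod d)}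
  else Finset.univ \ {0}

variable {d}

open Classical in
/-- The orbit `{m, q m, q ^ 2 m, …}` of `m`. -/
def orbit (q : ℕ) (m : ZMod d) : Finset (ZMod d) :=
  Finset.univ.filter fun n => ∃ i : ℕ, n = (q : ZMod d) ^ i * m

variable (d)

open Classical in
/-- The set of orbits of multiplication by `q` on `zSet d`. -/
def orbits (q : ℕ) : Finset (Finset (ZMod d)) := (zSet d).image (orbit q)

end Orbits

/-! ### The Teichmüller character

`Q` is an algebraic closure of `ℚ`, with ring of integers `integralClosure ℤ Q`, and `𝔓` is a prime
ideal of the latter above `p`. -/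

section Teichmuller

/-- The group of roots of unity of order prime to `p` in a commutative ring. -/
def rootsOfUnityPrimeTo (p : ℕ) (A : Type*) [CommRing A] : Subgroup Aˣ where
  carrier := {ζ | ∃ n : ℕ, 0 < n ∧ n.Coprime p ∧ ζ ^ n = 1}
  one_mem' := ⟨1, one_pos, Nat.coprime_one_left p, by simp⟩
  mul_mem' := by
    rintro a b ⟨n, hn, hnp, ha⟩ ⟨m, hm, hmp, hb⟩
    refine ⟨n * m, Nat.mul_pos hn hm, Nat.Coprime.mul_left hnp hmp, ?_⟩
    rw [mul_pow, pow_mul, ha, one_pow, mul_comm n m, pow_mul, hb, one_pow, one_mul]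
  inv_mem' := by
    rintro a ⟨n, hn, hnp, ha⟩
    exact ⟨n, hn, hnp, by rw [inv_pow, ha, inv_one]⟩

variable {Q : Type*} [Field Q] (p : ℕ) (𝔓 : Ideal (integralClosure ℤ Q))

/-- The reduction map from the roots of unity of order prime to `p` to the units of the residue
field of `𝔓`. -/
def reduceRoots :
    rootsOfUnityPrimeTo p (integralClosure ℤ Q) →* (integralClosure ℤ Q ⧸ 𝔓)ˣ :=
  (Units.map (Ideal.Quotient.mk 𝔓 : integralClosure ℤ Q →* integralClosure ℤ Q ⧸ 𝔓)).comp
    (rootsOfUnityPrimeTo p (integralClosure ℤ Q)).subtype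

theorem charP_residue [Fact p.Prime] [𝔓.LiesOver (Ideal.span {(p : ℤ)})] :
    CharP (integralClosure ℤ Q ⧸ 𝔓) p := by
  refine ⟨fun n => ?_⟩
  have h : (Ideal.span {(p : ℤ)}) = 𝔓.under ℤ := Ideal.LiesOver.over
  have h2 : ((n : ℤ) ∈ Ideal.span {(p : ℤ)}) ↔
      algebraMap ℤ (integralClosure ℤ Q) (n : ℤ) ∈ 𝔓 := by
    rw [h]; exact Ideal.mem_comap
  rw [Ideal.mem_span_singleton, Int.natCast_dvd_natCast] at h2
  rw [h2, ← Ideal.Quotient.eq_zero_iff_mem]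
  simp

theorem isMaximal_of_liesOver [hp : Fact p.Prime] [𝔓.IsPrime]
    [𝔓.LiesOver (Ideal.span {(p : ℤ)})] : 𝔓.IsMaximal := by
  have h : (Ideal.span {(p : ℤ)}) = 𝔓.under ℤ := Ideal.LiesOver.over
  have hmax : (Ideal.span {(p : ℤ)}).IsMaximal :=
    PrincipalIdealRing.isMaximal_of_irreducible
      (Nat.prime_iff_prime_int.mp hp.out).irreducible
  exact Ideal.isMaximal_of_isIntegral_of_isMaximal_comap (R := ℤ) 𝔓 (by
    rw [h] at hmax; exact hmax)

theorem exists_pow_eq_one_of_isIntegral {p : ℕ} [hp : Fact p.Prime] {k : Type*} [Field k]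
    [Algebra (ZMod p) k] {x : k} (hx : x ≠ 0) (hint : IsIntegral (ZMod p) x) :
    ∃ n : ℕ, 0 < n ∧ n.Coprime p ∧ x ^ n = 1 := by
  have := IntermediateField.adjoin.finiteDimensional hint
  let L := IntermediateField.adjoin (ZMod p) {x}
  have : Finite L := Module.finite_of_finite (ZMod p)
  have : Fintype L := Fintype.ofFinite L
  let y : L := ⟨x, IntermediateField.mem_adjoin_simple_self _ _⟩
  have hy : y ≠ 0 := fun h => hx (congrArg Subtype.val h)
  have : CharP L p := charP_of_injective_algebraMap (algebraMap (ZMod p) L).injective p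
  obtain ⟨n, -, hn⟩ := FiniteField.card L p
  refine ⟨Fintype.card L - 1, Nat.sub_pos_of_lt Fintype.one_lt_card, ?_, ?_⟩
  · have h1 : p ∣ Fintype.card L := by rw [hn]; exact dvd_pow_self p n.ne_zero
    have h2 : 1 < Fintype.card L := Fintype.one_lt_card
    rw [Nat.coprime_comm, hp.out.coprime_iff_not_dvd]
    intro h3
    have := (Nat.dvd_sub_iff_right h2.le h1).mp h3
    exact hp.out.one_lt.ne' (Nat.dvd_one.mp this)
  · exact congrArg Subtype.val (FiniteField.pow_card_sub_one_eq_one y hy)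

theorem exists_pow_eq_one [Fact p.Prime] [𝔓.IsPrime]
    [𝔓.LiesOver (Ideal.span {(p : ℤ)})] (x : (integralClosure ℤ Q ⧸ 𝔓)ˣ) :
    ∃ n : ℕ, 0 < n ∧ n.Coprime p ∧ x ^ n = 1 := by
  have := charP_residue p 𝔓
  have := isMaximal_of_liesOver p 𝔓
  let := Ideal.Quotient.field 𝔓
  let := ZMod.algebra (integralClosure ℤ Q ⧸ 𝔓) p
  have hint : IsIntegral ℤ (x : integralClosure ℤ Q ⧸ 𝔓) := Algebra.IsIntegral.isIntegral _
  obtain ⟨n, hn, hnp, h⟩ :=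
    exists_pow_eq_one_of_isIntegral (p := p) x.ne_zero hint.tower_top
  exact ⟨n, hn, hnp, Units.ext (by simpa using h)⟩

theorem reduceRoots_bijective [CharZero Q] [IsAlgClosed Q] [hp : Fact p.Prime] [𝔓.IsPrime]
    [𝔓.LiesOver (Ideal.span {(p : ℤ)})] : Function.Bijective (reduceRoots p 𝔓) := by
  have := charP_residue p 𝔓
  constructor
  · rw [injective_iff_map_eq_one]
    rintro ⟨ζ, n, hn, hnp, hζ⟩ h
    have h1 : Ideal.Quotient.mk 𝔓 (ζ : integralClosure ℤ Q) = 1 := congrArg Units.val h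
    by_contra hne
    have hne' : (ζ : integralClosure ℤ Q) - 1 ≠ 0 := by
      intro h0
      exact hne (Subtype.ext (Units.ext (sub_eq_zero.mp h0)))
    have hζ' : (ζ : integralClosure ℤ Q) ^ n = 1 := by
      rw [← Units.val_pow_eq_pow_val, hζ, Units.val_one]
    have hs : ∑ i ∈ Finset.range n, (ζ : integralClosure ℤ Q) ^ i = 0 := by
      have := geom_sum_mul (ζ : integralClosure ℤ Q) n
      rw [hζ', sub_self] at this
      exact (mul_eq_zero.mp this).resolve_right hne'
    have hs' := congrArg (Ideal.Quotient.mk 𝔓) hs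
    rw [map_sum, map_zero] at hs'
    simp only [map_pow, h1, one_pow, Finset.sum_const, Finset.card_range, nsmul_eq_mul,
      mul_one] at hs'
    rw [CharP.cast_eq_zero_iff _ p] at hs'
    exact (hp.out.coprime_iff_not_dvd.mp hnp.symm) hs'
  · intro x
    obtain ⟨n, hn, hnp, hx⟩ := exists_pow_eq_one p 𝔓 x
    have : NeZero n := ⟨hn.ne'⟩
    have : NeZero (n : Q) := ⟨Nat.cast_ne_zero.mpr hn.ne'⟩
    obtain ⟨ζ, hζ⟩ := HasEnoughRootsOfUnity.exists_primitiveRoot Q n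
    let z : integralClosure ℤ Q := ⟨ζ, hζ.isIntegral hn⟩
    have hz : IsPrimitiveRoot z n :=
      IsPrimitiveRoot.of_map_of_injective (f := (integralClosure ℤ Q).val) hζ
        Subtype.val_injective
    have hprod := X_pow_sub_one_eq_prod hn hz
    have hev := congrArg (Polynomial.eval₂ (Ideal.Quotient.mk 𝔓)
      (x : integralClosure ℤ Q ⧸ 𝔓)) hprod
    rw [Polynomial.eval₂_finsetProd] at hev
    simp only [eval₂_sub, eval₂_pow, eval₂_X, eval₂_one, eval₂_C] at hev
    rw [← Units.val_pow_eq_pow_val, hx, Units.val_one, sub_self, eq_comm,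
      Finset.prod_eq_zero_iff] at hev
    obtain ⟨w, hw, hw'⟩ := hev
    rw [Polynomial.mem_nthRootsFinset hn] at hw
    refine ⟨⟨Units.ofPowEqOne w n hw hn.ne', n, hn, hnp, Units.pow_ofPowEqOne hw hn.ne'⟩, ?_⟩
    ext
    exact (sub_eq_zero.mp hw').symm

variable [CharZero Q] [IsAlgClosed Q] [Fact p.Prime] [𝔓.IsPrime]
  [𝔓.LiesOver (Ideal.span {(p : ℤ)})]

/-- The Teichmüller character: the inverse of reduction modulo `𝔓`, from the units of the residue
field of `𝔓` (an algebraic closure of `𝔽_p`) to the roots of unity of order prime to `p`. -/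
def teichmuller :
    (integralClosure ℤ Q ⧸ 𝔓)ˣ ≃* rootsOfUnityPrimeTo p (integralClosure ℤ Q) :=
  (MulEquiv.ofBijective (reduceRoots p 𝔓) (reduceRoots_bijective p 𝔓)).symm

/-- The field with `p ^ r` elements (`r ≥ 1`) inside the residue field of `𝔓`: the solutions
of `x ^ (p ^ r) = x`. -/
def finiteField (r : ℕ) : Subring (integralClosure ℤ Q ⧸ 𝔓) :=
  haveI := charP_residue p 𝔓
  (iterateFrobenius (integralClosure ℤ Q ⧸ 𝔓) p r).eqLocus (RingHom.id _)

/-- For finite `R`, the Jacobi sum `∑ χ₁ x₁ * χ₂ x₂ * χ₃ x₃` over `x₁ + x₂ + x₃ = 1`. -/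
def jacobiSum₃ {R A : Type*} [CommRing R] [CommRing A] (χ₁ χ₂ χ₃ : R → A) : A :=
  ∑ᶠ x : {x : R × R × R // x.1 + x.2.1 + x.2.2 = 1},
    χ₁ x.1.1 * χ₂ x.1.2.1 * χ₃ x.1.2.2

variable {d : ℕ} [NeZero d]

open Classical in
/-- With `q = p ^ a`, the character `θ_m` of the field with `q ^ |m|` elements, where `|m|` is the
size of the orbit of `m`: it is the Teichmüller character to the power `(q ^ |m| - 1) m / d`
(an integer, `m` being lifted to `{0, …, d - 1}`), extended by `0` at `0`. -/
def theta (a : ℕ) (m : ZMod d) (x : finiteField p 𝔓 (a * (orbit (p ^ a) m).card)) : Q :=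
  if h : IsUnit (x : integralClosure ℤ Q ⧸ 𝔓) then
    (((teichmuller p 𝔓 h.unit : (integralClosure ℤ Q)ˣ) : integralClosure ℤ Q) : Q) ^
      (((p ^ a) ^ (orbit (p ^ a) m).card - 1) * m.val / d)
  else 0

/-- The Jacobi sum `J(m) = j(θ_m, θ_m, θ_m)` over the field with `q ^ |m|` elements. -/
def jacobi (a : ℕ) (m : ZMod d) : Q :=
  jacobiSum₃ (theta p 𝔓 a m) (theta p 𝔓 a m) (theta p 𝔓 a m)

end Teichmuller

/-- For a multiplicative character `χ` of the finite field `F` (with `χ 0 = 0`), the sum of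
`χ (-x₁ x₂ x₃)` over `x₁ + x₂ + x₃ = 1`. -/
def jacobiNeg {F Q : Type*} [Field F] [Field Q] (χ : MulChar F Q) : Q :=
  ∑ᶠ x : {x : F × F × F // x.1 + x.2.1 + x.2.2 = 1}, χ (-(x.1.1 * x.1.2.1 * x.1.2.2))

end

end Hessian

/-!
The proof compares logarithmic derivatives, that is, power sums.

*The analytic side.* Each Euler factor of `E_d` is the inverse of `1 - a T + q T²` or `1 - a T`,
for the reduced cubic over the residue field, evaluated at `T ^ deg v`
(`localPolynomial_finite`, `localPolynomial_infinity`: the given equation is minimal at the finite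
places, and a scaling makes it minimal at infinity). Minus the logarithmic derivative of such a
polynomial is the series of the traces `a` of the cubic over the finite extensions of its base field.
For a singular cubic this is a computation with the quadratic character; for a smooth one it is the
rationality of the zeta function of an elliptic curve (`exists_isTraceSeries_of_smooth`), proved by
counting the effective divisors on the affine curve with explicit Riemann-Roch spaces
(`card_idealsOfDegree`), the coordinate ring being a Dedekind domain. Consequently the `n`-th
coefficient of `T L' / L` is the sum of the traces of all the fibres of the Hessian family over the
points of the projective line with values in the extension of degree `n`
(`exists_lFunction_series`).

*The character sums.* The equation of the family is linear in `t ^ d`. Counting the points of the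
total space by means of the characters `χ` with `χ ^ d = 1` therefore expresses the sum of the traces
of the fibres as minus the sum of the triple Jacobi sums `jacobiNeg χ`. The characters with `χ ^ 3 = 1`
are cancelled by the fibre at infinity (`sum_affineTrace_hessian`).

*The comparison.* By the Hasse–Davenport relation the Jacobi sum of a character lifted by the norm is
a power of the Jacobi sum of the character (`jacobiNeg_normLift`). The relation itself is obtained from
the Euler product of the `L`-function of a Gauss sum over the polynomial ring, by the same computation
of a logarithmic derivative as for the curves (`X_mul_derivative_zetaSeries`). It remains to sort the
characters `χ` with `χ ^ d = 1` and `χ ^ 3 ≠ 1` of the field with `q ^ n` elements. They are the powers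
`(q ^ n - 1) m / d` of the Teichmüller character, for the `m` in `zSet d` fixed by `q ^ n`; those in
a given orbit have the same Jacobi sum, because it is invariant under Frobenius
(`sum_jacobiNeg_eq_sum_orbits`). When a character of order `d` of the constant field is given, they are
the powers of its lift (`map_lFunction_eq_prod_char`). In both cases the sum of the Jacobi sums over
the field with `q ^ n` elements is the `n`-th power sum attached to the claimed product, for all `n`,
and a power series with constant coefficient `1` over a field of characteristic zero is determined by
its logarithmic derivative (`map_lFunction_eq_prod`). In particular the `L`-function is a polynomial
over an algebraic closure of `ℚ`, hence over `ℤ`.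
-/

namespace Hessian

noncomputable section

/-! ### Zeta functions of rings of functions, and their logarithmic derivatives -/

section

open Polynomial IsDedekindDomain UniqueFactorizationMonoid

section Ideals

variable (k : Type*) {A : Type*} [Field k] [CommRing A] [Algebra k A]

/-- The degree over `k` of an ideal of a `k`-algebra: the `k`-dimension of the quotient. It is only
meaningful for ideals of finite codimension: the zero ideal of an infinite-dimensional algebra gets
the value `0`. -/
def ideg (I : Ideal A) : ℕ := Module.finrank k (A ⧸ I)

theorem card_quotient_eq_pow_ideg [Finite k] {I : Ideal A} [Finite (A ⧸ I)] :
    Nat.card (A ⧸ I) = Nat.card k ^ ideg k I :=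
  Module.natCard_eq_pow_finrank

theorem ideg_top : ideg k (⊤ : Ideal A) = 0 := by
  have : Subsingleton (A ⧸ (⊤ : Ideal A)) := Ideal.Quotient.subsingleton_iff.mpr rfl
  exact Module.finrank_zero_of_subsingleton

variable [Ring.HasFiniteQuotients A]

theorem ideg_eq_zero_iff {I : Ideal A} (hI : I ≠ ⊥) : ideg k I = 0 ↔ I = ⊤ := by
  have := Ring.HasFiniteQuotients.finiteQuotient hI
  have : Module.Finite k (A ⧸ I) := Module.Finite.of_finite
  rw [ideg, Module.finrank_zero_iff, Ideal.Quotient.subsingleton_iff]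

theorem ideg_pos (P : HeightOneSpectrum A) : 0 < ideg k P.asIdeal :=
  Nat.pos_of_ne_zero fun h => P.isPrime.ne_top ((ideg_eq_zero_iff k P.ne_bot).mp h)

variable [Finite k]

theorem finite_ideg_eq (n : ℕ) : {I : Ideal A | I ≠ ⊥ ∧ ideg k I = n}.Finite := by
  refine (Ring.HasFiniteQuotients.finite_cardQuot_le (R := A) (Nat.card k ^ n)).subset ?_
  rintro I ⟨hI, rfl⟩
  have := Ring.HasFiniteQuotients.finiteQuotient hI
  rw [Set.mem_ofPred_eq, Submodule.cardQuot_apply]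
  exact (card_quotient_eq_pow_ideg k).le

theorem finite_ideg_prime_le (n : ℕ) :
    {P : HeightOneSpectrum A | ideg k P.asIdeal ≤ n}.Finite := by
  refine (Ring.HasFiniteQuotients.finite_cardQuot_heightOneSpectrum_le
    (R := A) (Nat.card k ^ n)).subset ?_
  intro P hP
  have := Ring.HasFiniteQuotients.finiteQuotient P.ne_bot
  rw [Set.mem_ofPred_eq, Submodule.cardQuot_apply]
  exact (card_quotient_eq_pow_ideg k).le.trans (Nat.pow_le_pow_right Nat.card_pos hP)

theorem finite_ideg_prime_dvd (n : ℕ) :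
    {P : HeightOneSpectrum A | n ≠ 0 ∧ ideg k P.asIdeal ∣ n}.Finite :=
  (finite_ideg_prime_le k n).subset fun _ h => Nat.le_of_dvd (Nat.pos_of_ne_zero h.1) h.2

variable (A) in
/-- The nonzero ideals of degree `n`. -/
def idealsOfDegree (n : ℕ) : Finset (Ideal A) := (finite_ideg_eq (A := A) k n).toFinset

variable (A) in
/-- The maximal ideals whose degree divides `n`; by convention there are none if `n = 0`. -/
def primesOfDegreeDvd (n : ℕ) : Finset (HeightOneSpectrum A) :=
  (finite_ideg_prime_dvd (A := A) k n).toFinset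

@[simp] theorem mem_idealsOfDegree {n : ℕ} {I : Ideal A} :
    I ∈ idealsOfDegree k A n ↔ I ≠ ⊥ ∧ ideg k I = n := by
  simp [idealsOfDegree]

@[simp] theorem mem_primesOfDegreeDvd {n : ℕ} {P : HeightOneSpectrum A} :
    P ∈ primesOfDegreeDvd k A n ↔ n ≠ 0 ∧ ideg k P.asIdeal ∣ n := by
  simp [primesOfDegreeDvd]

variable [IsDedekindDomain A] [Infinite A]

omit [Ring.HasFiniteQuotients A] in
/-- The norm of ideals is multiplicative. Mathlib has this for rings which are free of finite rank
over `ℤ`; here the norm of the zero ideal is `0` because the ring is infinite. -/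
theorem cardQuot_mul_of_infinite (I J : Ideal A) :
    Submodule.cardQuot (I * J) = Submodule.cardQuot I * Submodule.cardQuot J :=
  multiplicative_of_coprime Submodule.cardQuot I J (Submodule.cardQuot_bot _ _)
      (fun {I J} hI => by simp [Ideal.isUnit_iff.mp hI, Ideal.mul_top])
      (fun {I} i hI =>
        have : Ideal.IsPrime I := Ideal.isPrime_of_prime hI
        cardQuot_pow_of_prime hI.ne_zero)
      fun {I J} hIJ => cardQuot_mul_of_coprime <| Ideal.isCoprime_iff_sup_eq.mpr
        (Ideal.isUnit_iff.mp
          (hIJ (Ideal.dvd_iff_le.mpr le_sup_left) (Ideal.dvd_iff_le.mpr le_sup_right)))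

theorem ideg_mul {I J : Ideal A} (hI : I ≠ ⊥) (hJ : J ≠ ⊥) :
    ideg k (I * J) = ideg k I + ideg k J := by
  have := Ring.HasFiniteQuotients.finiteQuotient hI
  have := Ring.HasFiniteQuotients.finiteQuotient hJ
  have hIJ : I * J ≠ ⊥ := mul_ne_zero hI hJ
  have := Ring.HasFiniteQuotients.finiteQuotient hIJ
  have h := cardQuot_mul_of_infinite I J
  simp only [Submodule.cardQuot_apply] at h
  have e1 := card_quotient_eq_pow_ideg k (I := I)
  have e2 := card_quotient_eq_pow_ideg k (I := J)
  have e3 := card_quotient_eq_pow_ideg k (I := I * J)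
  rw [e1, e2, e3, ← pow_add] at h
  exact Nat.pow_right_injective (Finite.one_lt_card (α := k)) h

theorem ideg_pow {I : Ideal A} (hI : I ≠ ⊥) (j : ℕ) : ideg k (I ^ j) = j * ideg k I := by
  induction j with
  | zero => simp [ideg_top]
  | succ j ih => rw [pow_succ, ideg_mul k (pow_ne_zero j hI) hI, ih]; ring

/-- The degree of an ideal, counted through its prime power divisors. -/
theorem ideg_eq_sum {I : Ideal A} (hI : I ≠ ⊥) {N : ℕ} (hN : ideg k I ≤ N)
    {s : Finset (HeightOneSpectrum A)} (hs : ∀ P, ideg k P.asIdeal ≤ N → P ∈ s) :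
    ideg k I = ∑ P ∈ s, ∑ j ∈ Finset.Icc 1 N,
      open Classical in if P.asIdeal ^ j ∣ I then ideg k P.asIdeal else 0 := by
  classical
  have hI0 : I ≠ 0 := hI
  have hdvd : ∀ J : Ideal A, J ∣ I → ideg k J ≤ ideg k I := by
    rintro J ⟨J', rfl⟩
    rw [ideg_mul k (left_ne_zero_of_mul hI0) (right_ne_zero_of_mul hI0)]
    exact Nat.le_add_right _ _
  have hcount : ∀ P : HeightOneSpectrum A, ∀ j, P.asIdeal ^ j ∣ I ↔
      j ≤ (normalizedFactors I).count P.asIdeal := by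
    intro P j
    rw [pow_dvd_iff_le_emultiplicity,
      emultiplicity_eq_count_normalizedFactors P.irreducible hI0, normalize_eq, Nat.cast_le]
  have hle : ∀ P : HeightOneSpectrum A, (normalizedFactors I).count P.asIdeal ≤ N := by
    intro P
    have h1 := hdvd _ ((hcount P _).mpr le_rfl)
    rw [ideg_pow k P.ne_bot] at h1
    exact (Nat.le_mul_of_pos_right _ (ideg_pos k P)).trans (h1.trans hN)
  have h1 : ∀ P ∈ s, (∑ j ∈ Finset.Icc 1 N,
      if P.asIdeal ^ j ∣ I then ideg k P.asIdeal else 0) =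
      (normalizedFactors I).count P.asIdeal * ideg k P.asIdeal := by
    intro P _
    rw [← Finset.sum_filter, Finset.sum_const, smul_eq_mul]
    congr 1
    have : (Finset.Icc 1 N).filter (fun j => P.asIdeal ^ j ∣ I) =
        Finset.Icc 1 ((normalizedFactors I).count P.asIdeal) := by
      ext j
      simp only [Finset.mem_filter, Finset.mem_Icc, hcount]
      have := hle P
      omega
    rw [this]; simp
  rw [Finset.sum_congr rfl h1]
  have h2 : ideg k I = ((normalizedFactors I).map (ideg k)).sum := by
    have key : ∀ m : Multiset (Ideal A), (∀ P ∈ m, P ≠ ⊥) → ideg k m.prod = (m.map (ideg k)).sum := by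
      intro m
      induction m using Multiset.induction_on with
      | empty => intro _; simp [ideg_top]
      | cons a m ih =>
        intro h
        rw [Multiset.prod_cons, Multiset.map_cons, Multiset.sum_cons, ideg_mul, ih]
        · exact fun P hP => h P (Multiset.mem_cons_of_mem hP)
        · exact h a (Multiset.mem_cons_self a m)
        · exact Multiset.prod_ne_zero fun h0 => h _ (Multiset.mem_cons_of_mem h0) rfl
    rw [← key _ fun P hP => (prime_of_normalized_factor P hP).ne_zero,
      Ideal.prod_normalizedFactors_eq_self hI]
  rw [h2, Finset.sum_multiset_map_count]
  simp only [smul_eq_mul]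
  refine Finset.sum_bij_ne_zero (fun P hP _ => ⟨P, Ideal.isPrime_of_prime
      (prime_of_normalized_factor P (Multiset.mem_toFinset.mp hP)),
      (prime_of_normalized_factor P (Multiset.mem_toFinset.mp hP)).ne_zero⟩) ?_ ?_ ?_ ?_
  · intro P hP _
    exact hs _ ((hdvd P (dvd_of_mem_normalizedFactors (Multiset.mem_toFinset.mp hP))).trans hN)
  · intro P _ _ P' _ _ h
    exact congrArg HeightOneSpectrum.asIdeal h
  · intro P _ hP
    have h3 : P.asIdeal ∈ normalizedFactors I :=
      Multiset.count_ne_zero.mp (left_ne_zero_of_mul hP)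
    exact ⟨P.asIdeal, Multiset.mem_toFinset.mpr h3, hP, rfl⟩
  · intro P _ _
    rfl

variable {R : Type*} [CommRing R] (lam : Ideal A →* R)

/-- The zeta series `∑ λ(I) T ^ deg I` over the nonzero ideals `I`. -/
def zetaSeries : PowerSeries R := PowerSeries.mk fun n => ∑ I ∈ idealsOfDegree k A n, lam I

/-- The series whose `n`-th coefficient is the sum of `deg P * λ(P) ^ (n / deg P)` over the maximal
ideals `P` with `deg P ∣ n`. -/
def primeSeries : PowerSeries R := PowerSeries.mk fun n =>
  ∑ P ∈ primesOfDegreeDvd k A n, (ideg k P.asIdeal : R) * lam P.asIdeal ^ (n / ideg k P.asIdeal)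

/-- The multiples of `P ^ j` of degree `n` are the products of `P ^ j` with the ideals of degree
`n - j deg P`. -/
theorem sum_lam_of_pow_dvd (P : HeightOneSpectrum A) (n j : ℕ) :
    (∑ I ∈ idealsOfDegree k A n, open Classical in if P.asIdeal ^ j ∣ I then lam I else 0) =
      if j * ideg k P.asIdeal ≤ n then
        lam P.asIdeal ^ j * ∑ I ∈ idealsOfDegree k A (n - j * ideg k P.asIdeal), lam I else 0 := by
  classical
  have hPj : P.asIdeal ^ j ≠ ⊥ := pow_ne_zero j P.ne_bot
  split_ifs with h
  · rw [← Finset.sum_filter, Finset.mul_sum]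
    symm
    refine Finset.sum_bij (fun I _ => P.asIdeal ^ j * I) ?_ ?_ ?_ ?_
    · intro I hI
      rw [mem_idealsOfDegree] at hI
      rw [Finset.mem_filter, mem_idealsOfDegree, ideg_mul k hPj hI.1, ideg_pow k P.ne_bot, hI.2]
      exact ⟨⟨mul_ne_zero hPj hI.1, by omega⟩, Dvd.intro _ rfl⟩
    · intro I _ I' _ h
      exact mul_left_cancel₀ hPj h
    · intro I hI
      rw [Finset.mem_filter, mem_idealsOfDegree] at hI
      obtain ⟨⟨hI0, hIn⟩, J, rfl⟩ := hI
      have hJ : J ≠ ⊥ := right_ne_zero_of_mul hI0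
      rw [ideg_mul k hPj hJ, ideg_pow k P.ne_bot] at hIn
      exact ⟨J, (mem_idealsOfDegree k).mpr ⟨hJ, by omega⟩, rfl⟩
    · intro I _
      rw [map_mul, map_pow]
  · refine Finset.sum_eq_zero fun I hI => if_neg ?_
    rintro ⟨J, rfl⟩
    rw [mem_idealsOfDegree] at hI
    have hJ : J ≠ ⊥ := right_ne_zero_of_mul hI.1
    have := hI.2
    rw [ideg_mul k hPj hJ, ideg_pow k P.ne_bot] at this
    omega

/-- The logarithmic derivative of the zeta series, obtained by counting in two ways the pairs of an
ideal of degree `n` and a prime power dividing it. -/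
theorem X_mul_derivative_zetaSeries :
    PowerSeries.X * PowerSeries.derivative R (zetaSeries k lam) =
      primeSeries k lam * zetaSeries k lam := by
  classical
  ext n
  set s : Finset (HeightOneSpectrum A) := (finite_ideg_prime_le k n).toFinset with hsdef
  have hs : ∀ P, ideg k P.asIdeal ≤ n → P ∈ s := fun P hP => by simpa [s] using hP
  have hL : PowerSeries.coeff n (PowerSeries.X * PowerSeries.derivative R (zetaSeries k lam)) =
      ∑ I ∈ idealsOfDegree k A n, (n : R) * lam I := by
    cases n with
    | zero => simp
    | succ n =>
      rw [PowerSeries.coeff_succ_X_mul, PowerSeries.coeff_derivative, zetaSeries,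
        PowerSeries.coeff_mk, mul_comm, Finset.mul_sum]
      push_cast
      rfl
  have hL2 : ∑ I ∈ idealsOfDegree k A n, (n : R) * lam I =
      ∑ P ∈ s, ∑ j ∈ Finset.Icc 1 n, (ideg k P.asIdeal : R) *
        if j * ideg k P.asIdeal ≤ n then
          lam P.asIdeal ^ j * ∑ I ∈ idealsOfDegree k A (n - j * ideg k P.asIdeal), lam I else 0 := by
    have : ∀ I ∈ idealsOfDegree k A n, (n : R) * lam I =
        ∑ P ∈ s, ∑ j ∈ Finset.Icc 1 n, (ideg k P.asIdeal : R) *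
          if P.asIdeal ^ j ∣ I then lam I else 0 := by
      intro I hI
      rw [mem_idealsOfDegree] at hI
      have h := ideg_eq_sum k hI.1 hI.2.le hs
      rw [hI.2] at h
      conv_lhs => rw [h]
      push_cast
      simp only [Finset.sum_mul]
      refine Finset.sum_congr rfl fun P _ => Finset.sum_congr rfl fun j _ => ?_
      split_ifs <;> simp
    rw [Finset.sum_congr rfl this, Finset.sum_comm]
    refine Finset.sum_congr rfl fun P _ => ?_
    rw [Finset.sum_comm]
    refine Finset.sum_congr rfl fun j _ => ?_
    rw [← Finset.mul_sum, sum_lam_of_pow_dvd]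
  have hS : ∀ m ≤ n, PowerSeries.coeff m (primeSeries k lam) =
      ∑ P ∈ s, ∑ j ∈ Finset.Icc 1 n, if j * ideg k P.asIdeal = m then
        (ideg k P.asIdeal : R) * lam P.asIdeal ^ j else 0 := by
    intro m hm
    rw [primeSeries, PowerSeries.coeff_mk]
    have hsub : primesOfDegreeDvd k A m ⊆ s := by
      intro P hP
      rw [mem_primesOfDegreeDvd] at hP
      exact hs P ((Nat.le_of_dvd (Nat.pos_of_ne_zero hP.1) hP.2).trans hm)
    rw [← Finset.sum_subset hsub]
    · refine Finset.sum_congr rfl fun P hP => ?_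
      rw [mem_primesOfDegreeDvd] at hP
      obtain ⟨hm0, j, rfl⟩ := hP
      have hpos := ideg_pos k P
      have hj : 0 < j := Nat.pos_of_ne_zero (right_ne_zero_of_mul hm0)
      rw [Finset.sum_eq_single j]
      · rw [if_pos (mul_comm _ _), Nat.mul_div_cancel_left _ hpos]
      · intro i _ hi
        rw [if_neg]
        intro h
        rw [mul_comm] at h
        exact hi (Nat.eq_of_mul_eq_mul_left hpos h)
      · intro h
        exfalso
        refine h (Finset.mem_Icc.mpr ⟨hj, le_trans ?_ hm⟩)
        exact Nat.le_mul_of_pos_left _ hpos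
    · intro P _ hP
      rw [mem_primesOfDegreeDvd] at hP
      refine Finset.sum_eq_zero fun j hj => if_neg ?_
      rintro rfl
      have hj := (Finset.mem_Icc.mp hj).1
      exact hP ⟨Nat.mul_ne_zero (by omega) (ideg_pos k P).ne', Dvd.intro_left _ rfl⟩
  rw [hL, hL2, PowerSeries.coeff_mul,
    Finset.Nat.sum_antidiagonal_eq_sum_range_succ
      (fun i j => PowerSeries.coeff i (primeSeries k lam) * PowerSeries.coeff j (zetaSeries k lam))]
  have hR : ∀ m ∈ Finset.range n.succ,
      PowerSeries.coeff m (primeSeries k lam) * PowerSeries.coeff (n - m) (zetaSeries k lam) =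
      ∑ P ∈ s, ∑ j ∈ Finset.Icc 1 n, if j * ideg k P.asIdeal = m then
        (ideg k P.asIdeal : R) * (lam P.asIdeal ^ j *
          ∑ I ∈ idealsOfDegree k A (n - j * ideg k P.asIdeal), lam I) else 0 := by
    intro m hm
    rw [hS m (Nat.lt_succ_iff.mp (Finset.mem_range.mp hm)), zetaSeries, PowerSeries.coeff_mk]
    simp only [Finset.sum_mul]
    refine Finset.sum_congr rfl fun P _ => Finset.sum_congr rfl fun j _ => ?_
    split_ifs with h
    · rw [h, mul_assoc]
    · rw [zero_mul]
  rw [Finset.sum_congr rfl hR]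
  conv_rhs => rw [Finset.sum_comm]
  refine Finset.sum_congr rfl fun P _ => ?_
  conv_rhs => rw [Finset.sum_comm]
  refine Finset.sum_congr rfl fun j _ => ?_
  rw [Finset.sum_ite_eq]
  simp only [Finset.mem_range, Nat.lt_succ_iff]
  split_ifs <;> simp

end Ideals

section Points

variable {k A L : Type*} [Field k] [CommRing A] [IsDomain A] [Algebra k A]
  [Ring.HasFiniteQuotients A] [Infinite A] [Field L] [Finite L] [Algebra k L]

/-- The kernel of a homomorphism from `A` to a finite field, as a maximal ideal. -/
def kerPrime (φ : A →ₐ[k] L) : HeightOneSpectrum A where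
  asIdeal := RingHom.ker φ
  isPrime := RingHom.ker_isPrime φ
  ne_bot h := by
    have : Function.Injective φ := (RingHom.injective_iff_ker_eq_bot _).mpr h
    exact (Finite.of_injective φ this).false

variable [Finite k]

instance (P : HeightOneSpectrum A) : Field (A ⧸ P.asIdeal) :=
  have := Ring.HasFiniteQuotients.maximalOfPrime (P := P.asIdeal) P.ne_bot
  Ideal.Quotient.field P.asIdeal

instance (P : HeightOneSpectrum A) : Finite (A ⧸ P.asIdeal) :=
  Ring.HasFiniteQuotients.finiteQuotient P.ne_bot

omit [Finite k] [IsDomain A] in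
theorem ideg_kerPrime_dvd (φ : A →ₐ[k] L) :
    ideg k (kerPrime φ).asIdeal ∣ Module.finrank k L := by
  have : Module.Finite k L := Module.Finite.of_finite
  let ψ : (A ⧸ (kerPrime φ).asIdeal) →ₐ[k] L := Ideal.kerLiftAlg φ
  let : Algebra (A ⧸ (kerPrime φ).asIdeal) L := ψ.toRingHom.toAlgebra
  have : IsScalarTower k (A ⧸ (kerPrime φ).asIdeal) L :=
    IsScalarTower.of_algebraMap_eq fun x => (ψ.commutes x).symm
  exact Dvd.intro _ (Module.finrank_mul_finrank k (A ⧸ (kerPrime φ).asIdeal) L)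

omit [Finite k] [IsDomain A] in
theorem card_kerPrime_fiber (P : HeightOneSpectrum A)
    (hP : ideg k P.asIdeal ∣ Module.finrank k L) :
    Nat.card {φ : A →ₐ[k] L // kerPrime φ = P} = ideg k P.asIdeal := by
  have e : {φ : A →ₐ[k] L // kerPrime φ = P} ≃ ((A ⧸ P.asIdeal) →ₐ[k] L) :=
    { toFun := fun φ => Ideal.Quotient.liftₐ P.asIdeal φ.1 fun a ha => by
        rw [← φ.2] at ha; exact ha
      invFun := fun ψ => ⟨ψ.comp (Ideal.Quotient.mkₐ k P.asIdeal), by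
        ext a
        change ψ (Ideal.Quotient.mk P.asIdeal a) = 0 ↔ a ∈ P.asIdeal
        rw [map_eq_zero, Ideal.Quotient.eq_zero_iff_mem]⟩
      left_inv := fun φ => by ext a; rfl
      right_inv := fun ψ => by
        apply Ideal.Quotient.algHom_ext
        ext a; rfl }
  rw [Nat.card_congr e]
  exact FiniteField.natCard_algHom_of_finrank_dvd hP

omit [IsDomain A] in
/-- Points with values in an extension of degree `n` of the base field, sorted by the underlying
closed point. -/
theorem sum_algHom_eq_sum_primes [Fintype (A →ₐ[k] L)] {M : Type*} [AddCommMonoid M]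
    (f : HeightOneSpectrum A → M) :
    ∑ φ : A →ₐ[k] L, f (kerPrime φ) =
      ∑ P ∈ primesOfDegreeDvd k A (Module.finrank k L), ideg k P.asIdeal • f P := by
  classical
  have : Module.Finite k L := Module.Finite.of_finite
  have hpos : 0 < Module.finrank k L := Module.finrank_pos
  rw [← Finset.sum_fiberwise_of_maps_to (t := primesOfDegreeDvd k A (Module.finrank k L))
    (g := kerPrime)]
  · refine Finset.sum_congr rfl fun P hP => ?_
    rw [mem_primesOfDegreeDvd] at hP
    rw [Finset.sum_congr rfl (g := fun _ => f P)
      (fun φ hφ => by rw [(Finset.mem_filter.mp hφ).2]), Finset.sum_const]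
    congr 1
    rw [← card_kerPrime_fiber (L := L) P hP.2, Nat.card_eq_fintype_card, Fintype.card_subtype]
  · intro φ _
    exact (mem_primesOfDegreeDvd k).mpr ⟨hpos.ne', ideg_kerPrime_dvd φ⟩

end Points

end

/-! ### The coordinate ring of a smooth Weierstrass curve is a Dedekind domain -/

section

open Polynomial IsDedekindDomain UniqueFactorizationMonoid WeierstrassCurve

instance polynomial_hasFiniteQuotients {k : Type*} [Field k] [Finite k] :
    Ring.HasFiniteQuotients k[X] where
  finiteQuotient {I} hI := by
    obtain ⟨f, rfl⟩ := IsPrincipalIdealRing.principal I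
    have hf : f ≠ 0 := by rintro rfl; simp at hI
    have : Module.Finite k (AdjoinRoot f) := (AdjoinRoot.powerBasis hf).finite
    exact Module.finite_of_finite (M := AdjoinRoot f) k

/-- In an integrally closed domain `R`, an element `b` divides `a` as soon as `a / b` is
integral. -/
theorem dvd_of_isIntegral {R K : Type*} [CommRing R] [IsDomain R] [IsIntegrallyClosed R] [Field K]
    [Algebra R K] (hinj : Function.Injective (algebraMap R K)) {a b : R} (hb : b ≠ 0) {z : K}
    (hz : IsIntegral R z) (h : algebraMap R K b * z = algebraMap R K a) : b ∣ a := by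
  have : FaithfulSMul R K := (faithfulSMul_iff_algebraMap_injective R K).mpr hinj
  let φ : FractionRing R →ₐ[R] K := IsFractionRing.liftAlgHom (g := Algebra.ofId R K) hinj
  have hb' : algebraMap R (FractionRing R) b ≠ 0 :=
    fun h0 => hb (IsFractionRing.injective R (FractionRing R) (by rw [h0, map_zero]))
  set y : FractionRing R := algebraMap R _ a / algebraMap R _ b with hy
  have hφ : φ y = z := by
    have hb2 : algebraMap R K b ≠ 0 := fun h0 => hb (hinj (by rw [h0, map_zero]))
    rw [hy, map_div₀, AlgHom.commutes, AlgHom.commutes, ← h, mul_div_cancel_left₀ _ hb2]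
  have hyi : IsIntegral R y := by
    rw [← hφ] at hz
    exact (isIntegral_algHom_iff φ φ.toRingHom.injective).mp hz
  obtain ⟨c, hc⟩ := IsIntegrallyClosed.isIntegral_iff.mp hyi
  refine ⟨c, IsFractionRing.injective R (FractionRing R) ?_⟩
  rw [map_mul, hc, hy, mul_div_cancel₀ _ hb']

theorem dvd_of_sq_dvd_sq_mul_squarefree {R : Type*} [EuclideanDomain R] {f g q : R}
    (hf : Squarefree f) (h : g ^ 2 ∣ q ^ 2 * f) : g ∣ q := by
  classical
  by_cases hg : g = 0
  · subst hg
    rw [zero_pow two_ne_zero, zero_dvd_iff] at h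
    rw [zero_dvd_iff]
    exact pow_eq_zero_iff two_ne_zero |>.mp ((mul_eq_zero.mp h).resolve_right hf.ne_zero)
  · obtain ⟨e, g', q', he, hc, rfl, rfl⟩ : ∃ e g' q', e ≠ 0 ∧ IsCoprime g' q' ∧ g = e * g' ∧
        q = e * q' := by
      have he : EuclideanDomain.gcd g q ≠ 0 := fun h0 => hg (EuclideanDomain.gcd_eq_zero_iff.mp h0).1
      obtain ⟨g', hg'⟩ := EuclideanDomain.gcd_dvd_left g q
      obtain ⟨q', hq'⟩ := EuclideanDomain.gcd_dvd_right g q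
      refine ⟨_, g', q', he, ?_, hg', hq'⟩
      refine ⟨EuclideanDomain.gcdA g q, EuclideanDomain.gcdB g q, mul_left_cancel₀ he ?_⟩
      linear_combination -EuclideanDomain.gcdA g q * hg' - EuclideanDomain.gcdB g q * hq' -
        EuclideanDomain.gcd_eq_gcd_ab g q
    have h2 : g' ^ 2 ∣ q' ^ 2 * f := by
      obtain ⟨c, hc⟩ := h
      refine ⟨c, mul_left_cancel₀ (pow_ne_zero 2 he) ?_⟩
      linear_combination hc
    have h3 : g' ^ 2 ∣ f := (hc.pow (m := 2) (n := 2)).dvd_of_dvd_mul_left h2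
    rw [sq] at h3
    exact mul_dvd_mul_left e ((hf g' h3).dvd)

/-- If `2` is a unit in the Euclidean domain `R`, and `f ∈ R` is squarefree, then `R[√f]` is
integrally closed. If `(p + q √f) / g` is integral over `R`, then so are its trace `2 p / g` and the
square `4 q² f / g²` of its difference with its conjugate, so `g` divides `p` and `q`. -/
theorem isIntegrallyClosed_of_quadratic {R A : Type*} [EuclideanDomain R] [IsIntegrallyClosed R]
    [CommRing A] [IsDomain A] [Algebra R A] [FaithfulSMul R A] [Algebra.IsIntegral R A]
    (h2 : IsUnit (2 : R)) {f : R} (hf : Squarefree f) {η : A} (hη : η ^ 2 = algebraMap R A f)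
    (hspan : ∀ z : A, ∃ p q : R, z = algebraMap R A p + algebraMap R A q * η)
    (σ : A →ₐ[R] A) (hση : σ η = -η) : IsIntegrallyClosed A := by
  have hnorm : ∀ p q : R, (algebraMap R A p + algebraMap R A q * η) *
      (algebraMap R A p - algebraMap R A q * η) = algebraMap R A (p ^ 2 - q ^ 2 * f) := by
    intro p q
    rw [map_sub, map_mul, map_pow, map_pow, ← hη]; ring
  have hconj : ∀ p q : R, σ (algebraMap R A p + algebraMap R A q * η) =
      algebraMap R A p - algebraMap R A q * η := by
    intro p q
    rw [map_add, map_mul, AlgHom.commutes, AlgHom.commutes, hση]; ring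
  have hinj : Function.Injective σ := by
    have : ∀ z, σ (σ z) = z := by
      intro z
      obtain ⟨p, q, rfl⟩ := hspan z
      rw [hconj, map_sub, map_mul, AlgHom.commutes, AlgHom.commutes, hση]
      ring
    exact Function.LeftInverse.injective this
  have hAK : Function.Injective (algebraMap A (FractionRing A)) :=
    IsFractionRing.injective A (FractionRing A)
  have hRK : Function.Injective (algebraMap R (FractionRing A)) := by
    rw [IsScalarTower.algebraMap_eq R A (FractionRing A)]
    exact hAK.comp (FaithfulSMul.algebraMap_injective R A)
  have hσinj : Function.Injective ((IsScalarTower.toAlgHom R A (FractionRing A)).comp σ) :=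
    hAK.comp hinj
  let τ : FractionRing A →ₐ[R] FractionRing A := IsFractionRing.liftAlgHom hσinj
  have hτ : ∀ z : A, τ (algebraMap A _ z) = algebraMap A _ (σ z) := fun z =>
    IsFractionRing.lift_algebraMap hσinj z
  rw [isIntegrallyClosed_iff (FractionRing A)]
  intro x hx
  have hx' : IsIntegral R x := isIntegral_trans x hx
  -- rationalise the denominator
  obtain ⟨p, q, g, hg, hgx⟩ : ∃ p q g : R, g ≠ 0 ∧ algebraMap R (FractionRing A) g * x =
      algebraMap A (FractionRing A) (algebraMap R A p + algebraMap R A q * η) := by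
    obtain ⟨a, b, hb, rfl⟩ := IsFractionRing.div_surjective (A := A) x
    have hb0 : b ≠ 0 := nonZeroDivisors.ne_zero hb
    obtain ⟨b₁, b₂, rfl⟩ := hspan b
    obtain ⟨p, q, hpq⟩ := hspan (a * (algebraMap R A b₁ - algebraMap R A b₂ * η))
    refine ⟨p, q, b₁ ^ 2 - b₂ ^ 2 * f, ?_, ?_⟩
    · intro h0
      have h1 := hnorm b₁ b₂
      rw [h0, map_zero] at h1
      have h3 := (mul_eq_zero.mp h1).resolve_left hb0
      rw [← hconj] at h3
      exact hb0 (hinj (by rw [h3, map_zero]))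
    · rw [← hpq, IsScalarTower.algebraMap_apply R A (FractionRing A), ← hnorm, map_mul, map_mul]
      have : algebraMap A (FractionRing A) (algebraMap R A b₁ + algebraMap R A b₂ * η) ≠ 0 :=
        fun h0 => hb0 (hAK (by rw [h0, map_zero]))
      field_simp
  have hτx : IsIntegral R (τ x) := hx'.map τ
  have hgτ : algebraMap R (FractionRing A) g * τ x =
      algebraMap A (FractionRing A) (algebraMap R A p - algebraMap R A q * η) := by
    rw [← hconj, ← hτ, ← hgx, map_mul, AlgHom.commutes]
  rw [map_add, map_mul] at hgx
  rw [map_sub, map_mul] at hgτ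
  simp only [← IsScalarTower.algebraMap_apply R A (FractionRing A)] at hgx hgτ
  have hη' : algebraMap A (FractionRing A) η ^ 2 = algebraMap R (FractionRing A) f := by
    rw [← map_pow, hη, ← IsScalarTower.algebraMap_apply R A (FractionRing A)]
  have hp : g ∣ p := by
    have : g ∣ 2 * p := dvd_of_isIntegral hRK hg (hx'.add hτx) (by
      rw [map_mul, map_ofNat]; linear_combination hgx + hgτ)
    exact h2.dvd_mul_left.mp this
  have hq : g ∣ q := by
    have h3 : g ^ 2 ∣ 2 ^ 2 * (q ^ 2 * f) :=
      dvd_of_isIntegral hRK (pow_ne_zero 2 hg) ((hx'.sub hτx).pow 2) (by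
        rw [map_mul, map_mul, map_pow, map_pow, map_pow, map_ofNat, ← hη']
        have h4 : algebraMap R (FractionRing A) g * (x - τ x) =
            2 * (algebraMap R (FractionRing A) q * algebraMap A (FractionRing A) η) := by
          linear_combination hgx - hgτ
        rw [← mul_pow, h4]; ring)
    exact dvd_of_sq_dvd_sq_mul_squarefree hf ((h2.pow 2).dvd_mul_left.mp h3)
  obtain ⟨p', rfl⟩ := hp
  obtain ⟨q', rfl⟩ := hq
  refine ⟨algebraMap R A p' + algebraMap R A q' * η, ?_⟩
  have hg' : algebraMap R (FractionRing A) g ≠ 0 := fun h0 => hg (hRK (by rw [h0, map_zero]))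
  refine mul_left_cancel₀ hg' ?_
  rw [hgx, map_add, map_mul]
  simp only [← IsScalarTower.algebraMap_apply R A (FractionRing A), map_mul]
  ring

section Curve

variable {k : Type*} [Field k] (W : WeierstrassCurve.Affine k)

/-- The right-hand side of the equation of a Weierstrass curve once the square is completed. -/
abbrev cubicRHS : k[X] := C 4 * X ^ 3 + C W.b₂ * X ^ 2 + C (2 * W.b₄) * X + C W.b₆

variable {W}

theorem squarefree_cubicRHS (h2 : (2 : k) ≠ 0) (hΔ : W.Δ ≠ 0) : Squarefree (cubicRHS W) := by
  have h4 : (4 : k) ≠ 0 := by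
    have : (4 : k) = 2 * 2 := by norm_num
    rw [this]; exact mul_ne_zero h2 h2
  have hdeg : (cubicRHS W).natDegree = 3 := natDegree_cubic h4
  have hne : cubicRHS W ≠ 0 := by
    intro h; rw [h] at hdeg; simp at hdeg
  rintro g ⟨h, hgh⟩
  have hg : g ≠ 0 := by rintro rfl; simp at hgh; exact hne hgh
  have hh : h ≠ 0 := by rintro rfl; simp at hgh; exact hne hgh
  by_contra hu
  have hd : g.natDegree + g.natDegree + h.natDegree = 3 := by
    rw [← hdeg, hgh, natDegree_mul (mul_ne_zero hg hg) hh, natDegree_mul hg hg]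
  have hg0 : g.natDegree ≠ 0 := fun h0 => hu (isUnit_iff_degree_eq_zero.mpr
    ((degree_eq_iff_natDegree_eq hg).mpr h0))
  have hg1 : g.degree = 1 := (degree_eq_iff_natDegree_eq_of_pos one_pos).mpr (by omega)
  obtain ⟨r, hr⟩ := exists_root_of_degree_eq_one hg1
  have e1 : (cubicRHS W).eval r = 0 := by rw [hgh]; simp [hr.eq_zero]
  have e2 : (derivative (cubicRHS W)).eval r = 0 := by rw [hgh]; simp [hr.eq_zero]
  simp [cubicRHS] at e1 e2
  -- a double root `r` determines `b₄` and `b₆`, and the discriminant then vanishes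
  refine hΔ ?_
  have hb4 : W.b₄ = -6 * r ^ 2 - W.b₂ * r := mul_left_cancel₀ h2 (by linear_combination e2)
  have hb6 : W.b₆ = 8 * r ^ 3 + W.b₂ * r ^ 2 := by
    rw [hb4] at e1
    linear_combination e1
  have hb8 := W.b_relation
  have : 4 * W.Δ = 0 := by
    rw [WeierstrassCurve.Δ]
    rw [show 4 * (-W.b₂ ^ 2 * W.b₈ - 8 * W.b₄ ^ 3 - 27 * W.b₆ ^ 2 + 9 * W.b₂ * W.b₄ * W.b₆) =
      -W.b₂ ^ 2 * (4 * W.b₈) - 32 * W.b₄ ^ 3 - 108 * W.b₆ ^ 2 + 36 * W.b₂ * W.b₄ * W.b₆ by ring,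
      hb8, hb6, hb4]
    ring
  exact (mul_eq_zero.mp this).resolve_left h4

theorem eval₂_negPolynomial_eq_zero (W : WeierstrassCurve.Affine k) :
    W.polynomial.eval₂ (AdjoinRoot.of W.polynomial)
      (Affine.CoordinateRing.mk W W.negPolynomial) = 0 := by
  have h : W.polynomial.eval₂ (AdjoinRoot.of W.polynomial)
      (Affine.CoordinateRing.mk W W.negPolynomial) =
      Affine.CoordinateRing.mk W (W.polynomial.eval₂ C W.negPolynomial) := by
    rw [hom_eval₂]; rfl
  refine h.trans (AdjoinRoot.mk_eq_zero.mpr ⟨1, ?_⟩)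
  rw [Affine.polynomial]
  simp only [eval₂_add, eval₂_sub, eval₂_mul, eval₂_pow, eval₂_X, eval₂_C]
  rw [Affine.negPolynomial]
  ring

/-- The conjugation `Y ↦ -Y - a₁ X - a₃` of the coordinate ring. -/
def conj (W : WeierstrassCurve.Affine k) : W.CoordinateRing →ₐ[k[X]] W.CoordinateRing :=
  AdjoinRoot.liftAlgHom W.polynomial (Algebra.ofId k[X] W.CoordinateRing)
    (Affine.CoordinateRing.mk W W.negPolynomial) (eval₂_negPolynomial_eq_zero W)

/-- The element `2 Y + a₁ X + a₃` of the coordinate ring. -/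
def eta (W : WeierstrassCurve.Affine k) : W.CoordinateRing :=
  Affine.CoordinateRing.mk W (2 * X + C (C W.a₁ * X + C W.a₃))

theorem conj_mk (f : k[X][X]) : conj W (Affine.CoordinateRing.mk W f) =
    Affine.CoordinateRing.mk W (f.eval₂ C W.negPolynomial) := by
  rw [hom_eval₂]
  exact AdjoinRoot.lift_mk (eval₂_negPolynomial_eq_zero W) f

theorem conj_eta : conj W (eta W) = -eta W := by
  rw [eta, conj_mk, ← map_neg]
  congr 1
  simp only [eval₂_add, eval₂_mul, eval₂_X, eval₂_C, eval₂_ofNat]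
  rw [Affine.negPolynomial]
  ring

theorem eta_sq : eta W ^ 2 = algebraMap k[X] W.CoordinateRing (cubicRHS W) := by
  change Affine.CoordinateRing.mk W _ ^ 2 = Affine.CoordinateRing.mk W (C (cubicRHS W))
  rw [← map_pow]
  refine AdjoinRoot.mk_eq_mk.mpr ⟨4, ?_⟩
  rw [Affine.polynomial, cubicRHS, b₂, b₄, b₆]
  simp only [map_ofNat, C_add, C_mul, C_pow]
  ring

theorem exists_eq_add_mul_eta (h2 : (2 : k) ≠ 0) (z : W.CoordinateRing) :
    ∃ p q : k[X], z = algebraMap k[X] _ p + algebraMap k[X] _ q * eta W := by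
  obtain ⟨p, q, rfl⟩ := Affine.CoordinateRing.exists_smul_basis_eq z
  have hc : (C 2⁻¹ * 2 : k[X]) = 1 := by
    rw [← map_ofNat C 2, ← C_mul, inv_mul_cancel₀ h2, C_1]
  refine ⟨p - C 2⁻¹ * q * (C W.a₁ * X + C W.a₃), C 2⁻¹ * q, ?_⟩
  rw [Affine.CoordinateRing.smul, Affine.CoordinateRing.smul, mul_one, ← map_mul, ← map_add]
  change _ = Affine.CoordinateRing.mk W (C (p - C 2⁻¹ * q * (C W.a₁ * X + C W.a₃))) +
    Affine.CoordinateRing.mk W (C (C 2⁻¹ * q)) * eta W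
  rw [eta, ← map_mul, ← map_add]
  congr 1
  have hc' := congrArg (C : k[X] → k[X][X]) hc
  simp only [map_mul, map_sub, map_add, map_ofNat, map_one] at hc' ⊢
  linear_combination (-C q * X) * hc'

instance : Module.Finite k[X] W.CoordinateRing :=
  Module.Finite.of_basis (Affine.CoordinateRing.basis W)

instance [Finite k] : Ring.HasFiniteQuotients W.CoordinateRing :=
  Ring.HasFiniteQuotients.of_module_finite k[X] W.CoordinateRing

theorem algebraMap_coordinateRing_injective :
    Function.Injective (algebraMap k[X] W.CoordinateRing) :=
  FaithfulSMul.algebraMap_injective _ _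

instance : Infinite W.CoordinateRing := Infinite.of_injective _ algebraMap_coordinateRing_injective

theorem isIntegrallyClosed_coordinateRing (h2 : (2 : k) ≠ 0) (hΔ : W.Δ ≠ 0) :
    IsIntegrallyClosed W.CoordinateRing := by
  refine isIntegrallyClosed_of_quadratic (R := k[X]) ?_ (squarefree_cubicRHS h2 hΔ) eta_sq
    (exists_eq_add_mul_eta h2) (conj W) conj_eta
  rw [← map_ofNat C 2]
  exact isUnit_C.mpr (isUnit_iff_ne_zero.mpr h2)

theorem isDedekindDomain_coordinateRing [Finite k] (h2 : (2 : k) ≠ 0) (hΔ : W.Δ ≠ 0) :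
    IsDedekindDomain W.CoordinateRing :=
  have := isIntegrallyClosed_coordinateRing h2 hΔ
  { }

end Curve

end

/-! ### Riemann-Roch spaces of a Weierstrass curve -/

section

open Polynomial IsDedekindDomain UniqueFactorizationMonoid WeierstrassCurve

section RiemannRoch

/-- A product of submodules is linearly equivalent to the product of the underlying modules. -/
def submoduleProdEquiv {k M N : Type*} [Semiring k] [AddCommMonoid M] [AddCommMonoid N]
    [Module k M] [Module k N] (p : Submodule k M) (q : Submodule k N) :
    p.prod q ≃ₗ[k] p × q where
  toFun z := (⟨z.1.1, z.2.1⟩, ⟨z.1.2, z.2.2⟩)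
  map_add' _ _ := rfl
  map_smul' _ _ := rfl
  invFun z := ⟨(z.1.1, z.2.1), z.1.2, z.2.2⟩
  left_inv _ := rfl
  right_inv _ := rfl

variable {k : Type*} [Field k] (W : WeierstrassCurve.Affine k)

/-- The `k`-linear isomorphism `(p, q) ↦ p + q Y` onto the coordinate ring. -/
def coordinateEquiv : (k[X] × k[X]) ≃ₗ[k] W.CoordinateRing :=
  LinearEquiv.ofBijective
    { toFun := fun f => f.1 • (1 : W.CoordinateRing) + f.2 • Affine.CoordinateRing.mk W X
      map_add' := fun f g => by simp only [Prod.fst_add, Prod.snd_add, add_smul]; abel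
      map_smul' := fun c f => by
        simp only [Prod.smul_fst, Prod.smul_snd, smul_assoc, smul_add, RingHom.id_apply] }
    ⟨by
      intro f g h
      have h' : (f.1 - g.1) • (1 : W.CoordinateRing) +
          (f.2 - g.2) • Affine.CoordinateRing.mk W X = 0 := by
        rw [sub_smul, sub_smul]
        have := sub_eq_zero.mpr h
        simp only [LinearMap.coe_mk, AddHom.coe_mk] at this
        rw [← this]; abel
      obtain ⟨h1, h2⟩ := Affine.CoordinateRing.smul_basis_eq_zero h'
      exact Prod.ext (sub_eq_zero.mp h1) (sub_eq_zero.mp h2), by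
      intro z
      obtain ⟨p, q, h⟩ := Affine.CoordinateRing.exists_smul_basis_eq z
      exact ⟨(p, q), h⟩⟩

/-- The Riemann-Roch space of the functions whose only pole is at infinity, of order at most `m`:
the elements `p + q Y` with `2 deg p ≤ m` and `2 deg q + 3 ≤ m`. -/
def poleSpace (m : ℕ) : Submodule k W.CoordinateRing :=
  ((degreeLT k (m / 2 + 1)).prod (degreeLT k ((m - 1) / 2))).map
    (coordinateEquiv W : (k[X] × k[X]) →ₗ[k] W.CoordinateRing)

variable {W}

theorem ideg_span_eq {z : W.CoordinateRing} (hz : z ≠ 0) :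
    ideg k (Ideal.span {z}) = (Algebra.norm k[X] z).natDegree :=
  finrank_quotient_span_eq_natDegree_norm (Affine.CoordinateRing.basis W) hz

/-- The order of the pole of `z` at infinity is the degree of its divisor of zeros on the affine
curve. -/
theorem mem_poleSpace {m : ℕ} {z : W.CoordinateRing} :
    z ∈ poleSpace W m ↔ z = 0 ∨ ideg k (Ideal.span {z}) ≤ m := by
  obtain ⟨⟨p, q⟩, rfl⟩ := (coordinateEquiv W).surjective z
  have h1 : coordinateEquiv W (p, q) ∈ poleSpace W m ↔
      p.degree < ((m / 2 + 1 : ℕ) : WithBot ℕ) ∧ q.degree < (((m - 1) / 2 : ℕ) : WithBot ℕ) := by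
    rw [poleSpace, Submodule.mem_map]
    constructor
    · rintro ⟨f, hf, h⟩
      have := (coordinateEquiv W).injective h
      subst this
      exact ⟨mem_degreeLT.mp hf.1, mem_degreeLT.mp hf.2⟩
    · rintro ⟨h1, h2⟩
      exact ⟨(p, q), ⟨mem_degreeLT.mpr h1, mem_degreeLT.mpr h2⟩, rfl⟩
  rw [h1]
  by_cases hz : coordinateEquiv W (p, q) = 0
  · have h0 : (p, q) = 0 := (coordinateEquiv W).map_eq_zero_iff.mp hz
    rw [Prod.mk_eq_zero] at h0
    obtain ⟨rfl, rfl⟩ := h0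
    simp
  · rw [ideg_span_eq hz]
    have hd := Affine.CoordinateRing.degree_norm_smul_basis (W' := W) p q
    change (Algebra.norm k[X] (coordinateEquiv W (p, q))).degree = _ at hd
    rw [natDegree_le_iff_degree_le, hd, max_le_iff]
    simp only [hz, false_or]
    refine and_congr ?_ ?_
    · rcases eq_or_ne p 0 with rfl | hp
      · simp
      · rw [degree_eq_natDegree hp, Nat.cast_lt, two_nsmul]
        norm_cast
        omega
    · rcases eq_or_ne q 0 with rfl | hq
      · simp
      · rw [degree_eq_natDegree hq, Nat.cast_lt, two_nsmul]
        norm_cast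
        omega

instance (n : ℕ) : Module.Finite k (degreeLT k n) :=
  Module.Finite.equiv (degreeLTEquiv k n).symm

theorem finrank_degreeLT (n : ℕ) : Module.finrank k (degreeLT k n) = n := by
  rw [(degreeLTEquiv k n).finrank_eq, Module.finrank_fin_fun]

instance (m : ℕ) : Module.Finite k (poleSpace W m) := by
  have : Module.Finite k ((degreeLT k (m / 2 + 1)).prod (degreeLT k ((m - 1) / 2))) :=
    Module.Finite.equiv (submoduleProdEquiv _ _).symm
  exact Module.Finite.map _ _

/-- Riemann-Roch for the divisor `m ∞`. -/
theorem finrank_poleSpace (m : ℕ) : Module.finrank k (poleSpace W m) = max m 1 := by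
  rw [poleSpace, LinearEquiv.finrank_map_eq, (submoduleProdEquiv _ _).finrank_eq,
    Module.finrank_prod, finrank_degreeLT, finrank_degreeLT]
  omega

theorem one_mem_poleSpace (m : ℕ) : (1 : W.CoordinateRing) ∈ poleSpace W m := by
  rw [mem_poleSpace, Ideal.span_singleton_one, ideg_top]
  exact Or.inr (Nat.zero_le m)

theorem poleSpace_mono {m n : ℕ} (h : m ≤ n) : poleSpace W m ≤ poleSpace W n := by
  intro z hz
  rw [mem_poleSpace] at hz ⊢
  exact hz.imp_right fun h' => h'.trans h

/-- There is no function with a single simple pole at infinity. -/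
theorem exists_smul_one_of_mem_poleSpace_one {z : W.CoordinateRing} (hz : z ∈ poleSpace W 1) :
    ∃ c : k, z = c • 1 := by
  have h1 : Module.finrank k (poleSpace W 1) = 1 := by rw [finrank_poleSpace]; rfl
  obtain ⟨c, hc⟩ := exists_smul_eq_of_finrank_eq_one h1
    (x := ⟨1, one_mem_poleSpace 1⟩) (fun h => one_ne_zero (congrArg Subtype.val h)) ⟨z, hz⟩
  exact ⟨c, (congrArg Subtype.val hc).symm⟩

/-- The rank theorem for the reduction modulo `I` of the functions in `poleSpace W m`. -/
theorem finrank_inf_poleSpace (I : Ideal W.CoordinateRing) (m : ℕ) :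
    Module.finrank k (I.restrictScalars k ⊓ poleSpace W m : Submodule k W.CoordinateRing) +
      Module.finrank k (LinearMap.range
        ((Ideal.Quotient.mkₐ k I).toLinearMap.domRestrict (poleSpace W m))) = max m 1 := by
  rw [← finrank_poleSpace (W := W) m, ← LinearMap.finrank_range_add_finrank_ker
    ((Ideal.Quotient.mkₐ k I).toLinearMap.domRestrict (poleSpace W m)), add_comm]
  congr 1
  rw [← Submodule.finrank_map_subtype_eq]
  have : I.restrictScalars k ⊓ poleSpace W m = (LinearMap.ker
      ((Ideal.Quotient.mkₐ k I).toLinearMap.domRestrict (poleSpace W m))).map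
        (poleSpace W m).subtype := by
    ext z
    simp only [Submodule.mem_inf, Submodule.restrictScalars_mem, Submodule.mem_map,
      LinearMap.mem_ker, Submodule.subtype_apply, Subtype.exists]
    constructor
    · rintro ⟨h1, h2⟩
      exact ⟨z, h2, Ideal.Quotient.eq_zero_iff_mem.mpr h1, rfl⟩
    · rintro ⟨z, h2, h1, rfl⟩
      exact ⟨Ideal.Quotient.eq_zero_iff_mem.mp h1, h2⟩
  rw [this]

/-- Riemann-Roch for the divisor `m ∞ - P`, where `P` is a point. -/
theorem finrank_inf_poleSpace_of_ideg_eq_one {I : Ideal W.CoordinateRing} (hd : ideg k I = 1) (m : ℕ) :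
    Module.finrank k (I.restrictScalars k ⊓ poleSpace W m : Submodule k W.CoordinateRing) =
      m - 1 := by
  have h := finrank_inf_poleSpace I m
  have htop : I ≠ ⊤ := fun h0 => by rw [h0, ideg_top] at hd; exact zero_ne_one hd
  have hsurj : Function.Surjective
      ((Ideal.Quotient.mkₐ k I).toLinearMap.domRestrict (poleSpace W m)) := by
    refine surjective_of_nonzero_of_finrank_eq_one hd fun h0 => ?_
    have h1 := DFunLike.congr_fun h0 ⟨1, one_mem_poleSpace m⟩
    exact htop ((Ideal.eq_top_iff_one I).mpr (Ideal.Quotient.eq_zero_iff_mem.mp h1))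
  rw [LinearMap.range_eq_top.mpr hsurj, finrank_top] at h
  change _ + ideg k I = _ at h
  omega

variable [Finite k] [IsDedekindDomain W.CoordinateRing]

/-- Riemann-Roch for the divisor of degree one `(n + 1) ∞ - I`, where `I` is an effective divisor of
degree `n`: the space of sections is a line. -/
theorem finrank_inf_poleSpace_succ {I : Ideal W.CoordinateRing} (hI : I ≠ ⊥) {n : ℕ} (hn : 1 ≤ n)
    (hd : ideg k I = n) :
    Module.finrank k (I.restrictScalars k ⊓ poleSpace W (n + 1) : Submodule k W.CoordinateRing) =
      1 := by
  have := Ring.HasFiniteQuotients.finiteQuotient hI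
  have : Module.Finite k (W.CoordinateRing ⧸ I) := Module.Finite.of_finite
  apply le_antisymm
  · by_cases hc : ∃ z ∈ I.restrictScalars k ⊓ poleSpace W n, z ≠ 0
    · -- a function vanishing on `I` with a pole of order at most `n` generates `I`
      obtain ⟨z, ⟨hzI, hzn⟩, hz0⟩ := hc
      rw [SetLike.mem_coe, mem_poleSpace, or_iff_right hz0] at hzn
      have hspan0 : Ideal.span {z} ≠ ⊥ := by simpa using hz0
      obtain ⟨J, hJ⟩ : I ∣ Ideal.span {z} :=
        Ideal.dvd_iff_le.mpr ((Ideal.span_singleton_le_iff_mem I).mpr hzI)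
      have hJ0 : J ≠ ⊥ := by rintro rfl; rw [Ideal.mul_bot] at hJ; exact hspan0 hJ
      rw [hJ, ideg_mul k hI hJ0, hd] at hzn
      have hJt : J = ⊤ := (ideg_eq_zero_iff k hJ0).mp (by omega)
      rw [hJt, Ideal.mul_top] at hJ
      refine finrank_le_one ⟨z, hzI, poleSpace_mono (Nat.le_succ n)
        (mem_poleSpace.mpr (Or.inr (by rw [hJ, hd])))⟩ ?_
      rintro ⟨w, hwI, hwn⟩
      rw [SetLike.mem_coe, Submodule.restrictScalars_mem, ← hJ, Ideal.mem_span_singleton'] at hwI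
      obtain ⟨c, rfl⟩ := hwI
      obtain ⟨a, rfl⟩ : ∃ a : k, c = a • 1 := by
        rcases eq_or_ne c 0 with rfl | hc0
        · exact ⟨0, by simp⟩
        · refine exists_smul_one_of_mem_poleSpace_one (mem_poleSpace.mpr (Or.inr ?_))
          rw [SetLike.mem_coe, mem_poleSpace, or_iff_right (mul_ne_zero hc0 hz0),
            ← Ideal.span_singleton_mul_span_singleton, ideg_mul k (by simpa using hc0) hspan0,
            hJ, hd] at hwn
          omega
      exact ⟨a, Subtype.ext (by simp)⟩
    · -- no nonzero section has a pole of order at most `n`, and `poleSpace W n` has codimension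
      -- one in `poleSpace W (n + 1)`
      have hdisj : I.restrictScalars k ⊓ poleSpace W (n + 1) ⊓ poleSpace W n = ⊥ := by
        rw [eq_bot_iff]
        rintro z ⟨⟨h1, -⟩, h2⟩
        by_contra h0
        exact hc ⟨z, ⟨h1, h2⟩, h0⟩
      have h1 := Submodule.finrank_sup_add_finrank_inf_eq
        (I.restrictScalars k ⊓ poleSpace W (n + 1)) (poleSpace W n)
      rw [hdisj, finrank_bot, finrank_poleSpace] at h1
      have h2 := Submodule.finrank_mono
        (sup_le inf_le_right (poleSpace_mono (Nat.le_succ n)) :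
          I.restrictScalars k ⊓ poleSpace W (n + 1) ⊔ poleSpace W n ≤ poleSpace W (n + 1))
      rw [finrank_poleSpace] at h2
      omega
  · -- vanishing on `I` imposes at most `n` linear conditions on a space of dimension `n + 1`
    have h1 := finrank_inf_poleSpace I (n + 1)
    have h2 := Submodule.finrank_le (LinearMap.range
        ((Ideal.Quotient.mkₐ k I).toLinearMap.domRestrict (poleSpace W (n + 1))))
    change _ ≤ ideg k I at h2
    omega

end RiemannRoch

end

/-! ### The zeta function of a smooth Weierstrass curve -/

section

open Polynomial IsDedekindDomain UniqueFactorizationMonoid WeierstrassCurve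

section ComplementaryIdeals

variable {k A : Type*} [Field k] [Finite k] [CommRing A] [Algebra k A]
  [Ring.HasFiniteQuotients A] [IsDedekindDomain A] [Infinite A]

open Classical in
theorem card_filter_ideals_mem_le {z : A} (hz : z ≠ 0) {n e : ℕ}
    (he : ideg k (Ideal.span {z}) = n + e) :
    ((idealsOfDegree k A n).filter (z ∈ ·)).card ≤
      ((idealsOfDegree k A e).filter (z ∈ ·)).card := by
  have hspan0 : Ideal.span {z} ≠ ⊥ := by simpa using hz
  have h : ∀ I : Ideal A, z ∈ I → ∃ J, Ideal.span {z} = I * J := fun I hI =>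
    Ideal.dvd_iff_le.mpr ((Ideal.span_singleton_le_iff_mem I).mpr hI)
  choose! J hJ using h
  refine Finset.card_le_card_of_injOn J ?_ ?_
  · intro I hI
    simp only [Finset.coe_filter, mem_idealsOfDegree, Set.mem_ofPred_eq] at hI ⊢
    obtain ⟨⟨hI0, hId⟩, hzI⟩ := hI
    have hIJ := hJ I hzI
    have hJ0 : J I ≠ ⊥ := fun h0 => hspan0 (by rw [hIJ, h0, Ideal.mul_bot])
    rw [hIJ, ideg_mul k hI0 hJ0, hId] at he
    refine ⟨⟨hJ0, by omega⟩, ?_⟩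
    have : z ∈ I * J I := by rw [← hIJ]; exact Ideal.mem_span_singleton_self z
    exact (Ideal.mul_le_right : I * J I ≤ J I) this
  · intro I hI I' hI' hII'
    simp only [Finset.coe_filter, mem_idealsOfDegree, Set.mem_ofPred_eq] at hI hI'
    have h1 := hJ I hI.2
    have h2 := hJ I' hI'.2
    have hJ0 : J I ≠ 0 := fun h0 => hspan0 (by rw [h1, h0, mul_zero]; rfl)
    rw [← hII', h1] at h2
    exact mul_right_cancel₀ hJ0 h2

open Classical in
/-- The ideals of degree `n` containing a function `z` correspond to those of complementary degree,
by dividing the divisor of zeros of `z`. -/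
theorem card_filter_ideals_mem {z : A} (hz : z ≠ 0) {n e : ℕ}
    (he : ideg k (Ideal.span {z}) = n + e) :
    ((idealsOfDegree k A n).filter (z ∈ ·)).card =
      ((idealsOfDegree k A e).filter (z ∈ ·)).card :=
  le_antisymm (card_filter_ideals_mem_le hz he)
    (card_filter_ideals_mem_le hz (he.trans (add_comm n e)))

omit [IsDedekindDomain A] [Infinite A] in
theorem idealsOfDegree_zero [Nontrivial A] : idealsOfDegree k A 0 = {⊤} := by
  ext I
  rw [mem_idealsOfDegree, Finset.mem_singleton]
  constructor
  · rintro ⟨h1, h2⟩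
    exact (ideg_eq_zero_iff k h1).mp h2
  · rintro rfl
    exact ⟨top_ne_bot, ideg_top k⟩

end ComplementaryIdeals

section CountIdeals

variable {k : Type*} [Field k] [Finite k] {W : WeierstrassCurve.Affine k}

instance (m : ℕ) : Finite (poleSpace W m) := Module.finite_of_finite k

variable (W) in
/-- The elements of `poleSpace W m`, as a finite set. -/
def poleFinset (m : ℕ) : Finset W.CoordinateRing :=
  (Set.finite_coe_iff.mp (inferInstanceAs (Finite (poleSpace W m))) :
    (poleSpace W m : Set W.CoordinateRing).Finite).toFinset

theorem mem_poleFinset {m : ℕ} {z : W.CoordinateRing} :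
    z ∈ poleFinset W m ↔ z ∈ poleSpace W m := by simp [poleFinset]

theorem card_poleFinset (m : ℕ) : (poleFinset W m).card = Nat.card k ^ max m 1 := by
  rw [← finrank_poleSpace (W := W) m, ← Module.natCard_eq_pow_finrank]
  exact (Nat.subtype_card _ fun _ => mem_poleFinset).symm

open Classical in
theorem card_filter_mem_poleFinset (I : Ideal W.CoordinateRing) (m : ℕ) :
    ((poleFinset W m).filter (· ∈ I)).card = Nat.card k ^ Module.finrank k
      (I.restrictScalars k ⊓ poleSpace W m : Submodule k W.CoordinateRing) := by
  have : Module.Finite k (I.restrictScalars k ⊓ poleSpace W m : Submodule k W.CoordinateRing) :=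
    Submodule.finiteDimensional_inf_right _ _
  rw [← Module.natCard_eq_pow_finrank]
  refine (Nat.subtype_card _ fun _ => ?_).symm
  rw [Finset.mem_filter, mem_poleFinset, and_comm]
  rfl

theorem poleFinset_mono {m n : ℕ} (h : m ≤ n) : poleFinset W m ⊆ poleFinset W n := fun _ hz =>
  mem_poleFinset.mpr (poleSpace_mono h (mem_poleFinset.mp hz))

variable [IsDedekindDomain W.CoordinateRing]

open Classical in
/-- Counting in two ways the pairs of an ideal of degree `n` and a nonzero function vanishing on it
with a pole of order at most `n + 1` at infinity. -/
theorem card_idealsOfDegree_mul {n : ℕ} (hn : 1 ≤ n) :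
    (idealsOfDegree k W.CoordinateRing n).card * (Nat.card k - 1) =
      ∑ P ∈ idealsOfDegree k W.CoordinateRing 1,
        (((poleFinset W (n + 1)).filter (· ∈ P)).card - ((poleFinset W n).filter (· ∈ P)).card) +
      ((poleFinset W n).card - (poleFinset W (n - 1)).card) := by
  have h1 : (idealsOfDegree k W.CoordinateRing n).card * (Nat.card k - 1) =
      ∑ I ∈ idealsOfDegree k W.CoordinateRing n,
        ∑ z ∈ (poleFinset W (n + 1)).erase 0, if z ∈ I then 1 else 0 := by
    rw [Finset.card_eq_sum_ones, Finset.sum_mul]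
    refine Finset.sum_congr rfl fun I hI => ?_
    rw [mem_idealsOfDegree] at hI
    rw [Finset.sum_boole, Finset.filter_erase, Nat.cast_id, Finset.card_erase_of_mem,
      card_filter_mem_poleFinset, finrank_inf_poleSpace_succ hI.1 hn hI.2, pow_one, one_mul]
    exact Finset.mem_filter.mpr ⟨mem_poleFinset.mpr (zero_mem _), zero_mem _⟩
  -- an effective divisor of degree `n` made of zeros of `z` is the complement of one zero if `z` has
  -- `n + 1` zeros, is the whole divisor of zeros if `z` has `n` of them, and does not exist otherwise
  have h2 : ∀ z ∈ poleFinset W (n + 1), z ≠ 0 →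
      (∑ I ∈ idealsOfDegree k W.CoordinateRing n, if z ∈ I then 1 else 0) =
        if z ∈ poleFinset W n then (if z ∈ poleFinset W (n - 1) then 0 else 1) else
          ∑ P ∈ idealsOfDegree k W.CoordinateRing 1, if z ∈ P then 1 else 0 := by
    intro z hz hz0
    simp only [mem_poleFinset, mem_poleSpace, hz0, false_or] at hz ⊢
    simp only [Finset.sum_boole, Nat.cast_id]
    split_ifs with h h'
    · rw [Finset.card_eq_zero, Finset.filter_eq_empty_iff]
      intro I hI hzI
      rw [mem_idealsOfDegree] at hI
      obtain ⟨J, hJ⟩ : I ∣ Ideal.span {z} :=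
        Ideal.dvd_iff_le.mpr ((Ideal.span_singleton_le_iff_mem I).mpr hzI)
      have hJ0 : J ≠ ⊥ := by
        rintro rfl
        rw [Ideal.mul_bot, Ideal.span_singleton_eq_bot] at hJ
        exact hz0 hJ
      rw [hJ, ideg_mul k hI.1 hJ0] at h'
      omega
    · rw [card_filter_ideals_mem hz0 (e := 0) (by omega), idealsOfDegree_zero,
        Finset.filter_singleton, if_pos Submodule.mem_top, Finset.card_singleton]
    · exact card_filter_ideals_mem hz0 (by omega)
  rw [h1, Finset.sum_comm, Finset.sum_congr rfl (fun z hz => h2 z (Finset.mem_of_mem_erase hz)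
    (Finset.ne_of_mem_erase hz)), Finset.sum_erase _ (by
      simp [mem_poleFinset]), Finset.sum_ite, add_comm]
  have hsub1 := poleFinset_mono (W := W) (Nat.le_succ n)
  have hsub2 := poleFinset_mono (W := W) (Nat.sub_le n 1)
  congr 1
  · rw [Finset.sum_comm]
    refine Finset.sum_congr rfl fun P _ => ?_
    rw [Finset.sum_boole, Nat.cast_id,
      ← Finset.card_sdiff_of_subset (Finset.filter_subset_filter _ hsub1)]
    congr 1
    ext z
    simp only [Finset.mem_filter, Finset.mem_sdiff]
    tauto
  · rw [← Finset.card_sdiff_of_subset hsub2, Finset.sum_ite, Finset.sum_const_zero, zero_add,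
      Finset.card_eq_sum_ones]
    refine Finset.sum_congr ?_ fun _ _ => rfl
    ext z
    simp only [Finset.mem_filter, Finset.mem_sdiff]
    have := @hsub1 z
    tauto

/-- The number of effective divisors of degree `n ≥ 1` on the affine curve: with `N` affine
rational points it is `N` for `n = 1`, and `q ^ (n - 1) (N + 1)` for `n ≥ 2`. -/
theorem card_idealsOfDegree {n : ℕ} (hn : 1 ≤ n) :
    (idealsOfDegree k W.CoordinateRing n).card =
      Nat.card k ^ (n - 1) * ((idealsOfDegree k W.CoordinateRing 1).card +
        if n = 1 then 0 else 1) := by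
  classical
  have hq : 1 < Nat.card k := Finite.one_lt_card
  refine Nat.eq_of_mul_eq_mul_right (Nat.sub_pos_of_lt hq) ?_
  rw [card_idealsOfDegree_mul hn]
  have h1 : ∀ P ∈ idealsOfDegree k W.CoordinateRing 1,
      ((poleFinset W (n + 1)).filter (· ∈ P)).card - ((poleFinset W n).filter (· ∈ P)).card =
      Nat.card k ^ (n - 1) * (Nat.card k - 1) := by
    intro P hP
    rw [mem_idealsOfDegree] at hP
    rw [card_filter_mem_poleFinset, card_filter_mem_poleFinset,
      finrank_inf_poleSpace_of_ideg_eq_one hP.2, finrank_inf_poleSpace_of_ideg_eq_one hP.2,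
      Nat.mul_sub, mul_one, ← pow_succ, Nat.sub_add_cancel hn, Nat.add_sub_cancel]
  rw [Finset.sum_congr rfl h1, Finset.sum_const, smul_eq_mul, card_poleFinset, card_poleFinset]
  split_ifs with h
  · subst h
    simp
  · obtain ⟨m, rfl⟩ : ∃ m, n = m + 2 := ⟨n - 2, by omega⟩
    rw [show max (m + 2) 1 = m + 2 by omega, show max (m + 2 - 1) 1 = m + 1 by omega,
      show m + 2 - 1 = m + 1 by omega, pow_succ _ (m + 1)]
    have : Nat.card k ^ (m + 1) * Nat.card k - Nat.card k ^ (m + 1) =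
        Nat.card k ^ (m + 1) * (Nat.card k - 1) := by rw [Nat.mul_sub, mul_one]
    rw [this]
    ring

end CountIdeals

section CurvePoints

variable {k : Type*} [Field k] (W : WeierstrassCurve.Affine k) (L : Type*) [Field L] [Algebra k L]

theorem eval₂_aeval_polynomial (x y : L) :
    W.polynomial.eval₂ (aeval x : k[X] →ₐ[k] L).toRingHom y = 0 ↔
      (W.map (algebraMap k L)).toAffine.Equation x y := by
  rw [Affine.equation_iff', Affine.polynomial]
  simp only [eval₂_add, eval₂_sub, eval₂_mul, eval₂_pow, eval₂_X, eval₂_C]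
  simp
  rw [add_mul, ← add_assoc]

variable {W L} in
theorem algHom_mk_eq (φ : W.CoordinateRing →ₐ[k] L) (f : k[X][X]) :
    φ (Affine.CoordinateRing.mk W f) =
      f.eval₂ (aeval (φ (Affine.CoordinateRing.mk W (C X))) : k[X] →ₐ[k] L).toRingHom
        (φ (Affine.CoordinateRing.mk W X)) := by
  have h : (aeval (φ (Affine.CoordinateRing.mk W (C X))) : k[X] →ₐ[k] L).toRingHom =
      (φ : W.CoordinateRing →+* L).comp ((Affine.CoordinateRing.mk W).comp C) := by
    ext a
    · simp
      exact (φ.commutes a).symm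
    · simp
  rw [h]
  refine Eq.trans ?_ (hom_eval₂ f _ (φ : W.CoordinateRing →+* L) _)
  rw [← hom_eval₂, eval₂_C_X]
  rfl

/-- The points of the affine curve with values in `L` are the homomorphisms from its coordinate
ring to `L`. -/
def pointsEquiv : (W.CoordinateRing →ₐ[k] L) ≃
    {P : L × L // (W.map (algebraMap k L)).toAffine.Equation P.1 P.2} where
  toFun φ := ⟨(φ (Affine.CoordinateRing.mk W (C X)), φ (Affine.CoordinateRing.mk W X)), by
    rw [← eval₂_aeval_polynomial, ← algHom_mk_eq φ, AdjoinRoot.mk_self, map_zero]⟩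
  invFun P := AdjoinRoot.liftAlgHom W.polynomial (aeval P.1.1) P.1.2
    ((eval₂_aeval_polynomial W L _ _).mpr P.2)
  left_inv φ := by
    refine AlgHom.ext fun z => ?_
    obtain ⟨f, rfl⟩ := AdjoinRoot.mk_surjective z
    rw [algHom_mk_eq φ]
    exact AdjoinRoot.liftAlgHom_mk _ _ _ _ f
  right_inv P := by
    refine Subtype.ext (Prod.ext ?_ ?_)
    · refine (AdjoinRoot.liftAlgHom_mk _ _ _ _ (C X)).trans ?_
      simp
    · refine (AdjoinRoot.liftAlgHom_mk _ _ _ _ X).trans ?_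
      simp

/-- `|L|` minus the number of affine points with values in `L`. This is the trace `q_L + 1 - N_L`
of the projective cubic, which has one further point at infinity. -/
def affineTrace (W : WeierstrassCurve k) (L : Type*) [Field L] [Algebra k L] : ℤ :=
  Nat.card L - Nat.card {P : L × L // (W.map (algebraMap k L)).toAffine.Equation P.1 P.2}

/-- The polynomial `1 - a T + q T²` of a smooth cubic, resp. `1 - a T` of a singular one, where `a`
is the trace `affineTrace W k`. -/
def tracePolynomial (W : WeierstrassCurve k) : ℤ[X] :=
  open Classical in if W.Δ ≠ 0 then 1 - C (affineTrace W k) * X + C (Nat.card k : ℤ) * X ^ 2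
  else 1 - C (affineTrace W k) * X

/-- `U` is a series of the traces of `W` over all finite extensions of the base field: its
coefficient at `n` is the trace of `W` over any extension of degree `n`. -/
def IsTraceSeries.{w} (W : WeierstrassCurve k) (U : PowerSeries ℤ) : Prop :=
  ∀ (L : Type w) [Field L] [Finite L] [Algebra k L],
    PowerSeries.coeff (Module.finrank k L) U = affineTrace W L

end CurvePoints

section Smooth

variable {k : Type*} [Field k] [Finite k] (W : WeierstrassCurve k)

variable {W}

/-- Points with values in `L` are counted by the logarithmic derivative of the zeta function. -/
theorem card_points_eq [IsDedekindDomain W.toAffine.CoordinateRing]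
    (L : Type*) [Field L] [Finite L] [Algebra k L] :
    (Nat.card {P : L × L // (W.map (algebraMap k L)).toAffine.Equation P.1 P.2} : ℤ) =
      PowerSeries.coeff (Module.finrank k L)
        (primeSeries k (1 : Ideal W.toAffine.CoordinateRing →* ℤ)) := by
  have : Finite (W.toAffine.CoordinateRing →ₐ[k] L) := Finite.of_equiv _ (pointsEquiv W L).symm
  have := Fintype.ofFinite (W.toAffine.CoordinateRing →ₐ[k] L)
  rw [← Nat.card_congr (pointsEquiv W L), Nat.card_eq_fintype_card, primeSeries,
    PowerSeries.coeff_mk]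
  have h := sum_algHom_eq_sum_primes (k := k) (A := W.toAffine.CoordinateRing) (L := L)
    (fun _ => (1 : ℤ))
  rw [Finset.sum_const, Finset.card_univ] at h
  simpa using h

/-- Ideals of degree one are rational points; here this is read off the first coefficient of the
logarithmic derivative of the zeta series. -/
theorem card_idealsOfDegree_one [IsDedekindDomain W.toAffine.CoordinateRing] :
    ((idealsOfDegree k W.toAffine.CoordinateRing 1).card : ℤ) =
      Nat.card {P : k × k // (W.map (algebraMap k k)).toAffine.Equation P.1 P.2} := by
  have h := congrArg (PowerSeries.coeff 1)
    (X_mul_derivative_zetaSeries k (1 : Ideal W.toAffine.CoordinateRing →* ℤ))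
  rw [card_points_eq, Module.finrank_self]
  have h0 : PowerSeries.coeff 0 (primeSeries k (1 : Ideal W.toAffine.CoordinateRing →* ℤ)) = 0 := by
    rw [primeSeries, PowerSeries.coeff_mk]
    refine Finset.sum_eq_zero fun P hP => ?_
    simp at hP
  rw [show 1 = 0 + 1 from rfl, PowerSeries.coeff_succ_X_mul, PowerSeries.coeff_derivative,
    PowerSeries.coeff_mul, Finset.Nat.antidiagonal_succ] at h
  simp only [Finset.Nat.antidiagonal_zero, Finset.sum_cons, h0, zero_mul, zero_add,
    Finset.map_singleton, Finset.sum_singleton] at h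
  simp [zetaSeries, idealsOfDegree_zero] at h
  simpa using h

/-- The zeta function of a smooth affine Weierstrass curve: it is `(1 - a T + q T²) / (1 - q T)`. -/
theorem zetaSeries_mul [IsDedekindDomain W.toAffine.CoordinateRing] (hΔ : W.Δ ≠ 0) :
    zetaSeries k (1 : Ideal W.toAffine.CoordinateRing →* ℤ) *
      (1 - PowerSeries.C (Nat.card k : ℤ) * PowerSeries.X) =
      (tracePolynomial W : PowerSeries ℤ) := by
  rw [tracePolynomial, if_pos hΔ, affineTrace, ← card_idealsOfDegree_one]
  ext n
  simp only [mul_sub, mul_one, map_sub, map_add, Polynomial.coe_sub, Polynomial.coe_add,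
    Polynomial.coe_mul, Polynomial.coe_C, Polynomial.coe_X, Polynomial.coe_pow, Polynomial.coe_one,
    PowerSeries.coeff_C_mul, PowerSeries.coeff_X_pow, ← mul_assoc,
    mul_comm _ (PowerSeries.C (Nat.card k : ℤ))]
  have hc : ∀ n, PowerSeries.coeff n (zetaSeries k (1 : Ideal W.toAffine.CoordinateRing →* ℤ)) =
      (idealsOfDegree k W.toAffine.CoordinateRing n).card := by
    intro n
    simp [zetaSeries]
  match n with
  | 0 => simp [hc, idealsOfDegree_zero, mul_assoc]
  | 1 =>
    rw [mul_assoc, PowerSeries.coeff_C_mul, show 1 = 0 + 1 from rfl, PowerSeries.coeff_succ_mul_X,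
      hc, hc, idealsOfDegree_zero]
    simp [PowerSeries.coeff_one]
  | n + 2 =>
    rw [mul_assoc, PowerSeries.coeff_C_mul, PowerSeries.coeff_succ_mul_X,
      hc, hc, card_idealsOfDegree (by omega : 1 ≤ n + 2), card_idealsOfDegree (by omega : 1 ≤ n + 1)]
    push_cast
    generalize (Nat.card k : ℤ) = q
    generalize ((idealsOfDegree k W.toAffine.CoordinateRing 1).card : ℤ) = c
    rcases n with _ | n
    · simp [PowerSeries.coeff_one, -eq_intCast]
      ring
    · simp [PowerSeries.coeff_one, -eq_intCast]
      ring

/-- For a smooth cubic, minus the logarithmic derivative of `1 - a T + q T²` is the series of the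
traces over the finite extensions of the base field. -/
theorem exists_isTraceSeries_of_smooth.{w} (h2 : (2 : k) ≠ 0) (hΔ : W.Δ ≠ 0) :
    ∃ U : PowerSeries ℤ, PowerSeries.constantCoeff U = 0 ∧
      PowerSeries.X * PowerSeries.derivative ℤ (tracePolynomial W : PowerSeries ℤ) =
        -U * (tracePolynomial W : PowerSeries ℤ) ∧ IsTraceSeries.{_, w} W U := by
  have := isDedekindDomain_coordinateRing h2 hΔ
  set q : ℤ := (Nat.card k : ℤ) with hq
  set S := primeSeries k (1 : Ideal W.toAffine.CoordinateRing →* ℤ)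
  set V : PowerSeries ℤ := PowerSeries.X * PowerSeries.C q * PowerSeries.mk (fun n => q ^ n)
  have hV : V * (1 - PowerSeries.C q * PowerSeries.X) = PowerSeries.C q * PowerSeries.X := by
    have h1 : PowerSeries.mk (fun n => q ^ n) * (1 - PowerSeries.C q * PowerSeries.X) = 1 := by
      ext n
      rw [mul_sub, mul_one, mul_left_comm, map_sub, PowerSeries.coeff_C_mul, PowerSeries.coeff_mk]
      rcases n with _ | n
      · simp
      · rw [PowerSeries.coeff_succ_mul_X, PowerSeries.coeff_mk, pow_succ, PowerSeries.coeff_one]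
        simp [mul_comm]
    linear_combination (PowerSeries.X * PowerSeries.C q) * h1
  -- `V` counts the points of the affine line, and `S` those of the affine curve
  refine ⟨V - S, ?_, ?_, ?_⟩
  · rw [map_sub, ← PowerSeries.coeff_zero_eq_constantCoeff_apply,
      ← PowerSeries.coeff_zero_eq_constantCoeff_apply]
    have : PowerSeries.coeff 0 S = 0 := by
      refine (PowerSeries.coeff_mk _ _).trans (Finset.sum_eq_zero fun P hP => ?_)
      simp at hP
    rw [this]
    simp [V]
  · have hC := X_mul_derivative_zetaSeries k (1 : Ideal W.toAffine.CoordinateRing →* ℤ)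
    have hE := zetaSeries_mul (W := W) hΔ
    set Z := zetaSeries k (1 : Ideal W.toAffine.CoordinateRing →* ℤ)
    have hd : PowerSeries.derivative ℤ (1 - PowerSeries.C q * PowerSeries.X : PowerSeries ℤ) =
        -PowerSeries.C q := by
      simp [PowerSeries.derivative_X]
    rw [← hE, Derivation.leibniz, hd, smul_eq_mul, smul_eq_mul]
    linear_combination (1 - PowerSeries.C q * PowerSeries.X) * hC + Z * hV
  · intro L _ _ _
    have hfin : Module.Finite k L := Module.Finite.of_finite
    have hpos : 0 < Module.finrank k L := Module.finrank_pos
    rw [affineTrace, card_points_eq, map_sub, Module.natCard_eq_pow_finrank (K := k) (V := L)]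
    congr 1
    obtain ⟨n, hn⟩ : ∃ n, Module.finrank k L = n + 1 := ⟨_, (Nat.succ_pred_eq_of_pos hpos).symm⟩
    rw [hn, show V = PowerSeries.X * (PowerSeries.C q * PowerSeries.mk (fun n => q ^ n)) from
      mul_assoc _ _ _, PowerSeries.coeff_succ_X_mul, PowerSeries.coeff_C_mul, PowerSeries.coeff_mk]
    push_cast
    rw [← hq]; ring

end Smooth

end

/-! ### Singular Weierstrass cubics -/

section

open Polynomial WeierstrassCurve

section Singular

variable {k : Type*} [Field k]

/-- After completing the square, the Weierstrass cubic becomes `η² = (x - x₀)² (4 x + e)`: it is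
singular, with singular point of abscissa `x₀`. -/
structure HasDoubleRoot (W : WeierstrassCurve k) (x₀ e : k) : Prop where
  b₂ : W.b₂ = e - 8 * x₀
  b₄ : 2 * W.b₄ = 4 * x₀ ^ 2 - 2 * e * x₀
  b₆ : W.b₆ = e * x₀ ^ 2

theorem HasDoubleRoot.discr_eq_zero {W : WeierstrassCurve k} {x₀ e : k} (h2 : (2 : k) ≠ 0)
    (h : HasDoubleRoot W x₀ e) : W.Δ = 0 := by
  have h4 : (4 : k) ≠ 0 := by
    have : (4 : k) = 2 * 2 := by norm_num
    rw [this]; exact mul_ne_zero h2 h2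
  have hb4 : W.b₄ = 2 * x₀ ^ 2 - e * x₀ := mul_left_cancel₀ h2 (by rw [h.b₄]; ring)
  refine (mul_eq_zero.mp ?_).resolve_left h4
  have h8 := W.b_relation
  rw [WeierstrassCurve.Δ]
  rw [show 4 * (-W.b₂ ^ 2 * W.b₈ - 8 * W.b₄ ^ 3 - 27 * W.b₆ ^ 2 + 9 * W.b₂ * W.b₄ * W.b₆) =
    -W.b₂ ^ 2 * (4 * W.b₈) - 32 * W.b₄ ^ 3 - 108 * W.b₆ ^ 2 + 36 * W.b₂ * W.b₄ * W.b₆ by ring,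
    h8, hb4, h.b₂, h.b₆]
  ring

theorem HasDoubleRoot.map {W : WeierstrassCurve k} {x₀ e : k} (h : HasDoubleRoot W x₀ e)
    {L : Type*} [Field L] (f : k →+* L) : HasDoubleRoot (W.map f) (f x₀) (f e) where
  b₂ := by rw [map_b₂, h.b₂]; simp only [map_sub, map_mul, map_ofNat]
  b₄ := by rw [map_b₄, ← map_ofNat f 2, ← map_mul, h.b₄]; simp only [map_sub, map_mul, map_pow, map_ofNat]
  b₆ := by rw [map_b₆, h.b₆]; simp

/-- The number of affine points, by completing the square. -/
theorem card_equation_eq_sum (W : WeierstrassCurve k) [Fintype k] [DecidableEq k]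
    (h2 : (2 : k) ≠ 0) :
    (Nat.card {P : k × k // W.toAffine.Equation P.1 P.2} : ℤ) =
      ∑ x : k, (1 + quadraticChar k (4 * x ^ 3 + W.b₂ * x ^ 2 + 2 * W.b₄ * x + W.b₆)) := by
  classical
  have hc : ringChar k ≠ 2 := fun h => h2 (by
    have := ringChar.Nat.cast_ringChar (R := k); rw [h] at this; exact_mod_cast this)
  have e : {P : k × k // W.toAffine.Equation P.1 P.2} ≃ Σ x : k, {z : k // z ^ 2 =
      4 * x ^ 3 + W.b₂ * x ^ 2 + 2 * W.b₄ * x + W.b₆} :=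
    { toFun := fun P => ⟨P.1.1, 2 * P.1.2 + W.a₁ * P.1.1 + W.a₃, by
        have := (Affine.equation_iff _ _).mp P.2
        rw [WeierstrassCurve.b₂, WeierstrassCurve.b₄, WeierstrassCurve.b₆]
        linear_combination 4 * this⟩
      invFun := fun z => ⟨(z.1, (z.2.1 - W.a₁ * z.1 - W.a₃) / 2), by
        have := z.2.2
        simp only [WeierstrassCurve.b₂, WeierstrassCurve.b₄, WeierstrassCurve.b₆] at this
        rw [Affine.equation_iff]
        have h4 : (4 : k) ≠ 0 := by
          have : (4 : k) = 2 * 2 := by norm_num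
          rw [this]; exact mul_ne_zero h2 h2
        field_simp
        linear_combination this⟩
      left_inv := fun P => by
        refine Subtype.ext (Prod.ext rfl ?_)
        simp only
        field_simp
        ring
      right_inv := fun z => by
        obtain ⟨x, z, hz⟩ := z
        simp only [Sigma.mk.injEq, heq_eq_eq, true_and, Subtype.mk.injEq]
        field_simp
        ring }
  rw [Nat.card_congr e, Nat.card_sigma]
  push_cast
  refine Finset.sum_congr rfl fun x _ => ?_
  rw [add_comm 1, ← quadraticChar_card_sqrts hc, Nat.card_eq_fintype_card]
  norm_cast
  rw [Set.toFinset_card]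
  exact Fintype.card_congr (Equiv.refl _)

/-- The trace of a singular cubic is `1`, `-1` or `0` according as the tangents at the singular point
are rational, conjugate or equal. -/
theorem HasDoubleRoot.card_sub {W : WeierstrassCurve k} [Fintype k] [DecidableEq k]
    (h2 : (2 : k) ≠ 0) {x₀ e : k} (h : HasDoubleRoot W x₀ e) :
    (Nat.card k : ℤ) - Nat.card {P : k × k // W.toAffine.Equation P.1 P.2} =
      quadraticChar k (4 * x₀ + e) := by
  have hc : ringChar k ≠ 2 := fun h => h2 (by
    have := ringChar.Nat.cast_ringChar (R := k); rw [h] at this; exact_mod_cast this)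
  have h4 : (4 : k) ≠ 0 := by
    have : (4 : k) = 2 * 2 := by norm_num
    rw [this]; exact mul_ne_zero h2 h2
  have h1 : ∀ x : k, quadraticChar k (4 * x ^ 3 + W.b₂ * x ^ 2 + 2 * W.b₄ * x + W.b₆) =
      quadraticChar k (4 * x + e) - if x = x₀ then quadraticChar k (4 * x₀ + e) else 0 := by
    intro x
    have : 4 * x ^ 3 + W.b₂ * x ^ 2 + 2 * W.b₄ * x + W.b₆ = (x - x₀) ^ 2 * (4 * x + e) := by
      rw [h.b₂, h.b₄, h.b₆]; ring
    rw [this, map_mul]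
    split_ifs with hx
    · rw [hx]; simp
    · rw [quadraticChar_sq_one' (sub_ne_zero.mpr hx)]; simp
  have h3 : ∑ x : k, quadraticChar k (4 * x + e) = 0 := by
    rw [← quadraticChar_sum_zero hc]
    exact Fintype.sum_equiv ((Equiv.mulLeft₀ 4 h4).trans (Equiv.addRight e)) _ _ fun x => rfl
  rw [card_equation_eq_sum W h2, Finset.sum_add_distrib, Finset.sum_congr rfl fun x _ => h1 x,
    Finset.sum_sub_distrib, h3]
  simp

/-- The quadratic character of an extension of degree `n` restricts to the `n`-th power of that of the
base field. -/
theorem quadraticChar_algebraMap {L : Type*} [Field L] [Fintype L] [DecidableEq L] [Fintype k]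
    [DecidableEq k] [Algebra k L] (h2 : (2 : k) ≠ 0) (c : k) :
    quadraticChar L (algebraMap k L c) = quadraticChar k c ^ Module.finrank k L := by
  have : Module.Finite k L := Module.Finite.of_finite
  have hpos : 0 < Module.finrank k L := Module.finrank_pos
  have hc : ringChar k ≠ 2 := fun h => h2 (by
    have := ringChar.Nat.cast_ringChar (R := k); rw [h] at this; exact_mod_cast this)
  have h2L : (2 : L) ≠ 0 := fun h => h2 ((algebraMap k L).injective (by rw [map_ofNat, map_zero, h]))
  have hcL : ringChar L ≠ 2 := fun h => h2L (by
    have := ringChar.Nat.cast_ringChar (R := L); rw [h] at this; exact_mod_cast this)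
  rcases eq_or_ne c 0 with rfl | hc0
  · simp [zero_pow hpos.ne']
  have hcL0 : algebraMap k L c ≠ 0 := by simpa using hc0
  set n := Module.finrank k L
  set q := Fintype.card k with hq
  have hodd : q % 2 = 1 := FiniteField.odd_card_of_char_ne_two hc
  have hcard : Fintype.card L = q ^ n := Module.card_eq_pow_finrank
  have hL := quadraticChar_eq_pow_of_char_ne_two' hcL (algebraMap k L c)
  have hk := quadraticChar_eq_pow_of_char_ne_two' hc c
  -- Euler's criterion, with `(q ^ n - 1) / 2 = (q - 1) / 2 * (1 + q + ⋯ + q ^ (n - 1))`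
  have key : q ^ n / 2 = q / 2 * ∑ i ∈ Finset.range n, q ^ i := by
    have h := geom_sum_mul_add (q - 1) n
    have hq1 : q - 1 + 1 = q := by omega
    rw [hq1, show q - 1 = 2 * (q / 2) by omega, ← mul_assoc,
      mul_comm _ 2, mul_assoc, mul_comm _ (q / 2)] at h
    omega
  rw [hcard, key, pow_mul, ← map_pow, ← hk] at hL
  have hpar : (∑ i ∈ Finset.range n, q ^ i) % 2 = n % 2 := by
    rw [Finset.sum_nat_mod, Finset.sum_congr rfl (g := fun _ => 1)]
    · simp
    · intro i _; rw [Nat.pow_mod, hodd]; simp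
  have hdich := quadraticChar_dichotomy hc0
  have hpow : (quadraticChar k c) ^ (∑ i ∈ Finset.range n, q ^ i) = quadraticChar k c ^ n := by
    rcases hdich with h | h
    · rw [h]; simp
    · rw [h, neg_one_pow_eq_pow_mod_two, hpar, ← neg_one_pow_eq_pow_mod_two]
  rw [map_intCast, ← Int.cast_pow, hpow] at hL
  refine Int.cast_injOn_of_ringChar_ne_two hcL ?_ ?_ hL
  · rcases quadraticChar_dichotomy hcL0 with h | h <;> simp [h]
  · rcases hdich with h | h
    · simp [h]
    · rw [h]
      rcases neg_one_pow_eq_or ℤ n with h | h <;> simp [h]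

/-- For a singular cubic, minus the logarithmic derivative of `1 - a T` is the series of the traces
over the finite extensions of the base field. -/
theorem exists_isTraceSeries_of_hasDoubleRoot.{w} [Finite k] (h2 : (2 : k) ≠ 0)
    {W : WeierstrassCurve k} {x₀ e : k} (h : HasDoubleRoot W x₀ e) :
    ∃ U : PowerSeries ℤ, PowerSeries.constantCoeff U = 0 ∧
      PowerSeries.X * PowerSeries.derivative ℤ (tracePolynomial W : PowerSeries ℤ) =
        -U * (tracePolynomial W : PowerSeries ℤ) ∧ IsTraceSeries.{_, w} W U := by
  classical
  have := Fintype.ofFinite k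
  have hk : affineTrace W k = quadraticChar k (4 * x₀ + e) := by
    have h' := h.map (algebraMap k k)
    rw [affineTrace, h'.card_sub h2]
    rfl
  rw [tracePolynomial, if_neg (not_not.mpr (h.discr_eq_zero h2)), hk]
  set ε := quadraticChar k (4 * x₀ + e)
  have hV : PowerSeries.mk (fun n => ε ^ n) * (1 - PowerSeries.C ε * PowerSeries.X) = 1 := by
    ext n
    rw [mul_sub, mul_one, mul_left_comm, map_sub, PowerSeries.coeff_C_mul, PowerSeries.coeff_mk]
    rcases n with _ | n
    · simp
    · rw [PowerSeries.coeff_succ_mul_X, PowerSeries.coeff_mk, pow_succ, PowerSeries.coeff_one]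
      simp [mul_comm]
  refine ⟨PowerSeries.X * (PowerSeries.C ε * PowerSeries.mk (fun n => ε ^ n)), ?_, ?_, ?_⟩
  · simp
  · have hd : PowerSeries.derivative ℤ (1 - PowerSeries.C ε * PowerSeries.X : PowerSeries ℤ) =
        -PowerSeries.C ε := by
      simp [PowerSeries.derivative_X]
    rw [Polynomial.coe_sub, Polynomial.coe_mul, Polynomial.coe_C, Polynomial.coe_X,
      Polynomial.coe_one, hd]
    linear_combination (PowerSeries.X * PowerSeries.C ε) * hV
  · intro L _ _ _
    have := Fintype.ofFinite L
    have hfin : Module.Finite k L := Module.Finite.of_finite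
    have hpos : 0 < Module.finrank k L := Module.finrank_pos
    have h2L : (2 : L) ≠ 0 := fun h =>
      h2 ((algebraMap k L).injective (by rw [map_ofNat, map_zero, h]))
    rw [affineTrace, (h.map (algebraMap k L)).card_sub h2L]
    have : 4 * algebraMap k L x₀ + algebraMap k L e = algebraMap k L (4 * x₀ + e) := by
      rw [map_add, map_mul, map_ofNat]
    rw [this, quadraticChar_algebraMap h2]
    obtain ⟨n, hn⟩ : ∃ n, Module.finrank k L = n + 1 := ⟨_, (Nat.succ_pred_eq_of_pos hpos).symm⟩
    rw [hn, PowerSeries.coeff_succ_X_mul, PowerSeries.coeff_C_mul, PowerSeries.coeff_mk, pow_succ,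
      mul_comm]

end Singular

end

/-! ### Reductions of minimal models -/

section

open Polynomial IsDedekindDomain WeierstrassCurve

section MinimalModels

variable {R : Type*} [CommRing R] [IsDomain R] [IsDiscreteValuationRing R]
  {K : Type*} [Field K] [Algebra R K] [IsFractionRing R K]

/-- The scaling factor between an integral model `A` and a minimal model is a unit, as soon as no
non-unit `u` divides `c₄` by `u ^ 4` and the discriminant by `u ^ 12`. -/
theorem exists_unit_scaling {A : WeierstrassCurve R} {M : WeierstrassCurve K} [M.IsMinimal R]
    (hΔ : A.Δ ≠ 0)
    (hA : ∀ u ∈ IsLocalRing.maximalIdeal R, ∀ x y, A.c₄ = u ^ 4 * x → A.Δ ≠ u ^ 12 * y)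
    {D : VariableChange K} (hD : M = D • A.baseChange K) :
    ∃ u : Rˣ, algebraMap R K u = D.u := by
  have hinj := IsFractionRing.injective R K
  obtain ⟨w, hw⟩ | ⟨w, hw⟩ := ValuationRing.isInteger_or_isInteger R (D.u : K)
  · by_cases hwm : w ∈ IsLocalRing.maximalIdeal R
    · refine (hA w hwm (M.integralModel R).c₄ (M.integralModel R).Δ (hinj ?_) (hinj ?_)).elim
      · rw [map_mul, integralModel_c₄_eq, hD, variableChange_c₄, map_pow, hw, ← mul_assoc,
          ← mul_pow, Units.mul_inv, one_pow, one_mul, baseChange, map_c₄]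
      · rw [map_mul, integralModel_Δ_eq, hD, variableChange_Δ, map_pow, hw, ← mul_assoc,
          ← mul_pow, Units.mul_inv, one_pow, one_mul, baseChange, map_Δ]
    · obtain ⟨u, rfl⟩ := IsLocalRing.notMem_maximalIdeal.mp hwm
      exact ⟨u, hw⟩
  · by_cases hwm : w ∈ IsLocalRing.maximalIdeal R
    · exfalso
      have hA0 : (A.baseChange K).IsIntegral R := ⟨A, rfl⟩
      have hA1 : D⁻¹ • M = A.baseChange K := by rw [hD, inv_smul_smul]
      have hmax := IsMinimal.val_Δ_maximal (R := R) (W := M)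
      have h1 : (D⁻¹ • M).IsIntegral R := by rw [hA1]; exact hA0
      have h2 := (le_total _ _).elim (hmax.2 h1) id
      simp only [hA1, one_smul] at h2
      rw [← Subtype.coe_le_coe, valuation_Δ_aux_eq_of_isIntegral,
        valuation_Δ_aux_eq_of_isIntegral, hD, variableChange_Δ, map_mul, map_pow,
        Units.val_inv_eq_inv_val, ← hw] at h2
      have h3 : (IsDiscreteValuationRing.maximalIdeal R).valuation K (algebraMap R K w) < 1 :=
        (HeightOneSpectrum.valuation_lt_one_iff_mem _ _).mpr hwm
      have h4 : 0 < (IsDiscreteValuationRing.maximalIdeal R).valuation K (A.baseChange K).Δ := by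
        rw [zero_lt_iff, Valuation.ne_zero_iff, baseChange, map_Δ]
        exact (map_ne_zero_iff _ hinj).mpr hΔ
      exact absurd h2 (not_le.mpr (mul_lt_of_lt_one_left h4 (pow_lt_one₀ zero_le h3 (by norm_num))))
    · obtain ⟨u, rfl⟩ := IsLocalRing.notMem_maximalIdeal.mp hwm
      refine ⟨u⁻¹, ?_⟩
      rw [← inv_inv (D.u : K), ← hw]
      exact eq_inv_of_mul_eq_one_left (by rw [← map_mul, Units.inv_mul, map_one])

/-- In residue characteristic prime to `6`, the reduction of a minimal model is obtained by a change
of variables from the reduction of any integral model satisfying the usual criterion. -/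
theorem exists_reduction_minimal_eq {A : WeierstrassCurve R} {W : WeierstrassCurve K}
    (h2 : IsUnit (2 : R)) (h3 : IsUnit (3 : R)) (hΔ : A.Δ ≠ 0)
    (hA : ∀ u ∈ IsLocalRing.maximalIdeal R, ∀ x y, A.c₄ = u ^ 4 * x → A.Δ ≠ u ^ 12 * y)
    {C : VariableChange K} (hC : C • W = A.baseChange K) :
    ∃ D : VariableChange (IsLocalRing.ResidueField R),
      (W.minimal R).reduction R = D • A.map (IsLocalRing.residue R) := by
  have hinj := IsFractionRing.injective R K
  obtain ⟨C', hC'⟩ : ∃ C' : VariableChange K, W.minimal R = C' • W := ⟨_, rfl⟩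
  set M := W.minimal R
  have hD : M = (C' * C⁻¹) • A.baseChange K := by rw [← hC, mul_smul, inv_smul_smul, hC']
  set D := C' * C⁻¹
  obtain ⟨u, hu⟩ := exists_unit_scaling hΔ hA hD
  -- `2` and `3` being invertible, `s`, `r` and `t` can be recovered from the coefficients `a₁`, `a₂`
  -- and `a₃` of the two integral models
  obtain ⟨i₂, hi₂⟩ := h2.exists_right_inv
  obtain ⟨i₃, hi₃⟩ := h3.exists_right_inv
  have hi₂' : (2 : K) * algebraMap R K i₂ = 1 := by
    rw [← map_ofNat (algebraMap R K) 2, ← map_mul, hi₂, map_one]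
  have hi₃' : (3 : K) * algebraMap R K i₃ = 1 := by
    rw [← map_ofNat (algebraMap R K) 3, ← map_mul, hi₃, map_one]
  have ha₁ := integralModel_a₁_eq R M
  have ha₂ := integralModel_a₂_eq R M
  have ha₃ := integralModel_a₃_eq R M
  set B := M.integralModel R
  have hMB : B.map (algebraMap R K) = M := baseChange_integralModel_eq R M
  have hdu := D.u.mul_inv
  rw [← hu] at hdu
  set v : K := ↑D.u⁻¹
  have e₁ : algebraMap R K B.a₁ = v * (algebraMap R K A.a₁ + 2 * D.s) := by
    rw [ha₁, hD]; rfl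
  have e₂ : algebraMap R K B.a₂ = v ^ 2 * (algebraMap R K A.a₂ - D.s * algebraMap R K A.a₁ +
      3 * D.r - D.s ^ 2) := by
    rw [ha₂, hD]; rfl
  have e₃ : algebraMap R K B.a₃ = v ^ 3 * (algebraMap R K A.a₃ + D.r * algebraMap R K A.a₁ +
      2 * D.t) := by
    rw [ha₃, hD]; rfl
  obtain ⟨s, hs⟩ : ∃ s, algebraMap R K s = D.s := ⟨i₂ * (u * B.a₁ - A.a₁), by
    simp only [map_mul, map_sub]
    rw [e₁]
    linear_combination (algebraMap R K i₂ * (algebraMap R K A.a₁ + 2 * D.s)) * hdu + D.s * hi₂'⟩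
  rw [← hs] at e₂
  obtain ⟨r, hr⟩ : ∃ r, algebraMap R K r = D.r :=
    ⟨i₃ * (u ^ 2 * B.a₂ - A.a₂ + s * A.a₁ + s ^ 2), by
      simp only [map_mul, map_sub, map_add, map_pow]
      rw [e₂]
      linear_combination (algebraMap R K i₃ * (algebraMap R K A.a₂ - algebraMap R K s *
        algebraMap R K A.a₁ + 3 * D.r - algebraMap R K s ^ 2) *
        (algebraMap R K u * v + 1)) * hdu + D.r * hi₃'⟩
  rw [← hr] at e₃
  obtain ⟨t, ht⟩ : ∃ t, algebraMap R K t = D.t :=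
    ⟨i₂ * (u ^ 3 * B.a₃ - A.a₃ - r * A.a₁), by
      simp only [map_mul, map_sub, map_pow]
      rw [e₃]
      linear_combination (algebraMap R K i₂ * (algebraMap R K A.a₃ + algebraMap R K r *
        algebraMap R K A.a₁ + 2 * D.t) * ((algebraMap R K u * v) ^ 2 + algebraMap R K u * v + 1)) *
        hdu + D.t * hi₂'⟩
  let E : VariableChange R := ⟨u, r, s, t⟩
  have hE : E.map (algebraMap R K) = D := by
    ext
    · exact hu
    · exact hr
    · exact hs
    · exact ht
  have hB : B = E • A := by
    refine WeierstrassCurve.map_injective (f := algebraMap R K) hinj ?_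
    change B.map _ = (E • A).map _
    rw [hMB, ← map_variableChange, hE, hD]
    rfl
  refine ⟨E.map (IsLocalRing.residue R), ?_⟩
  rw [map_variableChange, ← hB]
  rfl

end MinimalModels

section NumPoints

variable {k : Type*} [Field k]

theorem card_equation_variableChange (W : WeierstrassCurve k) (D : VariableChange k) :
    Nat.card {P : k × k // (D • W).toAffine.Equation P.1 P.2} =
      Nat.card {P : k × k // W.toAffine.Equation P.1 P.2} := by
  have hu : (D.u : k) ≠ 0 := D.u.ne_zero
  have key : ∀ x y : k, (D • W).toAffine.Equation x y ↔
      W.toAffine.Equation (D.u ^ 2 * x + D.r) (D.u ^ 3 * y + D.u ^ 2 * D.s * x + D.t) := by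
    intro x y
    rw [Affine.equation_iff', Affine.equation_iff', ← mul_right_inj' (pow_ne_zero 6 hu), mul_zero]
    refine Eq.congr ?_ rfl
    change _ * (y ^ 2 + (D • W).a₁ * x * y + (D • W).a₃ * y - (x ^ 3 + (D • W).a₂ * x ^ 2 +
      (D • W).a₄ * x + (D • W).a₆)) = _
    rw [variableChange_a₁, variableChange_a₂, variableChange_a₃, variableChange_a₄,
      variableChange_a₆, Units.val_inv_eq_inv_val]
    field_simp
    ring
  refine Nat.card_congr
    { toFun := fun P => ⟨(D.u ^ 2 * P.1.1 + D.r,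
        D.u ^ 3 * P.1.2 + D.u ^ 2 * D.s * P.1.1 + D.t), (key _ _).mp P.2⟩
      invFun := fun P => ⟨((P.1.1 - D.r) / D.u ^ 2,
        (P.1.2 - D.t - D.s * (P.1.1 - D.r)) / D.u ^ 3), (key _ _).mpr ?_⟩
      left_inv := ?_
      right_inv := ?_ }
  · convert P.2 using 1
    · field_simp; ring
    · field_simp; ring
  · rintro ⟨⟨x, y⟩, h⟩
    refine Subtype.ext (Prod.ext ?_ ?_)
    · simp only; field_simp; ring
    · simp only; field_simp; ring
  · rintro ⟨⟨x, y⟩, h⟩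
    refine Subtype.ext (Prod.ext ?_ ?_)
    · simp only; field_simp; ring
    · simp only; field_simp; ring

theorem card_equation_map {k' : Type*} [Field k'] (W : WeierstrassCurve k) (e : k ≃+* k') :
    Nat.card {P : k' × k' // (W.map (e : k →+* k')).toAffine.Equation P.1 P.2} =
      Nat.card {P : k × k // W.toAffine.Equation P.1 P.2} := by
  symm
  refine Nat.card_congr ((Equiv.prodCongr e.toEquiv e.toEquiv).subtypeEquiv fun P => ?_)
  exact (Affine.map_equation (W := W.toAffine) (f := (e : k →+* k')) (x := P.1) (y := P.2) e.injective).symm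

theorem affineTrace_self (W : WeierstrassCurve k) :
    affineTrace W k = Nat.card k - Nat.card {P : k × k // W.toAffine.Equation P.1 P.2} := by
  rw [affineTrace, Algebra.algebraMap_self, WeierstrassCurve.map_id]

theorem tracePolynomial_variableChange (W : WeierstrassCurve k) (D : VariableChange k) :
    tracePolynomial (D • W) = tracePolynomial W := by
  classical
  have h : (D • W).Δ ≠ 0 ↔ W.Δ ≠ 0 := by
    rw [variableChange_Δ]
    simp
  rw [tracePolynomial, tracePolynomial, affineTrace_self, affineTrace_self,
    card_equation_variableChange, if_congr h rfl rfl]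

theorem tracePolynomial_map {k' : Type*} [Field k'] (W : WeierstrassCurve k) (e : k ≃+* k') :
    tracePolynomial (W.map (e : k →+* k')) = tracePolynomial W := by
  classical
  have h : (W.map (e : k →+* k')).Δ ≠ 0 ↔ W.Δ ≠ 0 := by
    rw [map_Δ]
    simp
  rw [tracePolynomial, tracePolynomial, affineTrace_self, affineTrace_self, card_equation_map,
    if_congr h rfl rfl, Nat.card_congr e.toEquiv]

end NumPoints

section LocalPolynomials

variable {F : Type*} [Field F]

/-- The Euler factor at `v` is that of the reduced cubic, as a curve over the residue field, evaluated
at `T ^ deg v`. -/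
theorem localPolynomial_eq (W : WeierstrassCurve (RatFunc F)) (v : Place F) :
    localPolynomial W v =
      expand ℤ v.degree (tracePolynomial ((W.minimal v.integers).reduction v.integers)) := by
  classical
  have h : (W.minimal v.integers).HasGoodReduction v.integers ↔
      ((W.minimal v.integers).reduction v.integers).Δ ≠ 0 := by
    rw [hasGoodReduction_iff_isElliptic_reduction, isElliptic_iff, isUnit_iff_ne_zero]
  have ht : traceAt W v =
      affineTrace ((W.minimal v.integers).reduction v.integers) v.residueField := by
    rw [traceAt, affineTrace_self, numPoints, Place.norm]
    push_cast
    ring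
  rw [localPolynomial, tracePolynomial, if_congr h rfl rfl, ht]
  split_ifs
  · simp [Place.norm, pow_mul, pow_right_comm X 2]
  · simp

end LocalPolynomials

end

/-! ### The Euler factors of the Hessian curve -/

section

open Polynomial IsDedekindDomain WeierstrassCurve

section ResidueFields

variable {F : Type*} [Field F]

theorem isUnit_natCast_integers (v : Place F) {n : ℕ} (hn : (n : F) ≠ 0) :
    IsUnit (n : v.integers) := by
  have := (isUnit_iff_ne_zero.mpr hn).map
    ((algebraMap F (RatFunc F)).codRestrict v.integers v.algebraMap_mem_integers)
  rwa [map_natCast] at this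

theorem mem_maximalIdeal_integers (v : Place F) (x : v.integers) :
    x ∈ IsLocalRing.maximalIdeal v.integers ↔ v.valuation (x : RatFunc F) < 1 :=
  Valuation.mem_maximalIdeal_iff (RatFunc F) v.valuation

/-- Polynomials are integral at the finite places. -/
def polyToIntegers (P : HeightOneSpectrum F[X]) : F[X] →+* (Place.finite P).integers :=
  (algebraMap F[X] (RatFunc F)).codRestrict (Place.finite P).integers fun f => by
    rw [Valuation.mem_valuationSubring_iff]
    exact P.valuation_le_one f

theorem coe_polyToIntegers (P : HeightOneSpectrum F[X]) (f : F[X]) :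
    (polyToIntegers P f : RatFunc F) = algebraMap F[X] (RatFunc F) f := rfl

/-- The residue class at a finite place of a polynomial. -/
def polyToResidue (P : HeightOneSpectrum F[X]) : F[X] →+* (Place.finite P).residueField :=
  (IsLocalRing.residue _).comp (polyToIntegers P)

theorem polyToResidue_surjective (P : HeightOneSpectrum F[X]) :
    Function.Surjective (polyToResidue P) := by
  intro y
  obtain ⟨x, rfl⟩ := IsLocalRing.residue_surjective y
  have hx : P.valuation (RatFunc F) (x : RatFunc F) ≤ 1 := x.2
  obtain ⟨f, hf⟩ := P.exists_valuation_sub_lt_of_integer hx 1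
  refine ⟨f, ?_⟩
  change IsLocalRing.residue _ (polyToIntegers P f) = _
  rw [← sub_eq_zero, ← map_sub, IsLocalRing.residue_eq_zero_iff, mem_maximalIdeal_integers]
  exact hf

theorem ker_polyToResidue (P : HeightOneSpectrum F[X]) :
    RingHom.ker (polyToResidue P) = P.asIdeal := by
  ext f
  rw [RingHom.mem_ker]
  change IsLocalRing.residue _ (polyToIntegers P f) = 0 ↔ _
  rw [IsLocalRing.residue_eq_zero_iff, mem_maximalIdeal_integers]
  exact P.valuation_lt_one_iff_mem f

/-- The residue field at a finite place is the quotient of the ring of polynomials. -/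
def residueEquiv (P : HeightOneSpectrum F[X]) :
    F[X] ⧸ P.asIdeal ≃+* (Place.finite P).residueField :=
  (Ideal.quotEquivOfEq (ker_polyToResidue P).symm).trans
    (RingHom.quotientKerEquivOfSurjective (polyToResidue_surjective P))

theorem residueEquiv_mk (P : HeightOneSpectrum F[X]) (f : F[X]) :
    residueEquiv P (Ideal.Quotient.mk _ f) = polyToResidue P f := rfl

theorem degree_finite (P : HeightOneSpectrum F[X]) :
    (Place.finite P).degree = ideg F P.asIdeal := by
  let := (Place.finite P).constants.toAlgebra
  refine (LinearEquiv.finrank_eq (R := F)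
    { residueEquiv P with map_smul' := fun c x => ?_ }).symm
  obtain ⟨f, rfl⟩ := Ideal.Quotient.mk_surjective x
  rw [RingHom.id_apply, Algebra.smul_def (R := F) (A := (Place.finite P).residueField)]
  change residueEquiv P (c • Ideal.Quotient.mk _ f) = (Place.finite P).constants c *
    polyToResidue P f
  rw [← Ideal.Quotient.mkₐ_eq_mk F, ← map_smul, Ideal.Quotient.mkₐ_eq_mk, residueEquiv_mk,
    Polynomial.smul_eq_C_mul, map_mul]
  rfl

theorem valuation_infinity [DecidableEq (RatFunc F)] :
    (Place.infinity : Place F).valuation = RatFunc.inftyValuation F := by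
  rw [Place.valuation]
  congr!

theorem constants_infinity_bijective :
    Function.Bijective (Place.infinity : Place F).constants := by
  classical
  refine ⟨RingHom.injective _, fun y => ?_⟩
  obtain ⟨x, rfl⟩ := IsLocalRing.residue_surjective y
  have hx : RatFunc.inftyValuation F (x : RatFunc F) ≤ 1 := by
    rw [← valuation_infinity]
    exact x.2
  suffices h : ∃ c : F, RatFunc.inftyValuation F (algebraMap F (RatFunc F) c - (x : RatFunc F)) < 1 by
    obtain ⟨c, hc⟩ := h
    refine ⟨c, ?_⟩
    rw [← sub_eq_zero]
    change IsLocalRing.residue _ _ - _ = 0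
    rw [← map_sub, IsLocalRing.residue_eq_zero_iff, mem_maximalIdeal_integers]
    rw [valuation_infinity]
    exact hc
  obtain ⟨z, hz⟩ := x
  change RatFunc.inftyValuation F z ≤ 1 at hx
  change ∃ c : F, RatFunc.inftyValuation F (algebraMap F (RatFunc F) c - z) < 1
  rcases hx.lt_or_eq with hlt | heq
  · exact ⟨0, by rwa [map_zero, zero_sub, Valuation.map_neg]⟩
  have hz : z ≠ 0 := by rintro h; rw [h, map_zero] at heq; exact zero_ne_one heq
  have hval : ∀ f : F[X], f ≠ 0 → RatFunc.inftyValuation F (algebraMap F[X] (RatFunc F) f) =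
      WithZero.exp (f.natDegree : ℤ) := fun f hf => RatFunc.inftyValuation.polynomial F hf
  have hn : z.num ≠ 0 := RatFunc.num_ne_zero hz
  have hd : z.denom ≠ 0 := RatFunc.denom_ne_zero z
  have hd' : algebraMap F[X] (RatFunc F) z.denom ≠ 0 := by simpa using hd
  rw [← RatFunc.num_div_denom z, map_div₀, hval _ hn, hval _ hd, ← WithZero.exp_sub,
    ← WithZero.exp_zero, WithZero.exp_inj, sub_eq_zero, Nat.cast_inj] at heq
  refine ⟨z.num.leadingCoeff / z.denom.leadingCoeff, ?_⟩
  set c := z.num.leadingCoeff / z.denom.leadingCoeff with hc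
  have hc0 : c ≠ 0 := div_ne_zero (leadingCoeff_ne_zero.mpr hn) (leadingCoeff_ne_zero.mpr hd)
  have hzc : algebraMap F (RatFunc F) c - z =
      algebraMap F[X] (RatFunc F) (C c * z.denom - z.num) /
        algebraMap F[X] (RatFunc F) z.denom := by
    conv_lhs => rw [← RatFunc.num_div_denom z]
    rw [IsScalarTower.algebraMap_apply F F[X] (RatFunc F), Polynomial.algebraMap_eq, map_sub,
      map_mul]
    field_simp
  rw [hzc]
  by_cases h0 : C c * z.denom - z.num = 0
  · rw [h0]; simp
  rw [map_div₀, hval _ h0, hval _ hd, ← WithZero.exp_sub, ← WithZero.exp_zero, WithZero.exp_lt_exp,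
    sub_neg, Nat.cast_lt, ← heq]
  have hlt : (C c * z.denom - z.num).degree < (C c * z.denom).degree := by
    refine degree_sub_lt_left ?_ (mul_ne_zero (C_ne_zero.mpr hc0) hd) ?_
    · rw [degree_C_mul hc0, degree_eq_natDegree hn, degree_eq_natDegree hd, heq]
    · rw [leadingCoeff_mul, leadingCoeff_C, hc, div_mul_cancel₀ _ (leadingCoeff_ne_zero.mpr hd)]
  rw [degree_C_mul hc0, degree_eq_natDegree hd, ← heq] at hlt
  exact (natDegree_lt_iff_degree_lt h0).mpr hlt

theorem degree_infinity : (Place.infinity : Place F).degree = 1 := by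
  let := (Place.infinity : Place F).constants.toAlgebra
  have h := LinearEquiv.finrank_eq (LinearEquiv.ofBijective
    (Algebra.linearMap F (Place.infinity : Place F).residueField) constants_infinity_bijective)
  rw [Module.finrank_self] at h
  exact h.symm

end ResidueFields

section HessianReduction

/-- The cubic `y² + x y - c y = x³`. -/
def hessianAt {k : Type*} [Field k] (c : k) : WeierstrassCurve k := ⟨1, 0, -c, 0, 0⟩

/-- The reduction at infinity of a minimal model of the Hessian curve: `y² - y = x³` if `3 ∣ d`, and
the cuspidal cubic `y² = x³` otherwise. -/
def hessianInfinity (F : Type*) [Field F] (d : ℕ) : WeierstrassCurve F :=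
  ⟨0, 0, if 3 ∣ d then -1 else 0, 0, 0⟩

theorem cubic_c₄ {R : Type*} [CommRing R] (a b : R) :
    (⟨a, 0, b, 0, 0⟩ : WeierstrassCurve R).c₄ = a ^ 4 - 24 * a * b := by
  simp only [WeierstrassCurve.c₄, WeierstrassCurve.b₂, WeierstrassCurve.b₄]
  ring

theorem cubic_Δ {R : Type*} [CommRing R] (a b : R) :
    (⟨a, 0, b, 0, 0⟩ : WeierstrassCurve R).Δ = b ^ 3 * (a ^ 3 - 27 * b) := by
  simp only [WeierstrassCurve.Δ, WeierstrassCurve.b₂, WeierstrassCurve.b₄, WeierstrassCurve.b₆,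
    WeierstrassCurve.b₈]
  ring

variable {F : Type*} [Field F]

/-- At the finite places the given equation is minimal. -/
theorem localPolynomial_finite (h2 : (2 : F) ≠ 0) (h3 : (3 : F) ≠ 0) {d : ℕ} (hd : d ≠ 0)
    [Finite F] (P : HeightOneSpectrum F[X]) :
    localPolynomial (hessianCurve F d) (.finite P) =
      expand ℤ (ideg F P.asIdeal)
        (tracePolynomial (hessianAt (Ideal.Quotient.mk P.asIdeal X ^ d))) := by
  set v := Place.finite P
  set T : v.integers := polyToIntegers P X ^ d with hT
  let A : WeierstrassCurve v.integers := ⟨1, 0, -T, 0, 0⟩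
  have hTX : (T : RatFunc F) = RatFunc.X ^ d := by
    rw [hT, SubmonoidClass.coe_pow, coe_polyToIntegers, RatFunc.algebraMap_X]
  have hA : (1 : VariableChange (RatFunc F)) • hessianCurve F d = A.baseChange (RatFunc F) := by
    rw [one_smul]
    ext
    · exact (map_one (algebraMap v.integers (RatFunc F))).symm
    · exact (map_zero (algebraMap v.integers (RatFunc F))).symm
    · exact (congrArg Neg.neg hTX.symm)
    · exact (map_zero (algebraMap v.integers (RatFunc F))).symm
    · exact (map_zero (algebraMap v.integers (RatFunc F))).symm
  have hΔ : A.Δ = -T ^ 3 * (1 + 27 * T) := by rw [cubic_Δ]; ring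
  have hc : A.c₄ = 1 + 24 * T := by rw [cubic_c₄]; ring
  have hXd : (X : F[X]) ^ d ≠ 0 := pow_ne_zero _ X_ne_zero
  have h27 : (1 + 27 * X ^ d : F[X]) ≠ 0 := by
    intro h
    have := congrArg (eval 0) h
    simp [hd] at this
  have hT0 : T ≠ 0 := fun h => by
    have h' := congrArg (Subtype.val) h
    rw [hTX] at h'
    exact pow_ne_zero d RatFunc.X_ne_zero h'
  have hΔ0 : A.Δ ≠ 0 := by
    rw [hΔ]
    refine mul_ne_zero (neg_ne_zero.mpr (pow_ne_zero _ hT0)) fun h => ?_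
    have h' := congrArg (Subtype.val) h
    have e : ((1 + 27 * T : v.integers) : RatFunc F) =
        algebraMap F[X] (RatFunc F) (1 + 27 * X ^ d) := by
      have : (1 + 27 * T : v.integers) = polyToIntegers P (1 + 27 * X ^ d) := by
        rw [map_add, map_mul, map_pow, map_one, map_ofNat, hT]
      rw [this, coe_polyToIntegers]
    rw [e] at h'
    exact h27 ((map_eq_zero_iff _ (RatFunc.algebraMap_injective F)).mp h')
  obtain ⟨D, hD⟩ := exists_reduction_minimal_eq (R := v.integers)
    (by exact_mod_cast isUnit_natCast_integers v (n := 2) (by exact_mod_cast h2))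
    (by exact_mod_cast isUnit_natCast_integers v (n := 3) (by exact_mod_cast h3))
    hΔ0 (fun u hu x y h4 hd' => by
      have m4 : A.c₄ ∈ IsLocalRing.maximalIdeal v.integers := by
        rw [h4]; exact Ideal.mul_mem_right _ _ (Ideal.pow_mem_of_mem _ hu 4 (by norm_num))
      have mΔ : A.Δ ∈ IsLocalRing.maximalIdeal v.integers := by
        rw [hd']; exact Ideal.mul_mem_right _ _ (Ideal.pow_mem_of_mem _ hu 12 (by norm_num))
      rw [hc] at m4
      rw [hΔ] at mΔ
      -- `c₄` and the discriminant have no common zero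
      refine (Ideal.ne_top_iff_one _).mp (IsLocalRing.maximalIdeal.isMaximal v.integers).ne_top ?_
      rcases Ideal.IsPrime.mem_or_mem inferInstance mΔ with h | h
      · have hT' := Ideal.IsPrime.mem_of_pow_mem inferInstance 3 ((Ideal.neg_mem_iff _).mp h)
        have := Ideal.sub_mem _ m4 (Ideal.mul_mem_left _ 24 hT')
        rwa [add_sub_cancel_right] at this
      · have := Ideal.sub_mem _ (Ideal.mul_mem_left _ 9 m4) (Ideal.mul_mem_left _ 8 h)
        convert this using 1
        ring) hA
  have hred : A.map (IsLocalRing.residue v.integers) =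
      (hessianAt (Ideal.Quotient.mk P.asIdeal X ^ d)).map
        (residueEquiv P : F[X] ⧸ P.asIdeal →+* v.residueField) := by
    ext
    · exact (map_one _).trans (map_one _).symm
    · exact (map_zero _).trans (map_zero _).symm
    · change IsLocalRing.residue v.integers (-T) = residueEquiv P (-(Ideal.Quotient.mk P.asIdeal X ^ d))
      rw [map_neg, map_neg, ← map_pow, residueEquiv_mk, hT, ← map_pow (polyToIntegers P)]
      rfl
    · exact (map_zero _).trans (map_zero _).symm
    · exact (map_zero _).trans (map_zero _).symm
  rw [localPolynomial_eq, hD, tracePolynomial_variableChange, hred, tracePolynomial_map,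
    degree_finite]

/-- At infinity, put `s = 1 / t` and scale by `t ^ k`, where `k = ⌈d / 3⌉`: this gives the minimal
model `y² + s ^ k x y - s ^ r y = x³`, where `r = 3 k - d`. -/
theorem localPolynomial_infinity (h2 : (2 : F) ≠ 0) (h3 : (3 : F) ≠ 0) {d : ℕ} (hd : d ≠ 0) :
    localPolynomial (hessianCurve F d) .infinity = tracePolynomial (hessianInfinity F d) := by
  classical
  set v : Place F := Place.infinity with hv
  -- the uniformiser `1 / t`
  have hval : v.valuation (RatFunc.X⁻¹ : RatFunc F) = WithZero.exp (-1 : ℤ) := by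
    rw [map_inv₀, WithZero.exp_neg]
    congr 1
    rw [hv, valuation_infinity]
    exact RatFunc.inftyValuation.X F
  obtain ⟨S, hS⟩ : ∃ S : v.integers, (S : RatFunc F) = RatFunc.X⁻¹ :=
    ⟨⟨RatFunc.X⁻¹, by
      rw [Valuation.mem_valuationSubring_iff, hval, ← WithZero.exp_zero, WithZero.exp_le_exp]
      norm_num⟩, rfl⟩
  have hS0 : S ≠ 0 := fun h => by
    rw [h] at hS
    exact inv_ne_zero RatFunc.X_ne_zero hS.symm
  have hSm : S ∈ IsLocalRing.maximalIdeal v.integers := by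
    rw [mem_maximalIdeal_integers, hS, hval, ← WithZero.exp_zero, WithZero.exp_lt_exp]
    norm_num
  obtain ⟨k, r, hkr, hr, hk, hr3⟩ : ∃ k r, 3 * k = d + r ∧ r < 3 ∧ k ≠ 0 ∧ (3 ∣ d ↔ r = 0) :=
    ⟨(d + 2) / 3, 3 * ((d + 2) / 3) - d, by omega, by omega, by omega, by omega⟩
  let A : WeierstrassCurve v.integers := ⟨S ^ k, 0, -S ^ r, 0, 0⟩
  have hX := RatFunc.X_ne_zero (K := F)
  have hA : (⟨Units.mk0 (RatFunc.X ^ k) (pow_ne_zero _ hX), 0, 0, 0⟩ :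
      VariableChange (RatFunc F)) • hessianCurve F d = A.baseChange (RatFunc F) := by
    have e1 : ((S ^ k : v.integers) : RatFunc F) = (RatFunc.X ^ k)⁻¹ := by
      rw [SubmonoidClass.coe_pow, hS, inv_pow]
    have e2 : ((-S ^ r : v.integers) : RatFunc F) = -(RatFunc.X ^ r)⁻¹ := by
      rw [NegMemClass.coe_neg, SubmonoidClass.coe_pow, hS, inv_pow]
    have h0 := map_zero (algebraMap v.integers (RatFunc F))
    rw [variableChange_def]
    ext
    · refine Eq.trans ?_ e1.symm
      simp [hessianCurve]
    · refine Eq.trans ?_ h0.symm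
      simp [hessianCurve]
    · refine Eq.trans ?_ e2.symm
      simp only [hessianCurve, Units.val_inv_eq_inv_val, Units.val_mk0]
      have : (RatFunc.X ^ k : RatFunc F) ^ 3 = RatFunc.X ^ d * RatFunc.X ^ r := by
        rw [← pow_mul, mul_comm, hkr, pow_add]
      rw [inv_pow, this]
      field_simp
      ring
    · refine Eq.trans ?_ h0.symm
      simp [hessianCurve]
    · refine Eq.trans ?_ h0.symm
      simp [hessianCurve]
  have hΔ : A.Δ = -(S ^ (4 * r) * (S ^ d + 27)) := by
    rw [cubic_Δ]
    have : (S ^ k) ^ 3 = S ^ d * S ^ r := by rw [← pow_mul, mul_comm, hkr, pow_add]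
    rw [this, pow_mul', Odd.neg_pow (by decide)]
    ring
  have h27 : IsUnit (27 : v.integers) := by
    have := (isUnit_natCast_integers v (n := 3) (by exact_mod_cast h3)).pow 3
    norm_num at this
    exact this
  have hunit : IsUnit (S ^ d + 27) := by
    rw [← IsLocalRing.notMem_maximalIdeal] at h27 ⊢
    intro h
    refine h27 ?_
    have := Ideal.sub_mem _ h (Ideal.pow_mem_of_mem _ hSm d (Nat.pos_of_ne_zero hd))
    rwa [add_sub_cancel_left] at this
  have hvu : v.valuation ((S ^ d + 27 : v.integers) : RatFunc F) = 1 := by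
    rw [← IsLocalRing.notMem_maximalIdeal, mem_maximalIdeal_integers, not_lt] at hunit
    exact le_antisymm (S ^ d + 27).2 hunit
  have hΔ0 : A.Δ ≠ 0 := by
    rw [hΔ]
    exact neg_ne_zero.mpr (mul_ne_zero (pow_ne_zero _ hS0) hunit.ne_zero)
  obtain ⟨D, hD⟩ := exists_reduction_minimal_eq (R := v.integers)
    (by exact_mod_cast isUnit_natCast_integers v (n := 2) (by exact_mod_cast h2))
    (by exact_mod_cast isUnit_natCast_integers v (n := 3) (by exact_mod_cast h3))
    hΔ0 (fun u hu x y _ hd' => by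
      -- the valuation of the discriminant is `4 r < 12`
      have hv1 : v.valuation (A.Δ : RatFunc F) = WithZero.exp (-(4 * r : ℕ) : ℤ) := by
        rw [hΔ, NegMemClass.coe_neg, Valuation.map_neg, MulMemClass.coe_mul, map_mul, hvu, mul_one,
          SubmonoidClass.coe_pow, map_pow, hS, hval, ← WithZero.exp_nsmul]
        simp
      have hv2 : v.valuation (A.Δ : RatFunc F) ≤ WithZero.exp (-12 : ℤ) := by
        rw [hd', MulMemClass.coe_mul, map_mul, SubmonoidClass.coe_pow, map_pow]
        have hy : v.valuation (y : RatFunc F) ≤ 1 := y.2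
        have hu1 : v.valuation (u : RatFunc F) ≤ WithZero.exp (-1 : ℤ) := by
          rw [mem_maximalIdeal_integers] at hu
          rw [← WithZero.lt_mul_exp_iff_le (WithZero.exp_ne_zero), ← WithZero.exp_add]
          simpa using hu
        calc _ ≤ WithZero.exp (-1 : ℤ) ^ 12 * 1 := mul_le_mul' (pow_le_pow_left' hu1 12) hy
          _ = _ := by rw [mul_one, ← WithZero.exp_nsmul]; simp
      rw [hv1, WithZero.exp_le_exp] at hv2
      push_cast at hv2
      omega) hA
  have hSr : IsLocalRing.residue v.integers S = 0 := by
    rw [IsLocalRing.residue_eq_zero_iff]; exact hSm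
  have hred : A.map (IsLocalRing.residue v.integers) = (hessianInfinity F d).map
      (RingEquiv.ofBijective (Place.infinity : Place F).constants constants_infinity_bijective :
        F →+* v.residueField) := by
    ext
    · change IsLocalRing.residue v.integers (S ^ k) = Place.constants v 0
      rw [map_pow, hSr, zero_pow hk, map_zero]
    · exact (map_zero _).trans (map_zero _).symm
    · change IsLocalRing.residue v.integers (-S ^ r) =
        Place.constants v (if 3 ∣ d then -1 else 0)
      rw [map_neg, map_pow, hSr]
      split_ifs with h
      · rw [hr3.mp h]; simp
      · rw [zero_pow (fun h' => h (hr3.mpr h'))]; simp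
    · exact (map_zero _).trans (map_zero _).symm
    · exact (map_zero _).trans (map_zero _).symm
  rw [localPolynomial_eq, hD, tracePolynomial_variableChange, hred, tracePolynomial_map,
    degree_infinity, expand_one]

end HessianReduction

end

/-! ### Traces of the Hessian family and Jacobi sums -/

section

open Polynomial WeierstrassCurve

section JacobiSums

variable {L Q : Type*} [Field L] [Fintype L] [Field Q]

theorem jacobiNeg_eq_sum (χ : MulChar L Q) :
    jacobiNeg χ = ∑ x : L, ∑ y : L, χ (-(x * y * (1 - x - y))) := by
  let e : L × L ≃ {x : L × L × L // x.1 + x.2.1 + x.2.2 = 1} :=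
    { toFun := fun x => ⟨(x.1, x.2, 1 - x.1 - x.2), by ring⟩
      invFun := fun x => (x.1.1, x.1.2.1)
      left_inv := fun x => rfl
      right_inv := fun x => by
        obtain ⟨⟨a, b, c⟩, h⟩ := x
        refine Subtype.ext (Prod.ext rfl (Prod.ext rfl ?_))
        simp only at h ⊢
        linear_combination -h }
  rw [jacobiNeg, ← Fintype.sum_prod_type', ← finsum_comp_equiv e, finsum_eq_sum_of_fintype]
  exact Finset.sum_congr rfl fun x _ => rfl

theorem jacobiNeg_eq_mul (χ : MulChar L Q) :
    jacobiNeg χ = χ (-1) * ∑ x : L, ∑ y : L, χ (x * y * (1 - x - y)) := by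
  rw [jacobiNeg_eq_sum, Finset.mul_sum]
  refine Finset.sum_congr rfl fun x _ => ?_
  rw [Finset.mul_sum]
  refine Finset.sum_congr rfl fun y _ => ?_
  rw [← map_mul, neg_one_mul]

/-- The triple Jacobi sum in terms of Gauss sums. -/
theorem sum_mul_gaussSum_pow_three {χ : MulChar L Q} (hχ : χ ^ 3 ≠ 1) (ψ : AddChar L Q) :
    (∑ x : L, ∑ y : L, χ (x * y * (1 - x - y))) * gaussSum (χ ^ 3) ψ = gaussSum χ ψ ^ 3 := by
  classical
  let T : L → Q := fun s => ∑ x : L, ∑ y : L, χ (x * y * (s - x - y))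
  have hscale : ∀ c : L, c ≠ 0 → ∀ s, T (c * s) = (χ ^ 3) c * T s := by
    intro c hc s
    simp only [T]
    rw [Finset.mul_sum, ← Equiv.sum_comp (Equiv.mulLeft₀ c hc)]
    refine Finset.sum_congr rfl fun x _ => ?_
    rw [Finset.mul_sum, ← Equiv.sum_comp (Equiv.mulLeft₀ c hc)]
    refine Finset.sum_congr rfl fun y _ => ?_
    rw [MulChar.pow_apply' _ (by norm_num), ← map_pow, ← map_mul χ]
    congr 1
    change c * x * (c * y) * (c * s - c * x - c * y) = _
    ring
  have hT0 : T 0 = 0 := by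
    obtain ⟨a, ha⟩ := MulChar.ne_one_iff.mp hχ
    have := hscale a a.ne_zero 0
    rw [mul_zero] at this
    exact eq_zero_of_mul_eq_self_left ha this.symm
  have hT : ∀ s, T s = (χ ^ 3) s * T 1 := by
    intro s
    rcases eq_or_ne s 0 with rfl | hs
    · rw [hT0, MulChar.map_zero, zero_mul]
    · rw [← hscale s hs, mul_one]
  -- expand the cube, and group the triples `(x, y, z)` by their sum `s`
  have h3 : gaussSum χ ψ ^ 3 = ∑ s, T s * ψ s := by
    have h1 : ∀ x y s : L, χ x * ψ x * (χ y * ψ y) * (χ (s - x - y) * ψ (s - x - y)) =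
        χ (x * y * (s - x - y)) * ψ s := by
      intro x y s
      rw [map_mul, map_mul, show s = x + y + (s - x - y) by ring, AddChar.map_add_eq_mul,
        AddChar.map_add_eq_mul]
      ring_nf
    have h2 : ∀ x y : L, ∑ z, χ z * ψ z = ∑ s, χ (s - x - y) * ψ (s - x - y) := fun x y =>
      (Equiv.sum_comp ((Equiv.subRight x).trans (Equiv.subRight y)) (fun z => χ z * ψ z)).symm
    calc gaussSum χ ψ ^ 3 = ∑ x, ∑ y, (χ x * ψ x * (χ y * ψ y)) * ∑ z, χ z * ψ z := by
          rw [pow_three', gaussSum, Finset.sum_mul_sum, Finset.sum_mul]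
          exact Finset.sum_congr rfl fun x _ => Finset.sum_mul _ _ _
      _ = ∑ x, ∑ y, ∑ s, χ (x * y * (s - x - y)) * ψ s := by
          refine Finset.sum_congr rfl fun x _ => Finset.sum_congr rfl fun y _ => ?_
          rw [h2 x y, Finset.mul_sum]
          exact Finset.sum_congr rfl fun s _ => h1 x y s
      _ = _ := by
          simp only [T, Finset.sum_mul]
          rw [Finset.sum_comm (s := Finset.univ (α := L)) (t := Finset.univ (α := L))
            (f := fun s x => ∑ y, χ (x * y * (s - x - y)) * ψ s)]
          exact Finset.sum_congr rfl fun x _ => Finset.sum_comm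
  rw [h3, gaussSum, Finset.mul_sum]
  refine Finset.sum_congr rfl fun s _ => ?_
  rw [hT s]
  ring

/-- For a cubic character the triple Jacobi sum reduces to a usual Jacobi sum. -/
theorem jacobiNeg_eq_neg_jacobiSum {χ : MulChar L Q} (hχ : χ ≠ 1) (h3 : χ ^ 3 = 1) :
    jacobiNeg χ = -jacobiSum χ χ := by
  classical
  have hneg : χ (-1) = 1 := MulChar.val_neg_one_eq_one_of_odd_order (by decide : Odd 3) h3
  have hinv : χ ^ 2 = χ⁻¹ := by
    rw [eq_inv_iff_mul_eq_one, ← pow_succ, h3]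
  have h2 : χ ^ 2 ≠ 1 := fun h => hχ (by rw [pow_succ, h, one_mul] at h3; exact h3)
  have key : ∀ x : L, ∑ y : L, χ (x * y * (1 - x - y)) =
      χ x * (χ ^ 2) (1 - x) * jacobiSum χ χ := by
    intro x
    by_cases hx : 1 - x = 0
    · rw [hx, MulChar.map_zero, mul_zero, zero_mul]
      have : ∀ y : L, χ (x * y * (0 - y)) = χ x * (χ ^ 2) y := by
        intro y
        rw [MulChar.pow_apply' _ two_ne_zero, zero_sub, ← neg_one_mul y, map_mul, map_mul, map_mul,
          hneg]
        ring
      rw [Finset.sum_congr rfl fun y _ => this y, ← Finset.mul_sum,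
        MulChar.sum_eq_zero_of_ne_one h2, mul_zero]
    · rw [jacobiSum, Finset.mul_sum, ← Equiv.sum_comp (Equiv.mulLeft₀ (1 - x) hx)]
      refine Finset.sum_congr rfl fun y _ => ?_
      rw [MulChar.pow_apply' _ two_ne_zero, ← map_pow, ← map_mul, ← map_mul, ← map_mul]
      congr 1
      change x * ((1 - x) * y) * (1 - x - (1 - x) * y) = _
      ring
  rw [jacobiNeg_eq_mul, hneg, one_mul, Finset.sum_congr rfl fun x _ => key x, ← Finset.sum_mul]
  have : ∑ x, χ x * (χ ^ 2) (1 - x) = jacobiSum χ (χ ^ 2) := rfl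
  rw [this, hinv, jacobiSum_nontrivial_inv hχ, hneg, neg_one_mul]

end JacobiSums

section CharacterSums

variable {L Q : Type*} [Field L] [Fintype L] [Field Q] [CharZero Q] [IsAlgClosed Q]

instance : Finite (MulChar L Q) := by
  classical
  exact Finite.of_equiv _ (MulChar.mulEquiv_units L Q).some.symm.toEquiv

/-- The multiplicative characters whose order divides `d`. -/
def charsOfOrderDvd (L Q : Type*) [Field L] [Fintype L] [Field Q] [CharZero Q] [IsAlgClosed Q]
    (d : ℕ) : Finset (MulChar L Q) :=
  (Set.toFinite {χ : MulChar L Q | χ ^ d = 1}).toFinset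

@[simp]
theorem mem_charsOfOrderDvd {d : ℕ} {χ : MulChar L Q} : χ ∈ charsOfOrderDvd L Q d ↔ χ ^ d = 1 := by
  simp [charsOfOrderDvd]

/-- Characters trivial on the `d`-th powers detect the non-`d`-th powers. -/
theorem exists_char_apply_ne_one {d : ℕ} {u : Lˣ} (hu : ∀ t : Lˣ, t ^ d ≠ u) :
    ∃ χ : MulChar L Q, χ ^ d = 1 ∧ χ u ≠ 1 := by
  classical
  let H : Subgroup Lˣ := (powMonoidHom d).range
  have hH : u ∉ H := by rintro ⟨t, ht⟩; exact hu t ht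
  set I := MulChar.subgroupOrderIsoSubgroupMulChar L Q
  have h := (MulChar.mem_subgroupOrderIsoSubgroupMulChar_symm_iff (M := L) (R := Q)
    (X := (I H).ofDual) (m := u)).not
  have h' : I.symm (OrderDual.toDual (I H).ofDual) = H := I.symm_apply_apply H
  rw [h'] at h
  have := h.mp hH
  push Not at this
  obtain ⟨χ, hχ, hne⟩ := this
  refine ⟨χ, ?_, hne⟩
  ext a
  rw [MulChar.pow_apply_coe, MulChar.one_apply_coe, ← map_pow]
  exact (MulChar.mem_subgroupOrderIsoSubgroupMulChar_iff (M := L) (R := Q)).mp hχ (a ^ d) ⟨a, rfl⟩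

/-- The number of `d`-th roots of an element, in terms of the characters of order dividing `d`. -/
theorem card_pow_eq {d : ℕ} (hd : d ≠ 0) (u : L) [Decidable (u = 0)] :
    (Nat.card {t : L // t ^ d = u} : Q) =
      (if u = 0 then 1 else 0) + ∑ χ ∈ charsOfOrderDvd L Q d, χ u := by
  classical
  rcases eq_or_ne u 0 with rfl | hu
  · rw [if_pos rfl, Finset.sum_eq_zero (fun χ _ => χ.map_zero)]
    have : Nat.card {t : L // t ^ d = 0} = 1 := by
      rw [Nat.card_eq_one_iff_unique]
      simp only [pow_eq_zero_iff hd]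
      exact ⟨inferInstance, inferInstance⟩
    rw [this]; simp
  rw [if_neg hu, zero_add]
  obtain ⟨u, rfl⟩ : ∃ v : Lˣ, (v : L) = u := ⟨Units.mk0 u hu, rfl⟩
  have hunits : Nat.card {t : L // t ^ d = u} = Nat.card {t : Lˣ // t ^ d = u} := by
    refine (Nat.card_congr (Equiv.ofBijective
      (fun t : {t : Lˣ // t ^ d = u} => (⟨t.1, by rw [← Units.val_pow_eq_pow_val, t.2]⟩ : {t : L // t ^ d = u}))
      ⟨fun a b h => Subtype.ext (Units.ext (congrArg Subtype.val h)), ?_⟩)).symm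
    rintro ⟨t, ht⟩
    have ht0 : t ≠ 0 := by rintro rfl; rw [zero_pow hd] at ht; exact hu ht.symm
    exact ⟨⟨Units.mk0 t ht0, Units.ext (by simpa using ht)⟩, rfl⟩
  rw [hunits]
  by_cases h : ∃ t : Lˣ, t ^ d = u
  · obtain ⟨t, rfl⟩ := h
    have h1 : ∀ χ ∈ charsOfOrderDvd L Q d, χ ((t ^ d : Lˣ) : L) = 1 := fun χ hχ => by
      rw [Units.val_pow_eq_pow_val, map_pow, ← MulChar.pow_apply_coe,
        mem_charsOfOrderDvd.mp hχ, MulChar.one_apply_coe]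
    rw [Finset.sum_congr rfl h1, Finset.sum_const, nsmul_one]
    congr 1
    have e1 : {s : Lˣ // s ^ d = t ^ d} ≃ {s : Lˣ // s ^ d = 1} :=
      (Equiv.divRight t).subtypeEquiv fun s => by simp [div_pow, div_eq_one]
    have e2 : {χ : MulChar L Q // χ ^ d = 1} ≃ {s : Lˣ // s ^ d = 1} :=
      (MulChar.mulEquiv_units L Q).some.toEquiv.subtypeEquiv fun χ => by
        change χ ^ d = 1 ↔ (MulChar.mulEquiv_units L Q).some χ ^ d = 1
        rw [← map_pow, map_eq_one_iff _ (MulEquiv.injective _)]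
    rw [Nat.card_congr (e1.trans e2.symm), ← Nat.card_eq_finsetCard]
    exact Nat.card_congr (Equiv.subtypeEquivRight fun χ => mem_charsOfOrderDvd.symm)
  · push Not at h
    have hemp : IsEmpty {t : Lˣ // t ^ d = u} := ⟨fun t => h t.1 t.2⟩
    rw [Nat.card_of_isEmpty, Nat.cast_zero]
    -- translating by a character which is not trivial at `u` multiplies the sum by a constant `≠ 1`
    obtain ⟨χ₀, hχ₀, hne⟩ := exists_char_apply_ne_one (Q := Q) h
    refine (eq_zero_of_mul_eq_self_left hne ?_).symm
    rw [Finset.mul_sum]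
    refine Finset.sum_bij' (fun χ _ => χ₀ * χ) (fun χ _ => χ₀⁻¹ * χ) ?_ ?_ ?_ ?_ ?_
    · intro χ hχ; rw [mem_charsOfOrderDvd] at *; rw [mul_pow, hχ, hχ₀, mul_one]
    · intro χ hχ; rw [mem_charsOfOrderDvd] at *; rw [mul_pow, inv_pow, hχ, hχ₀, mul_one, inv_one]
    · intro χ _; simp
    · intro χ _; simp
    · intro χ _; rfl

theorem one_mem_charsOfOrderDvd (d : ℕ) : (1 : MulChar L Q) ∈ charsOfOrderDvd L Q d := by simp

/-- The same count, the trivial character being set apart. -/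
theorem card_pow_eq_one_add [DecidableEq (MulChar L Q)] {d : ℕ} (hd : d ≠ 0) (u : L) :
    (Nat.card {t : L // t ^ d = u} : Q) =
      1 + ∑ χ ∈ (charsOfOrderDvd L Q d).erase 1, χ u := by
  classical
  rw [card_pow_eq hd, ← Finset.add_sum_erase _ _ (one_mem_charsOfOrderDvd d), ← add_assoc]
  congr 1
  split_ifs with h
  · rw [h, MulChar.map_zero, add_zero]
  · rw [MulChar.one_apply (isUnit_iff_ne_zero.mpr h), zero_add]

open Classical in
omit [CharZero Q] [IsAlgClosed Q] in
theorem affineTrace_self_eq_sum (W : WeierstrassCurve L) : (affineTrace W L : Q) =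
    Fintype.card L - ∑ y : L, ∑ x : L, if W.toAffine.Equation x y then 1 else 0 := by
  rw [affineTrace_self, Nat.card_eq_fintype_card, Nat.card_eq_fintype_card, Fintype.card_subtype,
    Finset.card_filter, Fintype.sum_prod_type, Finset.sum_comm]
  push_cast
  rfl

omit [CharZero Q] [IsAlgClosed Q] in
/-- The triple Jacobi sum as a sum over the total space `t = (y² + x y - x³) / y` of the Hessian
family for `d = 1`. By the convention `x³ / 0 = 0` the terms with `y = 0` are `χ x`, and contribute
`0` in total. -/
theorem sum_char_hessian {χ : MulChar L Q} (hχ : χ ≠ 1) :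
    ∑ y : L, ∑ x : L, χ (y + x - x ^ 3 / y) = jacobiNeg χ := by
  classical
  rw [Finset.sum_comm]
  have h1 : ∀ x : L, ∑ y : L, χ (y + x - x ^ 3 / y) = ∑ w : L, χ (x * w + x - x ^ 2 / w) := by
    intro x
    rcases eq_or_ne x 0 with rfl | hx
    · have e1 : ∀ y : L, χ (y + 0 - 0 ^ 3 / y) = χ y := fun y => by simp
      have e2 : ∀ w : L, χ (0 * w + 0 - 0 ^ 2 / w) = 0 := fun w => by simp [χ.map_zero]
      rw [Finset.sum_congr rfl fun y _ => e1 y, Finset.sum_congr rfl fun y _ => e2 y,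
        MulChar.sum_eq_zero_of_ne_one hχ, Finset.sum_const_zero]
    · rw [← Equiv.sum_comp (Equiv.mulLeft₀ x hx)]
      refine Finset.sum_congr rfl fun w _ => ?_
      change χ (x * w + x - x ^ 3 / (x * w)) = _
      congr 2
      rw [pow_succ', mul_div_mul_left _ _ hx]
  have h2 : ∀ w : L, ∑ x : L, χ (x * w + x - x ^ 2 / w) = ∑ z : L, χ (w * z * (w + 1 - z)) := by
    intro w
    rcases eq_or_ne w 0 with rfl | hw
    · have e1 : ∀ y : L, χ (y * 0 + y - y ^ 2 / 0) = χ y := fun y => by simp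
      have e2 : ∀ z : L, χ (0 * z * (0 + 1 - z)) = 0 := fun w => by simp [χ.map_zero]
      rw [Finset.sum_congr rfl fun y _ => e1 y, Finset.sum_congr rfl fun y _ => e2 y,
        MulChar.sum_eq_zero_of_ne_one hχ, Finset.sum_const_zero]
    · rw [← Equiv.sum_comp (Equiv.mulLeft₀ w hw)]
      refine Finset.sum_congr rfl fun z _ => ?_
      change χ (w * z * w + w * z - (w * z) ^ 2 / w) = _
      congr 1
      field_simp
  rw [Finset.sum_congr rfl fun x _ => h1 x, Finset.sum_comm, Finset.sum_congr rfl fun w _ => h2 w,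
    jacobiNeg_eq_sum, ← Equiv.sum_comp (Equiv.neg L)]
  refine Finset.sum_congr rfl fun x _ => Finset.sum_congr rfl fun y _ => ?_
  congr 1
  rw [Equiv.neg_apply]
  ring

/-- The points `(x, t)` with given `y` on the total space of the Hessian family are counted by solving
the equation for `t ^ d`; again the terms with `y = 0` on the right-hand side cancel. -/
theorem sum_ite_hessianAt [DecidableEq (MulChar L Q)] [DecidableEq L] {d : ℕ} (hd : d ≠ 0)
    (y : L) :
    ∑ x : L, ∑ t : L, (if y ^ 2 + x * y - t ^ d * y = x ^ 3 then 1 else 0 : Q) =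
      Fintype.card L + ∑ χ ∈ (charsOfOrderDvd L Q d).erase 1, ∑ x : L, χ (y + x - x ^ 3 / y) := by
  rcases eq_or_ne y 0 with rfl | hy
  · have e1 : ∀ x t : L, (if (0 : L) ^ 2 + x * 0 - t ^ d * 0 = x ^ 3 then 1 else 0 : Q) =
        if x = 0 then 1 else 0 := by
      intro x t
      refine if_congr ?_ rfl rfl
      simp [eq_comm (a := (0 : L))]
    simp_rw [e1]
    rw [Finset.sum_eq_zero (s := (charsOfOrderDvd L Q d).erase 1)]
    · simp
    · intro χ hχ
      have e2 : ∀ x : L, χ (0 + x - x ^ 3 / 0) = χ x := fun x => by simp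
      rw [Finset.sum_congr rfl fun x _ => e2 x,
        MulChar.sum_eq_zero_of_ne_one (Finset.ne_of_mem_erase hχ)]
  · have e1 : ∀ x : L, ∑ t : L, (if y ^ 2 + x * y - t ^ d * y = x ^ 3 then 1 else 0 : Q) =
        1 + ∑ χ ∈ (charsOfOrderDvd L Q d).erase 1, χ (y + x - x ^ 3 / y) := by
      intro x
      rw [← Finset.natCast_card_filter, ← Fintype.card_subtype, ← Nat.card_eq_fintype_card]
      have := card_pow_eq_one_add (Q := Q) hd (y + x - x ^ 3 / y)
      rw [show Nat.card {t : L // y ^ 2 + x * y - t ^ d * y = x ^ 3} =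
        Nat.card {t : L // t ^ d = y + x - x ^ 3 / y} from
          Nat.card_congr (Equiv.subtypeEquivRight fun t => ?_), this]
      · constructor
        · intro h; field_simp; linear_combination -h
        · intro h; field_simp at h; linear_combination -h
    rw [Finset.sum_congr rfl fun x _ => e1 x, Finset.sum_add_distrib, Finset.sum_comm]
    simp

/-- The sum of the traces of the fibres of the Hessian family over the affine line. -/
theorem sum_affineTrace_hessianAt [DecidableEq (MulChar L Q)] {d : ℕ} (hd : d ≠ 0) :
    ((∑ t : L, affineTrace (hessianAt (t ^ d)) L : ℤ) : Q) =
      -∑ χ ∈ (charsOfOrderDvd L Q d).erase 1, jacobiNeg χ := by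
  classical
  have h1 : ∀ t : L, (affineTrace (hessianAt (t ^ d)) L : Q) =
      Fintype.card L - ∑ y : L, ∑ x : L, if y ^ 2 + x * y - t ^ d * y = x ^ 3 then 1 else 0 := by
    intro t
    rw [affineTrace_self_eq_sum]
    congr 1
    refine Finset.sum_congr rfl fun y _ => Finset.sum_congr rfl fun x _ => if_congr ?_ rfl rfl
    rw [Affine.equation_iff]
    change y ^ 2 + 1 * x * y + -t ^ d * y = x ^ 3 + 0 * x ^ 2 + 0 * x + 0 ↔ _
    constructor <;> intro h <;> linear_combination h
  push_cast
  rw [Finset.sum_congr rfl fun t _ => h1 t, Finset.sum_sub_distrib, Finset.sum_comm]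
  have h2 : ∀ y : L, ∑ t : L, ∑ x : L,
      (if y ^ 2 + x * y - t ^ d * y = x ^ 3 then 1 else 0 : Q) = _ := fun y => by
    rw [Finset.sum_comm, sum_ite_hessianAt hd]
  rw [Finset.sum_congr rfl fun y _ => h2 y, Finset.sum_add_distrib, Finset.sum_comm,
    Finset.sum_congr rfl fun χ hχ => sum_char_hessian (Finset.ne_of_mem_erase hχ)]
  ring

/-- The fibre at infinity accounts for the characters of order `3`. -/
theorem affineTrace_hessianInfinity [DecidableEq (MulChar L Q)] {d : ℕ} (hd : d ≠ 0) (h2 : (2 : L) ≠ 0) :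
    (affineTrace (hessianInfinity L d) L : Q) =
      ∑ χ ∈ ((charsOfOrderDvd L Q d).erase 1).filter (fun χ => χ ^ 3 = 1), jacobiNeg χ := by
  classical
  have hfin : ∀ χ : MulChar L Q, 3 ∣ d → χ ^ 3 = 1 → χ ^ d = 1 := by
    rintro χ ⟨m, rfl⟩ h; rw [pow_mul, h, one_pow]
  by_cases h3 : 3 ∣ d
  · have hset : ((charsOfOrderDvd L Q d).erase 1).filter (fun χ => χ ^ 3 = 1) =
        (charsOfOrderDvd L Q 3).erase 1 := by
      ext χ
      simp only [Finset.mem_filter, Finset.mem_erase, mem_charsOfOrderDvd]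
      exact ⟨fun h => ⟨h.1.1, h.2⟩, fun h => ⟨⟨h.1, hfin χ h3 h.2⟩, h.2⟩⟩
    rw [hset, affineTrace_self_eq_sum]
    have h1 : ∀ y : L, ∑ x : L,
        (if (hessianInfinity L d).toAffine.Equation x y then 1 else 0 : Q) =
        1 + ∑ χ ∈ (charsOfOrderDvd L Q 3).erase 1, χ (y ^ 2 - y) := by
      intro y
      rw [← card_pow_eq_one_add three_ne_zero, ← Finset.natCast_card_filter,
        ← Fintype.card_subtype, ← Nat.card_eq_fintype_card]
      congr 1
      refine Nat.card_congr (Equiv.subtypeEquivRight fun x => ?_)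
      rw [Affine.equation_iff]
      simp only [hessianInfinity, h3, if_true]
      constructor <;> intro h <;> linear_combination -h
    rw [Finset.sum_congr rfl fun y _ => h1 y, Finset.sum_add_distrib, Finset.sum_comm]
    have h2 : ∀ χ ∈ (charsOfOrderDvd L Q 3).erase 1, ∑ y : L, χ (y ^ 2 - y) = -jacobiNeg χ := by
      intro χ hχ
      rw [Finset.mem_erase, mem_charsOfOrderDvd] at hχ
      have hneg : χ (-1) = 1 :=
        MulChar.val_neg_one_eq_one_of_odd_order (by decide : Odd 3) hχ.2
      rw [jacobiNeg_eq_neg_jacobiSum hχ.1 hχ.2, neg_neg, jacobiSum]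
      refine Finset.sum_congr rfl fun y _ => ?_
      rw [← map_mul, ← one_mul (χ (y * (1 - y))), ← hneg, ← map_mul]
      congr 1
      ring
    rw [Finset.sum_congr rfl h2]
    simp
  · have hset : ((charsOfOrderDvd L Q d).erase 1).filter (fun χ => χ ^ 3 = 1) = ∅ := by
      refine Finset.filter_eq_empty_iff.mpr fun χ hχ h => ?_
      simp only [Finset.mem_erase, mem_charsOfOrderDvd] at hχ
      refine hχ.1 ?_
      have := Nat.Coprime.gcd_eq_one ((Nat.Prime.coprime_iff_not_dvd Nat.prime_three).mpr h3)
      have h' := (pow_gcd_eq_one (a := χ)).mpr ⟨h, hχ.2⟩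
      rwa [this, pow_one] at h'
    rw [hset, Finset.sum_empty]
    have hdr : HasDoubleRoot (hessianInfinity L d) 0 0 := by
      constructor <;> simp [hessianInfinity, h3, WeierstrassCurve.b₂, WeierstrassCurve.b₄,
        WeierstrassCurve.b₆]
    rw [affineTrace_self, hdr.card_sub h2]
    simp

/-- The sum of the traces of all the fibres of the Hessian family. -/
theorem sum_affineTrace_hessian [DecidableEq (MulChar L Q)] {d : ℕ} (hd : d ≠ 0)
    (h2 : (2 : L) ≠ 0) :
    ((∑ t : L, affineTrace (hessianAt (t ^ d)) L + affineTrace (hessianInfinity L d) L : ℤ) : Q) =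
      -∑ χ ∈ (charsOfOrderDvd L Q d).filter (fun χ => χ ^ 3 ≠ 1), jacobiNeg χ := by
  rw [Int.cast_add, sum_affineTrace_hessianAt hd, affineTrace_hessianInfinity hd h2,
    ← Finset.sum_filter_add_sum_filter_not ((charsOfOrderDvd L Q d).erase 1) (fun χ => χ ^ 3 = 1)]
  have : ((charsOfOrderDvd L Q d).erase 1).filter (fun χ => ¬χ ^ 3 = 1) =
      (charsOfOrderDvd L Q d).filter (fun χ => χ ^ 3 ≠ 1) := by
    ext χ
    simp only [Finset.mem_filter, Finset.mem_erase]
    refine ⟨fun h => ⟨h.1.2, h.2⟩, fun h => ⟨⟨?_, h.1⟩, h.2⟩⟩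
    rintro rfl
    exact h.2 (one_pow 3)
  rw [this]
  ring

end CharacterSums

end

/-! ### The Hasse–Davenport relation -/

section

open Polynomial IsDedekindDomain

section MonicGenerators

variable {k : Type*} [Field k]

/-- The monic generator of a non-zero ideal of `k[X]`. -/
def monicGen (I : Ideal k[X]) : k[X] :=
  Submodule.IsPrincipal.generator I * C (Submodule.IsPrincipal.generator I).leadingCoeff⁻¹

theorem generator_ne_zero {I : Ideal k[X]} (hI : I ≠ ⊥) : Submodule.IsPrincipal.generator I ≠ 0 :=
  fun h => hI ((Submodule.IsPrincipal.eq_bot_iff_generator_eq_zero I).mpr h)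

theorem monicGen_monic {I : Ideal k[X]} (hI : I ≠ ⊥) : (monicGen I).Monic :=
  monic_mul_leadingCoeff_inv (generator_ne_zero hI)

theorem span_monicGen (I : Ideal k[X]) : Ideal.span {monicGen I} = I := by
  rcases eq_or_ne I ⊥ with rfl | hI
  · rw [monicGen, (Submodule.IsPrincipal.eq_bot_iff_generator_eq_zero (⊥ : Ideal k[X])).mp rfl]
    simp
  · have hu : IsUnit (C (Submodule.IsPrincipal.generator I).leadingCoeff⁻¹) :=
      isUnit_C.mpr (isUnit_iff_ne_zero.mpr (inv_ne_zero (leadingCoeff_ne_zero.mpr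
        (generator_ne_zero hI))))
    rw [monicGen, Ideal.span_singleton_mul_right_unit hu, Ideal.span_singleton_generator]

theorem monicGen_span {f : k[X]} (hf : f.Monic) : monicGen (Ideal.span {f}) = f := by
  have h0 : Ideal.span {f} ≠ ⊥ := by simpa using hf.ne_zero
  exact eq_of_monic_of_associated (monicGen_monic h0) hf
    (Ideal.span_singleton_eq_span_singleton.mp (span_monicGen _))

theorem monicGen_mul {I J : Ideal k[X]} (hI : I ≠ ⊥) (hJ : J ≠ ⊥) :
    monicGen (I * J) = monicGen I * monicGen J := by
  conv_lhs => rw [← span_monicGen I, ← span_monicGen J, Ideal.span_singleton_mul_span_singleton]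
  exact monicGen_span ((monicGen_monic hI).mul (monicGen_monic hJ))

theorem ideg_eq_natDegree (I : Ideal k[X]) : ideg k I = (monicGen I).natDegree := by
  conv_lhs => rw [← span_monicGen I]
  exact finrank_quotient_span_eq_natDegree

end MonicGenerators

section HasseDavenport

variable {k Q : Type*} [Field k] [Field Q]

open Classical in
/-- The completely multiplicative function `f ↦ χ (N f) ψ (T f)` on monic polynomials, where `N f`
is the product and `T f` the sum of the roots of `f`. It is written as a function of the ideal
generated by `f`, with value `0` at the zero ideal. -/
def gaussWeight (χ : MulChar k Q) (ψ : AddChar k Q) : Ideal k[X] →* Q where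
  toFun I := if I = ⊥ then 0 else
    χ ((-1) ^ (monicGen I).natDegree * (monicGen I).coeff 0) * ψ (-(monicGen I).nextCoeff)
  map_one' := by
    have h1 : (1 : Ideal k[X]) ≠ ⊥ := by
      rw [Ideal.one_eq_top]; exact top_ne_bot
    have h2 : monicGen (1 : Ideal k[X]) = 1 := by
      rw [Ideal.one_eq_top, ← Ideal.span_singleton_one, monicGen_span monic_one]
    rw [if_neg h1, h2, ← C_1, nextCoeff_C_eq_zero]
    simp
  map_mul' I J := by
    by_cases hI : I = ⊥
    · simp [hI]
    by_cases hJ : J = ⊥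
    · simp [hJ]
    have hIJ : I * J ≠ ⊥ := mul_ne_zero hI hJ
    rw [if_neg hI, if_neg hJ, if_neg hIJ, monicGen_mul hI hJ,
      (monicGen_monic hI).natDegree_mul (monicGen_monic hJ),
      (monicGen_monic hI).nextCoeff_mul (monicGen_monic hJ), mul_coeff_zero, neg_add,
      AddChar.map_add_eq_mul, pow_add, mul_mul_mul_comm, map_mul]
    ring

theorem gaussWeight_span {χ : MulChar k Q} {ψ : AddChar k Q} {f : k[X]} (hf : f.Monic) :
    gaussWeight χ ψ (Ideal.span {f}) = χ ((-1) ^ f.natDegree * f.coeff 0) * ψ (-f.nextCoeff) := by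
  have h0 : Ideal.span {f} ≠ ⊥ := by simpa using hf.ne_zero
  change ite _ _ _ = _
  rw [if_neg h0, monicGen_span hf]

section Lift

/-- The lift of a multiplicative character by the norm. -/
def normLift (χ : MulChar k Q) (L : Type*) [Field L] [Algebra k L] [Module.Finite k L] :
    MulChar L Q where
  toMonoidHom := χ.toMonoidHom.comp (Algebra.norm k)
  map_nonunit' x hx := by
    rw [isUnit_iff_ne_zero, not_not] at hx
    subst hx
    change χ (Algebra.norm k 0) = 0
    rw [Algebra.norm_zero, χ.map_zero]

variable {L : Type*} [Field L] [Algebra k L] [Module.Finite k L]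

theorem normLift_apply (χ : MulChar k Q) (x : L) : normLift χ L x = χ (Algebra.norm k x) := rfl

theorem normLift_pow (χ : MulChar k Q) (m : ℕ) : normLift χ L ^ m = normLift (χ ^ m) L := by
  ext u
  have hu : IsUnit (Algebra.norm k (u : L)) := u.isUnit.map _
  rw [MulChar.pow_apply_coe, normLift_apply, normLift_apply, ← hu.unit_spec,
    MulChar.pow_apply_coe]

theorem normLift_injective [Finite k] : Function.Injective (fun χ : MulChar k Q => normLift χ L) := by
  intro χ χ' h
  have : Finite L := Module.finite_of_finite k
  ext u
  obtain ⟨x, hx⟩ := FiniteField.norm_surjective k L (u : k)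
  rw [← hx, ← normLift_apply, ← normLift_apply]
  exact DFunLike.congr_fun h x

theorem normLift_one : normLift (1 : MulChar k Q) L = 1 := by
  ext u
  have hu : IsUnit (Algebra.norm k (u : L)) := u.isUnit.map _
  rw [normLift_apply, MulChar.one_apply hu, MulChar.one_apply u.isUnit]

end Lift

variable [Fintype k]

/-- The zeta function attached to a Gauss sum: the sum of `gaussWeight χ ψ` over the monic polynomials
of degree at least `2` vanishes. -/
theorem zetaSeries_gaussWeight (χ : MulChar k Q) {ψ : AddChar k Q} (hψ : ψ ≠ 1) :
    zetaSeries k (gaussWeight χ ψ) = 1 + PowerSeries.C (gaussSum χ ψ) * PowerSeries.X := by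
  classical
  ext n
  rw [zetaSeries, PowerSeries.coeff_mk]
  rcases n with _ | _ | n
  · rw [idealsOfDegree_zero, Finset.sum_singleton, ← Ideal.one_eq_top, map_one]
    simp
  · rw [map_add, PowerSeries.coeff_succ_mul_X, gaussSum]
    simp only [PowerSeries.coeff_one, PowerSeries.coeff_C]
    simp only [one_ne_zero, if_false, zero_add, if_true]
    symm
    refine Finset.sum_bij' (fun a _ => Ideal.span {X - C a}) (fun I _ => -(monicGen I).coeff 0)
      ?_ ?_ ?_ ?_ ?_
    · intro a _
      rw [mem_idealsOfDegree, ideg_eq_natDegree, monicGen_span (monic_X_sub_C a), natDegree_X_sub_C]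
      exact ⟨by simpa using X_sub_C_ne_zero a, rfl⟩
    · intro I _; exact Finset.mem_univ _
    · intro a _
      rw [monicGen_span (monic_X_sub_C a)]
      simp
    · intro I hI
      rw [mem_idealsOfDegree, ideg_eq_natDegree] at hI
      have hm := (monicGen_monic hI.1)
      conv_rhs => rw [← span_monicGen I]
      rw [hm.eq_X_add_C hI.2]
      simp
    · intro a _
      rw [gaussWeight_span (monic_X_sub_C a), natDegree_X_sub_C, nextCoeff_X_sub_C]
      simp
  · have hrhs : PowerSeries.coeff (n + 1 + 1)
        (1 + PowerSeries.C (gaussSum χ ψ) * PowerSeries.X) = 0 := by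
      rw [map_add, PowerSeries.coeff_succ_mul_X]
      simp [PowerSeries.coeff_one]
    rw [hrhs]
    obtain ⟨c, hc⟩ := (AddChar.ne_one_iff).mp hψ
    -- translating the subleading coefficient multiplies the sum by `ψ c ≠ 1`
    have hlt : ∀ a : k, (C a * X ^ (n + 1)).degree < ((n + 2 : ℕ) : WithBot ℕ) := fun a =>
      (degree_C_mul_X_pow_le _ _).trans_lt (by exact_mod_cast Nat.lt_succ_self _)
    have hmon : ∀ (a : k) (f : k[X]), f.Monic → f.natDegree = n + 2 →
        (f + C a * X ^ (n + 1)).Monic ∧ (f + C a * X ^ (n + 1)).natDegree = n + 2 := by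
      intro a f hf hd
      have hdeg : (C a * X ^ (n + 1)).degree < f.degree := by
        rw [degree_eq_natDegree hf.ne_zero, hd]; exact hlt a
      exact ⟨hf.add_of_left hdeg, by rw [natDegree_add_eq_left_of_degree_lt hdeg, hd]⟩
    have hmem : ∀ (a : k), ∀ I ∈ idealsOfDegree k k[X] (n + 2),
        monicGen (Ideal.span {monicGen I + C a * X ^ (n + 1)}) = monicGen I + C a * X ^ (n + 1) ∧
        Ideal.span {monicGen I + C a * X ^ (n + 1)} ∈ idealsOfDegree k k[X] (n + 2) := by
      intro a I hI
      rw [mem_idealsOfDegree, ideg_eq_natDegree] at hI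
      obtain ⟨h1, h2⟩ := hmon a _ (monicGen_monic hI.1) hI.2
      refine ⟨monicGen_span h1, ?_⟩
      rw [mem_idealsOfDegree, ideg_eq_natDegree, monicGen_span h1]
      exact ⟨by simpa using h1.ne_zero, h2⟩
    refine eq_zero_of_mul_eq_self_left hc ?_
    rw [Finset.mul_sum]
    refine Finset.sum_bij' (fun I _ => Ideal.span {monicGen I + C (-c) * X ^ (n + 1)})
      (fun I _ => Ideal.span {monicGen I + C c * X ^ (n + 1)}) ?_ ?_ ?_ ?_ ?_
    · intro I hI; exact (hmem _ I hI).2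
    · intro I hI; exact (hmem _ I hI).2
    · intro I hI
      rw [(hmem _ I hI).1]
      simp [span_monicGen]
    · intro I hI
      rw [(hmem _ I hI).1]
      simp [span_monicGen]
    · intro I hI
      rw [mem_idealsOfDegree, ideg_eq_natDegree] at hI
      obtain ⟨h1, h2⟩ := hmon (-c) _ (monicGen_monic hI.1) hI.2
      rw [gaussWeight_span h1, h2]
      conv_lhs => rw [← span_monicGen I, gaussWeight_span (monicGen_monic hI.1), hI.2]
      rw [nextCoeff_of_natDegree_pos (by omega), nextCoeff_of_natDegree_pos (by omega), h2, hI.2]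
      simp only [coeff_add, coeff_C_mul, coeff_X_pow]
      have e1 : n + 1 + 1 - 1 = n + 1 := rfl
      simp only [Nat.add_sub_cancel, neg_add, AddChar.map_add_eq_mul]
      simp
      ring

section

variable {L : Type*} [Field L] [Algebra k L] [Module.Finite k L]

/-- The Hasse–Davenport lifting relation, by comparing the two expressions of the logarithmic
derivative of the zeta function `1 + g T`. -/
theorem gaussSum_normLift [Fintype L] (χ : MulChar k Q) {ψ : AddChar k Q} (hψ : ψ ≠ 1) :
    gaussSum (normLift χ L) (ψ.compAddMonoidHom (Algebra.trace k L).toAddMonoidHom) =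
      -(-gaussSum χ ψ) ^ Module.finrank k L := by
  classical
  set g := gaussSum χ ψ
  set n := Module.finrank k L
  have hn : 0 < n := Module.finrank_pos
  have hz := X_mul_derivative_zetaSeries k (gaussWeight χ ψ)
  rw [zetaSeries_gaussWeight χ hψ] at hz
  set S := primeSeries k (gaussWeight χ ψ)
  have hd : PowerSeries.derivative Q (1 + PowerSeries.C g * PowerSeries.X) = PowerSeries.C g := by
    simp [PowerSeries.derivative_X]
  rw [hd] at hz
  have hS : ∀ m, PowerSeries.coeff (m + 1) S = -(-g) ^ (m + 1) := by
    intro m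
    have h := congrArg (PowerSeries.coeff (m + 1)) hz
    rw [mul_comm PowerSeries.X, PowerSeries.coeff_succ_mul_X, mul_add, mul_one, mul_left_comm, map_add,
      PowerSeries.coeff_C_mul, PowerSeries.coeff_succ_mul_X, PowerSeries.coeff_C] at h
    induction m with
    | zero =>
      have h0 : PowerSeries.coeff 0 S = 0 := by
        simp [S, primeSeries, primesOfDegreeDvd]
      rw [h0] at h
      simp at h ⊢
      exact h.symm
    | succ m ih =>
      have h' := congrArg (PowerSeries.coeff (m + 1)) hz
      rw [mul_comm PowerSeries.X, PowerSeries.coeff_succ_mul_X, mul_add, mul_one, mul_left_comm, map_add,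
        PowerSeries.coeff_C_mul, PowerSeries.coeff_succ_mul_X, PowerSeries.coeff_C] at h'
      rw [ih h'] at h
      simp at h
      rw [eq_neg_of_add_eq_zero_left h.symm]
      ring
  obtain ⟨m, hm⟩ : ∃ m, n = m + 1 := ⟨n - 1, by omega⟩
  rw [hm, ← hS m, ← hm]
  have : Fintype (k[X] →ₐ[k] L) := Fintype.ofEquiv L (aevalEquiv k L)
  have hsum := sum_algHom_eq_sum_primes (k := k) (A := k[X]) (L := L)
    (fun P => gaussWeight χ ψ P.asIdeal ^ (n / ideg k P.asIdeal))
  have hS' : PowerSeries.coeff n S = ∑ φ : k[X] →ₐ[k] L,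
      gaussWeight χ ψ (kerPrime φ).asIdeal ^ (n / ideg k (kerPrime φ).asIdeal) := by
    rw [hsum]
    simp only [S, primeSeries, PowerSeries.coeff_mk]
    exact Finset.sum_congr rfl fun P _ => (nsmul_eq_mul _ _).symm
  rw [hS', gaussSum, ← Equiv.sum_comp (aevalEquiv k L)]
  refine Finset.sum_congr rfl fun x _ => ?_
  have hint : IsIntegral k x := Algebra.IsIntegral.isIntegral x
  have hker : (kerPrime (aevalEquiv k L x)).asIdeal = Ideal.span {minpoly k x} :=
    minpoly.ker_aeval_eq_span_minpoly k x
  have hmon := minpoly.monic hint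
  have hdeg : ideg k (Ideal.span {minpoly k x}) = (minpoly k x).natDegree :=
    finrank_quotient_span_eq_natDegree
  have hdiv : n / (minpoly k x).natDegree = Module.finrank (IntermediateField.adjoin k {x}) L := by
    rw [← IntermediateField.adjoin.finrank hint]
    refine Nat.div_eq_of_eq_mul_right Module.finrank_pos ?_
    exact (Module.finrank_mul_finrank k (IntermediateField.adjoin k {x}) L).symm
  rw [hker, hdeg, hdiv, gaussWeight_span hmon, mul_pow, ← map_pow, ← AddChar.map_nsmul_eq_pow]
  have htr := trace_eq_finrank_mul_minpoly_nextCoeff k x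
  have hno := Algebra.norm_eq_norm_adjoin k x
  rw [← IntermediateField.adjoin.powerBasis_gen hint,
    Algebra.PowerBasis.norm_gen_eq_coeff_zero_minpoly, IntermediateField.adjoin.powerBasis_gen hint,
    IntermediateField.minpoly_gen, ← PowerBasis.finrank,
    IntermediateField.adjoin.finrank hint] at hno
  rw [normLift_apply, hno, nsmul_eq_mul, ← htr]
  rfl

end

variable [CharZero Q] [IsAlgClosed Q]

omit [Fintype k] in
theorem exists_addChar_isPrimitive [Finite k] : ∃ ψ : AddChar k Q, ψ.IsPrimitive := by
  have hne : ringChar Q ≠ ringChar k := by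
    rw [ringChar.eq_zero]
    exact (CharP.char_ne_zero_of_finite k (ringChar k)).symm
  let ψ := AddChar.FiniteField.primitiveChar k Q hne
  have : NeZero ((ψ.n : ℕ) : Q) := ⟨Nat.cast_ne_zero.mpr ψ.n.ne_zero⟩
  have := IsCyclotomicExtension.finiteDimensional {(ψ.n : ℕ)} Q (CyclotomicField ψ.n Q)
  let ι : CyclotomicField ψ.n Q →ₐ[Q] Q := IsAlgClosed.lift
  exact ⟨(ι : CyclotomicField ψ.n Q →* Q).compAddChar ψ.char,
    ψ.prim.compMulHom_of_isPrimitive ι.injective⟩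

/-- The Jacobi sum of a lifted character is a power: express it through Gauss sums and apply the
Hasse–Davenport relation. -/
theorem jacobiNeg_normLift {L : Type*} [Field L] [Finite L] [Algebra k L] [Module.Finite k L]
    {χ : MulChar k Q} (hχ : χ ^ 3 ≠ 1) :
    jacobiNeg (normLift χ L) = jacobiNeg χ ^ Module.finrank k L := by
  have := Fintype.ofFinite L
  obtain ⟨ψ, hψ⟩ := exists_addChar_isPrimitive (k := k) (Q := Q)
  have hψ1 : ψ ≠ 1 := by
    rintro rfl
    exact hψ one_ne_zero (by ext; simp)
  have hχ3 : normLift χ L ^ 3 ≠ 1 := fun h => hχ (normLift_injective (L := L) (by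
    change normLift (χ ^ 3) L = normLift 1 L
    rw [← normLift_pow, h, normLift_one]))
  have hg3 : gaussSum (χ ^ 3) ψ ≠ 0 :=
    gaussSum_ne_zero_of_nontrivial (by exact_mod_cast Fintype.card_ne_zero) hχ hψ
  have h1 := sum_mul_gaussSum_pow_three hχ ψ
  have h2 := sum_mul_gaussSum_pow_three hχ3
    (ψ.compAddMonoidHom (Algebra.trace k L).toAddMonoidHom)
  rw [normLift_pow, gaussSum_normLift _ hψ1, gaussSum_normLift _ hψ1] at h2
  rw [jacobiNeg_eq_mul, jacobiNeg_eq_mul, normLift_apply, mul_pow]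
  have hneg : χ (Algebra.norm k (-1 : L)) = χ (-1) ^ Module.finrank k L := by
    rw [show (-1 : L) = algebraMap k L (-1) by simp, Algebra.norm_algebraMap, map_pow]
  rw [hneg]
  congr 1
  set n := Module.finrank k L
  set J := ∑ x : k, ∑ y : k, χ (x * y * (1 - x - y))
  refine mul_right_cancel₀ (b := -(-gaussSum (χ ^ 3) ψ) ^ n)
    (neg_ne_zero.mpr (pow_ne_zero _ (neg_ne_zero.mpr hg3))) ?_
  rw [h2, mul_neg, ← mul_pow, mul_neg, h1]
  rw [Odd.neg_pow (by decide : Odd 3), ← pow_mul, mul_comm n 3, pow_mul,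
    Odd.neg_pow (by decide : Odd 3)]

end HasseDavenport

end

/-! ### The logarithmic derivative of the `L`-function -/

section

open Polynomial IsDedekindDomain WeierstrassCurve

section EulerProducts

theorem X_mul_derivative_expand {R : Type*} [CommRing R] {m : ℕ} (hm : m ≠ 0) (f : PowerSeries R) :
    PowerSeries.X * PowerSeries.derivative R (PowerSeries.expand m hm f) =
      m • PowerSeries.expand m hm (PowerSeries.X * PowerSeries.derivative R f) := by
  have hX : ∀ (g : PowerSeries R) n, PowerSeries.coeff n (PowerSeries.X * PowerSeries.derivative R g) =
      n * PowerSeries.coeff n g := by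
    intro g n
    rcases n with _ | n
    · simp
    · rw [PowerSeries.coeff_succ_X_mul, PowerSeries.coeff_derivative]
      push_cast
      ring
  ext n
  rw [hX, map_nsmul]
  by_cases h : m ∣ n
  · obtain ⟨j, rfl⟩ := h
    rw [PowerSeries.coeff_expand_mul, PowerSeries.coeff_expand_mul, hX]
    push_cast
    rw [nsmul_eq_mul]
    ring
  · rw [PowerSeries.coeff_expand_of_not_dvd _ _ _ h, PowerSeries.coeff_expand_of_not_dvd _ _ _ h]
    simp

theorem coe_expand {R : Type*} [CommRing R] {m : ℕ} (hm : m ≠ 0) (f : R[X]) :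
    ((Polynomial.expand R m f : R[X]) : PowerSeries R) = PowerSeries.expand m hm (f : PowerSeries R) := by
  ext n
  rw [Polynomial.coeff_coe, Polynomial.coeff_expand (Nat.pos_of_ne_zero hm),
    PowerSeries.coeff_expand, Polynomial.coeff_coe]

variable {ι : Type*}

theorem coeff_prod_eq_of_X_pow_dvd {ε : ι → PowerSeries ℤ} {deg : ι → ℕ}
    (h : ∀ i, PowerSeries.X ^ deg i ∣ ε i - 1) {n : ℕ} {s t : Finset ι} (hst : s ⊆ t)
    (hs : ∀ i, deg i ≤ n → i ∈ s) :
    PowerSeries.coeff n (∏ i ∈ t, ε i) = PowerSeries.coeff n (∏ i ∈ s, ε i) := by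
  classical
  have h1 : PowerSeries.X ^ (n + 1) ∣ (∏ i ∈ t \ s, ε i) - 1 := by
    refine Finset.prod_induction ε (fun f => PowerSeries.X ^ (n + 1) ∣ f - 1) ?_ (by simp) ?_
    · intro a b ha hb
      have : a * b - 1 = (a - 1) * b + (b - 1) := by ring
      rw [this]
      exact dvd_add (dvd_mul_of_dvd_left ha b) hb
    · intro i hi
      refine (pow_dvd_pow _ ?_).trans (h i)
      by_contra hlt
      exact (Finset.mem_sdiff.mp hi).2 (hs i (by omega))
  have h2 : PowerSeries.X ^ (n + 1) ∣ (∏ i ∈ t, ε i) - ∏ i ∈ s, ε i := by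
    rw [← Finset.prod_sdiff hst]
    have : (∏ i ∈ t \ s, ε i) * ∏ i ∈ s, ε i - ∏ i ∈ s, ε i =
      ((∏ i ∈ t \ s, ε i) - 1) * ∏ i ∈ s, ε i := by ring
    rw [this]
    exact dvd_mul_of_dvd_left h1 _
  have := PowerSeries.X_pow_dvd_iff.mp h2 n (Nat.lt_succ_self n)
  rwa [map_sub, sub_eq_zero] at this

/-- A product of power series converges coefficientwise as soon as all but finitely many factors are
`1` modulo any given power of the variable. -/
theorem multipliable_of_X_pow_dvd {ε : ι → PowerSeries ℤ} {deg : ι → ℕ}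
    (h : ∀ i, PowerSeries.X ^ deg i ∣ ε i - 1) (hfin : ∀ n, {i | deg i ≤ n}.Finite) :
    Multipliable ε := by
  refine ⟨PowerSeries.mk fun n => PowerSeries.coeff n (∏ i ∈ (hfin n).toFinset, ε i), ?_⟩
  rw [HasProd, PowerSeries.WithPiTopology.tendsto_iff_coeff_tendsto]
  intro n
  rw [PowerSeries.coeff_mk]
  refine tendsto_const_nhds.congr' ?_
  filter_upwards [Filter.eventually_ge_atTop (hfin n).toFinset] with t ht
  exact (coeff_prod_eq_of_X_pow_dvd h ht fun i hi => by simpa using hi).symm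

/-- Logarithmic derivative of a convergent product. -/
theorem X_mul_derivative_tprod {ε V : ι → PowerSeries ℤ} {S : PowerSeries ℤ}
    (hε : Multipliable ε) (hV : HasSum V S)
    (h : ∀ i, PowerSeries.X * PowerSeries.derivative ℤ (ε i) = V i * ε i) :
    PowerSeries.X * PowerSeries.derivative ℤ (∏' i, ε i) = S * ∏' i, ε i := by
  classical
  have hfin : ∀ s : Finset ι, PowerSeries.X * PowerSeries.derivative ℤ (∏ i ∈ s, ε i) =
      (∑ i ∈ s, V i) * ∏ i ∈ s, ε i := by
    intro s
    induction s using Finset.induction_on with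
    | empty => simp
    | insert i s hi ih =>
      rw [Finset.prod_insert hi, Finset.sum_insert hi, Derivation.leibniz, smul_eq_mul, smul_eq_mul]
      linear_combination ε i * ih + (∏ i ∈ s, ε i) * h i
  have h1 : Filter.Tendsto (fun s : Finset ι => (∑ i ∈ s, V i) * ∏ i ∈ s, ε i) Filter.atTop
      (nhds (S * ∏' i, ε i)) := Filter.Tendsto.mul hV hε.hasProd
  have hd : Continuous (fun f : PowerSeries ℤ => PowerSeries.X * PowerSeries.derivative ℤ f) := by
    refine continuous_const.mul (continuous_iff_continuousAt.mpr fun f => ?_)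
    rw [ContinuousAt, PowerSeries.WithPiTopology.tendsto_iff_coeff_tendsto]
    intro n
    simp only [PowerSeries.coeff_derivative]
    exact ((PowerSeries.WithPiTopology.continuous_coeff ℤ (n + 1)).tendsto f).mul tendsto_const_nhds
  have h2 := (hd.tendsto (∏' i, ε i)).comp hε.hasProd
  refine tendsto_nhds_unique h2 (h1.congr fun s => (hfin s).symm)

end EulerProducts

section HessianSeries

variable {k : Type*} [Field k] [Finite k]

omit [Finite k] in
theorem ne_zero_of_algebra {n : ℕ} (h : (n : k) ≠ 0) (L : Type*) [Field L] [Algebra k L] :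
    (n : L) ≠ 0 := by
  rw [← map_natCast (algebraMap k L)]
  exact (_root_.map_ne_zero _).mpr h

/-- The singular fibres of the Hessian family are at `c = 0` and `c = -1 / 27`. -/
theorem exists_isTraceSeries_hessianAt.{w} (h2 : (2 : k) ≠ 0) (h3 : (3 : k) ≠ 0) (c : k) :
    ∃ U : PowerSeries ℤ, PowerSeries.constantCoeff U = 0 ∧
      PowerSeries.X * PowerSeries.derivative ℤ (tracePolynomial (hessianAt c) : PowerSeries ℤ) =
        -U * (tracePolynomial (hessianAt c) : PowerSeries ℤ) ∧
      IsTraceSeries.{_, w} (hessianAt c) U := by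
  by_cases hΔ : (hessianAt c).Δ = 0
  · rw [hessianAt, cubic_Δ, mul_eq_zero, pow_eq_zero_iff three_ne_zero, neg_eq_zero] at hΔ
    rcases hΔ with rfl | hc
    · refine exists_isTraceSeries_of_hasDoubleRoot h2 (x₀ := 0) (e := 1) ?_
      constructor <;> simp [hessianAt, WeierstrassCurve.b₂, WeierstrassCurve.b₄,
        WeierstrassCurve.b₆]
    · have h9 : (9 : k) ≠ 0 := by
        have : (9 : k) = 3 * 3 := by norm_num
        rw [this]; exact mul_ne_zero h3 h3
      have h27 : (27 : k) ≠ 0 := by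
        have : (27 : k) = 3 * 9 := by norm_num
        rw [this]; exact mul_ne_zero h3 h9
      have hc' : c = -1 / 27 := by
        field_simp
        linear_combination hc
      subst hc'
      refine exists_isTraceSeries_of_hasDoubleRoot h2 (x₀ := -1 / 9) (e := 1 / 9) ?_
      constructor
      · simp only [hessianAt, WeierstrassCurve.b₂]
        field_simp
        norm_num
      · simp only [hessianAt, WeierstrassCurve.b₄]
        field_simp
        norm_num
      · simp only [hessianAt, WeierstrassCurve.b₆]
        field_simp
        norm_num
  · exact exists_isTraceSeries_of_smooth h2 hΔ

theorem exists_isTraceSeries_hessianInfinity.{w} (h2 : (2 : k) ≠ 0) (h3 : (3 : k) ≠ 0) (d : ℕ) :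
    ∃ U : PowerSeries ℤ, PowerSeries.constantCoeff U = 0 ∧
      PowerSeries.X * PowerSeries.derivative ℤ (tracePolynomial (hessianInfinity k d) : PowerSeries ℤ) =
        -U * (tracePolynomial (hessianInfinity k d) : PowerSeries ℤ) ∧
      IsTraceSeries.{_, w} (hessianInfinity k d) U := by
  by_cases h : 3 ∣ d
  · refine exists_isTraceSeries_of_smooth h2 ?_
    rw [hessianInfinity, cubic_Δ, if_pos h]
    have : (-1 : k) ^ 3 * (0 ^ 3 - 27 * -1) = -3 ^ 3 := by norm_num
    rw [this]
    exact neg_ne_zero.mpr (pow_ne_zero 3 h3)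
  · refine exists_isTraceSeries_of_hasDoubleRoot h2 (x₀ := 0) (e := 0) ?_
    constructor <;> simp [hessianInfinity, h, WeierstrassCurve.b₂, WeierstrassCurve.b₄,
      WeierstrassCurve.b₆]

omit [Finite k] in
theorem affineTrace_hessianAt (c : k) (L : Type*) [Field L] [Algebra k L] :
    affineTrace (hessianAt c) L = affineTrace (hessianAt (algebraMap k L c)) L := by
  have : (hessianAt c).map (algebraMap k L) = hessianAt (algebraMap k L c) := by
    ext <;> simp [hessianAt]
  rw [affineTrace, affineTrace_self, this]

omit [Finite k] in
theorem affineTrace_hessianInfinity_map (d : ℕ) (L : Type*) [Field L] [Algebra k L] :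
    affineTrace (hessianInfinity k d) L = affineTrace (hessianInfinity L d) L := by
  have : (hessianInfinity k d).map (algebraMap k L) = hessianInfinity L d := by
    ext <;> simp [hessianInfinity, apply_ite (algebraMap k L)]
  rw [affineTrace, affineTrace_self, this]

omit [Finite k] in
theorem constantCoeff_tracePolynomial (W : WeierstrassCurve k) :
    PowerSeries.constantCoeff (tracePolynomial W : PowerSeries ℤ) = 1 := by
  rw [← PowerSeries.coeff_zero_eq_constantCoeff_apply, Polynomial.coeff_coe, tracePolynomial]
  split_ifs <;> simp

end HessianSeries

section HessianLFunction

variable {F : Type*} [Field F] [Finite F]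

omit [Finite F] in
/-- An Euler factor satisfies the same differential equation as the (inverse of the) local
polynomial, after rescaling the variable. -/
theorem X_mul_derivative_invOfUnit {k : Type*} [Field k] {W : WeierstrassCurve k}
    {U : PowerSeries ℤ} {m : ℕ} (hm : m ≠ 0)
    (hU : PowerSeries.X * PowerSeries.derivative ℤ (tracePolynomial W : PowerSeries ℤ) =
        -U * (tracePolynomial W : PowerSeries ℤ)) {ε : PowerSeries ℤ}
    (hε : (expand ℤ m (tracePolynomial W) : PowerSeries ℤ) * ε = 1) :
    PowerSeries.X * PowerSeries.derivative ℤ ε = m • PowerSeries.expand m hm U * ε ∧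
      PowerSeries.X ^ m ∣ ε - 1 := by
  rw [coe_expand hm] at hε
  set E := PowerSeries.expand m hm (tracePolynomial W : PowerSeries ℤ) with hE
  have h1 : PowerSeries.X * PowerSeries.derivative ℤ E =
      -(m • PowerSeries.expand m hm U * E) := by
    rw [hE, X_mul_derivative_expand hm, hU, map_mul, map_neg, nsmul_eq_mul, nsmul_eq_mul]
    ring
  constructor
  · have h2 := congrArg (fun f => PowerSeries.X * PowerSeries.derivative ℤ f) hε
    simp only [Derivation.leibniz, smul_eq_mul, Derivation.map_one_eq_zero, mul_zero] at h2
    linear_combination ε * h2 - ε ^ 2 * h1 +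
      (m • PowerSeries.expand m hm U * ε - PowerSeries.X * PowerSeries.derivative ℤ ε) * hε
  · have h3 : PowerSeries.X ∣ (tracePolynomial W : PowerSeries ℤ) - 1 := by
      rw [PowerSeries.X_dvd_iff, map_sub, constantCoeff_tracePolynomial, map_one, sub_self]
    obtain ⟨f, hf⟩ := h3
    have h4 : E - 1 = PowerSeries.X ^ m * PowerSeries.expand m hm f := by
      rw [← PowerSeries.expand_X (R := ℤ) m hm, ← map_mul, ← hf, map_sub, map_one]
    refine ⟨-(ε * PowerSeries.expand m hm f), ?_⟩
    linear_combination -ε * h4 + hε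

omit [Finite F] in
theorem localPolynomial_mul_eulerFactor (W : WeierstrassCurve (RatFunc F)) (v : Place F)
    {k : Type*} [Field k] {W' : WeierstrassCurve k} {m : ℕ} (hm : m ≠ 0)
    (h : localPolynomial W v = expand ℤ m (tracePolynomial W')) :
    (expand ℤ m (tracePolynomial W') : PowerSeries ℤ) * eulerFactor W v = 1 := by
  rw [eulerFactor, h]
  refine PowerSeries.mul_invOfUnit _ _ ?_
  rw [coe_expand hm, PowerSeries.constantCoeff_expand, constantCoeff_tracePolynomial]
  rfl

/-- The Euler product of the Hessian curve converges, and the coefficients of its logarithmic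
derivative are the sums of the traces of all fibres over the finite extensions of `F`. -/
theorem exists_lFunction_series.{w} (h2 : (2 : F) ≠ 0) (h3 : (3 : F) ≠ 0) {d : ℕ} (hd : d ≠ 0) :
    Multipliable (eulerFactor (hessianCurve F d)) ∧
    PowerSeries.constantCoeff (lFunction (hessianCurve F d)) = 1 ∧
    ∃ S : PowerSeries ℤ, PowerSeries.X * PowerSeries.derivative ℤ (lFunction (hessianCurve F d)) =
        S * lFunction (hessianCurve F d) ∧
      ∀ (L : Type w) [Field L] [Fintype L] [Algebra F L],
        PowerSeries.coeff (Module.finrank F L) S =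
          ∑ t : L, affineTrace (hessianAt (t ^ d)) L + affineTrace (hessianInfinity L d) L := by
  classical
  have hU := fun P : HeightOneSpectrum F[X] =>
    exists_isTraceSeries_hessianAt.{_, w} (k := F[X] ⧸ P.asIdeal)
      (by exact_mod_cast ne_zero_of_algebra (k := F) (n := 2) (by exact_mod_cast h2) (F[X] ⧸ P.asIdeal))
      (by exact_mod_cast ne_zero_of_algebra (k := F) (n := 3) (by exact_mod_cast h3) (F[X] ⧸ P.asIdeal))
      (Ideal.Quotient.mk P.asIdeal X ^ d)
  choose U hU0 hUd hUt using hU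
  obtain ⟨U', hU0', hUd', hUt'⟩ := exists_isTraceSeries_hessianInfinity.{_, w} h2 h3 d
  have hdeg : ∀ P : HeightOneSpectrum F[X], ideg F P.asIdeal ≠ 0 := fun P => (ideg_pos F P).ne'
  set W := hessianCurve F d
  let deg : Place F → ℕ := fun v => Place.rec (fun P => ideg F P.asIdeal) 1 v
  let V : Place F → PowerSeries ℤ := fun v =>
    Place.rec (fun P => ideg F P.asIdeal • PowerSeries.expand _ (hdeg P) (U P)) U' v
  have key : ∀ v, PowerSeries.X * PowerSeries.derivative ℤ (eulerFactor W v) = V v * eulerFactor W v ∧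
      PowerSeries.X ^ deg v ∣ eulerFactor W v - 1 := by
    rintro (P | _)
    · exact X_mul_derivative_invOfUnit (hdeg P) (hUd P) (localPolynomial_mul_eulerFactor W _ (hdeg P)
        (localPolynomial_finite h2 h3 hd P))
    · have := X_mul_derivative_invOfUnit one_ne_zero hUd' (localPolynomial_mul_eulerFactor W .infinity
        one_ne_zero (by rw [localPolynomial_infinity h2 h3 hd, expand_one]))
      rwa [one_smul, PowerSeries.expand_one_apply] at this
  have hfin : ∀ n, {v | deg v ≤ n}.Finite := by
    intro n
    refine ((Set.finite_singleton Place.infinity).union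
      ((finite_ideg_prime_le (A := F[X]) F n).image Place.finite)).subset ?_
    rintro (P | _) hv
    · exact Or.inr ⟨P, hv, rfl⟩
    · exact Or.inl rfl
  have hmult : Multipliable (eulerFactor W) := multipliable_of_X_pow_dvd (fun v => (key v).2) hfin
  refine ⟨hmult, ?_, ?_⟩
  · have h := (PowerSeries.WithPiTopology.continuous_constantCoeff ℤ).tendsto _ |>.comp hmult.hasProd
    refine tendsto_nhds_unique h ?_
    refine tendsto_const_nhds.congr fun s => ?_
    rw [Function.comp_apply, map_prod]
    refine (Finset.prod_eq_one fun v _ => ?_).symm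
    have h1 : PowerSeries.X ∣ eulerFactor W v - 1 := by
      refine (dvd_pow_self _ ?_).trans (key v).2
      rcases v with P | _
      · exact hdeg P
      · exact one_ne_zero
    rw [PowerSeries.X_dvd_iff, map_sub, map_one, sub_eq_zero] at h1
    exact h1
  -- each place `P` contributes its trace series, rescaled, with multiplicity `deg P`
  let S : PowerSeries ℤ := PowerSeries.mk fun n =>
    ∑ P ∈ primesOfDegreeDvd F F[X] n, ideg F P.asIdeal • PowerSeries.coeff (n / ideg F P.asIdeal) (U P) +
      PowerSeries.coeff n U'
  have hsum : HasSum V S := by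
    rw [PowerSeries.WithPiTopology.hasSum_iff_hasSum_coeff]
    intro n
    have hinj : Function.Injective (Place.finite : HeightOneSpectrum F[X] → Place F) :=
      fun P P' h => by injection h
    have hcoeff : ∀ P, PowerSeries.coeff n (V (.finite P)) = if ideg F P.asIdeal ∣ n then
        ideg F P.asIdeal • PowerSeries.coeff (n / ideg F P.asIdeal) (U P) else 0 := by
      intro P
      change PowerSeries.coeff n (ideg F P.asIdeal • PowerSeries.expand _ (hdeg P) (U P)) = _
      rw [map_nsmul, PowerSeries.coeff_expand]
      split_ifs <;> simp
    have h : HasSum (fun v => PowerSeries.coeff n (V v))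
        (∑ v ∈ insert Place.infinity ((primesOfDegreeDvd F F[X] n).map ⟨_, hinj⟩),
          PowerSeries.coeff n (V v)) := hasSum_sum_of_ne_finset_zero (by
        rintro (P | _) hv
        · simp only [Finset.mem_insert, reduceCtorEq, Finset.mem_map, mem_primesOfDegreeDvd,
            Function.Embedding.coeFn_mk, Place.finite.injEq, exists_eq_right, false_or, not_and] at hv
          rw [hcoeff]
          split_ifs with hdvd
          · by_cases hn : n = 0
            · rw [hn, Nat.zero_div, PowerSeries.coeff_zero_eq_constantCoeff_apply, hU0, smul_zero]
            · exact (hv hn hdvd).elim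
          · rfl
        · exact (hv (Finset.mem_insert_self _ _)).elim)
    rw [Finset.sum_insert (by simp), Finset.sum_map] at h
    have hS : PowerSeries.coeff n S = PowerSeries.coeff n (V Place.infinity) +
        ∑ P ∈ primesOfDegreeDvd F F[X] n, PowerSeries.coeff n (V (.finite P)) := by
      rw [PowerSeries.coeff_mk, add_comm]
      congr 1
      refine Finset.sum_congr rfl fun P hP => ?_
      rw [mem_primesOfDegreeDvd] at hP
      rw [hcoeff, if_pos hP.2]
    rw [hS]
    exact h
  refine ⟨S, X_mul_derivative_tprod hmult hsum fun v => (key v).1, ?_⟩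
  intro L _ _ _
  have : Module.Finite F L := Module.Finite.of_finite
  have : Fintype (F[X] →ₐ[F] L) := Fintype.ofEquiv L (aevalEquiv F L)
  rw [PowerSeries.coeff_mk, hUt' L, affineTrace_hessianInfinity_map,
    ← sum_algHom_eq_sum_primes (L := L)
      (fun P => PowerSeries.coeff (Module.finrank F L / ideg F P.asIdeal) (U P)),
    ← Equiv.sum_comp (aevalEquiv F L)]
  congr 1
  refine Finset.sum_congr rfl fun t _ => ?_
  -- the fibre at the closed point below `t`, extended to `L`, is the fibre at `t`
  set φ : F[X] →ₐ[F] L := aevalEquiv F L t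
  have hφ : φ X = t := aeval_X t
  let ψ : (F[X] ⧸ (kerPrime φ).asIdeal) →ₐ[F] L := Ideal.kerLiftAlg φ
  let : Algebra (F[X] ⧸ (kerPrime φ).asIdeal) L := ψ.toRingHom.toAlgebra
  have : IsScalarTower F (F[X] ⧸ (kerPrime φ).asIdeal) L :=
    IsScalarTower.of_algebraMap_eq fun x => (ψ.commutes x).symm
  have hfr : Module.finrank F L / ideg F (kerPrime φ).asIdeal =
      Module.finrank (F[X] ⧸ (kerPrime φ).asIdeal) L := by
    refine Nat.div_eq_of_eq_mul_right (ideg_pos F _) ?_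
    exact (Module.finrank_mul_finrank F (F[X] ⧸ (kerPrime φ).asIdeal) L).symm
  rw [hfr, hUt (kerPrime φ) L, affineTrace_hessianAt]
  have : algebraMap (F[X] ⧸ (kerPrime φ).asIdeal) L (Ideal.Quotient.mk (kerPrime φ).asIdeal X ^ d) =
      t ^ d := by
    rw [map_pow]
    congr 1
  rw [this]

end HessianLFunction

end

/-! ### From power sums to a factorization of the `L`-function -/

section

open Polynomial

section LogarithmicDerivatives

variable {Q : Type*} [Field Q]

/-- A power series with constant coefficient `1` is determined by its logarithmic derivative. -/
theorem eq_of_X_mul_derivative_eq [CharZero Q] {f g S : PowerSeries Q}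
    (hf : PowerSeries.X * PowerSeries.derivative Q f = S * f)
    (hg : PowerSeries.X * PowerSeries.derivative Q g = S * g)
    (hf0 : PowerSeries.constantCoeff f = 1) (hg0 : PowerSeries.constantCoeff g = 1) : f = g := by
  have hu : g * g⁻¹ = 1 := PowerSeries.mul_inv_cancel g (by rw [hg0]; exact one_ne_zero)
  have h1 := congrArg (fun h => PowerSeries.X * PowerSeries.derivative Q h) hu
  simp only [Derivation.leibniz, smul_eq_mul, Derivation.map_one_eq_zero, mul_zero] at h1
  have h2 : PowerSeries.X * PowerSeries.derivative Q (f * g⁻¹) = 0 := by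
    rw [Derivation.leibniz, smul_eq_mul, smul_eq_mul]
    linear_combination f * g⁻¹ * h1 + g⁻¹ * hf - f * g⁻¹ ^ 2 * hg +
      (-(S * f * g⁻¹) - f * (PowerSeries.X * PowerSeries.derivative Q g⁻¹)) * hu
  have h3 : f * g⁻¹ = 1 := by
    refine PowerSeries.derivative.ext ?_ ?_
    · rw [Derivation.map_one_eq_zero]
      exact (mul_eq_zero.mp h2).resolve_left PowerSeries.X_ne_zero
    · have := congrArg PowerSeries.constantCoeff hu
      rw [map_mul, hg0, one_mul] at this
      rw [map_mul, hf0, one_mul, this]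
  calc f = f * g⁻¹ * g := by rw [mul_assoc, mul_comm g⁻¹, hu, mul_one]
    _ = g := by rw [h3, one_mul]

/-- The power series `e ∑ c ^ j X ^ (e j)`, over `j ≥ 1`. -/
def powerSumSeries (c : Q) (e : ℕ) : PowerSeries Q :=
  PowerSeries.mk fun n => if n ≠ 0 ∧ e ∣ n then (e : Q) * c ^ (n / e) else 0

theorem powerSumSeries_mul {c : Q} {e : ℕ} (he : e ≠ 0) :
    powerSumSeries c e * (1 - PowerSeries.C c * PowerSeries.X ^ e) =
      PowerSeries.C (e * c) * PowerSeries.X ^ e := by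
  ext n
  rw [mul_sub, mul_one, map_sub, mul_left_comm, PowerSeries.coeff_C_mul,
    PowerSeries.coeff_mul_X_pow', PowerSeries.coeff_C_mul, PowerSeries.coeff_X_pow, powerSumSeries,
    PowerSeries.coeff_mk, PowerSeries.coeff_mk]
  by_cases hen : e ≤ n
  · obtain ⟨m, rfl⟩ := Nat.exists_eq_add_of_le hen
    rw [if_pos hen, Nat.add_sub_cancel_left]
    by_cases hd : e ∣ m
    · obtain ⟨j, rfl⟩ := hd
      have h1 : e ∣ e + e * j := ⟨j + 1, by ring⟩
      have h2 : (e + e * j) / e = j + 1 := by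
        rw [show e + e * j = e * (j + 1) by ring, Nat.mul_div_cancel_left _ (Nat.pos_of_ne_zero he)]
      rw [if_pos ⟨by omega, h1⟩, h2, Nat.mul_div_cancel_left _ (Nat.pos_of_ne_zero he)]
      rcases j with _ | j
      · simp
      · have h3 : e * (j + 1) ≠ 0 := Nat.mul_ne_zero he j.succ_ne_zero
        rw [if_pos ⟨h3, Dvd.intro _ rfl⟩, if_neg (by omega)]
        ring
    · have h1 : ¬ e ∣ e + m := (Nat.dvd_add_right (dvd_refl e)).not.mpr hd
      have h3 : m ≠ 0 := by rintro rfl; exact hd (dvd_zero _)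
      rw [if_neg (fun h => h1 h.2), if_neg (fun h => hd h.2), if_neg (by omega)]
      simp
  · have h1 : ¬ (n ≠ 0 ∧ e ∣ n) := fun h => hen (Nat.le_of_dvd (Nat.pos_of_ne_zero h.1) h.2)
    rw [if_neg h1, if_neg hen, if_neg (by omega)]
    simp

/-- The logarithmic derivative of a product of binomials. -/
theorem X_mul_derivative_prod_binomial {ι : Type*} (s : Finset ι) (c : ι → Q) {e : ι → ℕ}
    (he : ∀ i ∈ s, e i ≠ 0) :
    PowerSeries.X * PowerSeries.derivative Q
        (∏ i ∈ s, (1 - PowerSeries.C (c i) * PowerSeries.X ^ e i)) =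
      (-∑ i ∈ s, powerSumSeries (c i) (e i)) *
        ∏ i ∈ s, (1 - PowerSeries.C (c i) * PowerSeries.X ^ e i) := by
  classical
  induction s using Finset.induction_on with
  | empty => simp
  | insert i s hi ih =>
    have h1 : PowerSeries.X * PowerSeries.derivative Q
        (1 - PowerSeries.C (c i) * PowerSeries.X ^ e i) =
        -powerSumSeries (c i) (e i) * (1 - PowerSeries.C (c i) * PowerSeries.X ^ e i) := by
      rw [neg_mul, powerSumSeries_mul (he i (Finset.mem_insert_self _ _))]
      obtain ⟨m, hm⟩ : ∃ m, e i = m + 1 :=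
        Nat.exists_eq_succ_of_ne_zero (he i (Finset.mem_insert_self _ _))
      rw [hm, map_sub, Derivation.map_one_eq_zero, ← PowerSeries.smul_eq_C_mul,
        Derivation.map_smul, Derivation.leibniz_pow, PowerSeries.derivative_X,
        PowerSeries.smul_eq_C_mul, map_mul, map_natCast]
      simp only [Nat.add_sub_cancel, smul_eq_mul, mul_one, nsmul_eq_mul]
      ring
    rw [Finset.prod_insert hi, Finset.sum_insert hi, Derivation.leibniz, smul_eq_mul, smul_eq_mul]
    linear_combination (1 - PowerSeries.C (c i) * PowerSeries.X ^ e i) *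
      ih (fun j hj => he j (Finset.mem_insert_of_mem hj)) +
      (∏ i ∈ s, (1 - PowerSeries.C (c i) * PowerSeries.X ^ e i)) * h1

end LogarithmicDerivatives

section Factorization

variable {F Q : Type*} [Field F] [Finite F] [Field Q] [CharZero Q] [IsAlgClosed Q]

/-- To factor the `L`-function, it suffices to compute, over some extension of each degree, the sum
of the Jacobi sums of the characters `ψ` with `ψ ^ d = 1` and `ψ ^ 3 ≠ 1`. -/
theorem map_lFunction_eq_prod.{w} (h2 : (2 : F) ≠ 0) (h3 : (3 : F) ≠ 0) {d : ℕ} (hd : d ≠ 0)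
    {ι : Type*} (s : Finset ι) (c : ι → Q) {e : ι → ℕ} (he : ∀ i ∈ s, e i ≠ 0)
    (h : ∀ n, n ≠ 0 → ∃ (L : Type w) (_ : Field L) (_ : Fintype L) (_ : Algebra F L)
      (_ : DecidableEq (MulChar L Q)),
      Module.finrank F L = n ∧
      ∑ ψ ∈ (charsOfOrderDvd L Q d).filter (fun ψ => ψ ^ 3 ≠ 1), jacobiNeg ψ =
        ∑ i ∈ s, if e i ∣ n then (e i : Q) * c i ^ (n / e i) else 0) :
    PowerSeries.map (Int.castRingHom Q) (lFunction (hessianCurve F d)) =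
      ∏ i ∈ s, (1 - PowerSeries.C (c i) * PowerSeries.X ^ e i) := by
  obtain ⟨-, h0, S, hS, hSL⟩ := exists_lFunction_series.{_, w} h2 h3 hd
  have hS' : PowerSeries.map (Int.castRingHom Q) S = -∑ i ∈ s, powerSumSeries (c i) (e i) := by
    ext n
    rw [PowerSeries.coeff_map, map_neg, map_sum]
    rcases eq_or_ne n 0 with rfl | hn
    · have := congrArg PowerSeries.constantCoeff hS
      rw [map_mul, map_mul, PowerSeries.constantCoeff_X, zero_mul, h0, mul_one] at this
      rw [PowerSeries.coeff_zero_eq_constantCoeff_apply, ← this]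
      simp [powerSumSeries]
    · obtain ⟨L, _, _, _, _, rfl, hL⟩ := h n hn
      have h2L : (2 : L) ≠ 0 := by
        exact_mod_cast ne_zero_of_algebra (k := F) (n := 2) (by exact_mod_cast h2) L
      rw [hSL L, eq_intCast (Int.castRingHom Q), sum_affineTrace_hessian hd h2L, hL]
      congr 1
      refine Finset.sum_congr rfl fun i _ => ?_
      rw [powerSumSeries, PowerSeries.coeff_mk]
      exact if_congr (by simp [hn]) rfl rfl
  refine eq_of_X_mul_derivative_eq (S := -∑ i ∈ s, powerSumSeries (c i) (e i)) ?_
    (X_mul_derivative_prod_binomial s c he) ?_ ?_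
  · have := congrArg (PowerSeries.map (Int.castRingHom Q)) hS
    rw [map_mul, map_mul, PowerSeries.map_X, hS'] at this
    rw [← this]
    congr 1
    ext n
    simp [PowerSeries.coeff_derivative]
  · rw [← PowerSeries.coeff_zero_eq_constantCoeff_apply, PowerSeries.coeff_map,
      PowerSeries.coeff_zero_eq_constantCoeff_apply, h0, map_one]
  · rw [map_prod]
    refine Finset.prod_eq_one fun i hi => ?_
    simp [he i hi]

end Factorization

section KummerCase

variable {L Q : Type*} [Field L] [Fintype L] [Field Q] [CharZero Q] [IsAlgClosed Q]

theorem card_charsOfOrderDvd_le {d : ℕ} (hd : d ≠ 0) : (charsOfOrderDvd L Q d).card ≤ d := by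
  classical
  have e2 : {χ : MulChar L Q // χ ^ d = 1} ≃ {s : Lˣ // s ^ d = 1} :=
    (MulChar.mulEquiv_units L Q).some.toEquiv.subtypeEquiv fun χ => by
      change χ ^ d = 1 ↔ (MulChar.mulEquiv_units L Q).some χ ^ d = 1
      rw [← map_pow, map_eq_one_iff _ (MulEquiv.injective _)]
  have h1 : (charsOfOrderDvd L Q d).card = Nat.card {s : Lˣ // s ^ d = 1} := by
    rw [← Nat.card_eq_finsetCard, ← Nat.card_congr e2]
    exact Nat.card_congr (Equiv.subtypeEquivRight fun χ => mem_charsOfOrderDvd)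
  have : NeZero d := ⟨hd⟩
  rw [h1, Nat.card_congr (Equiv.subtypeEquivRight fun s => (mem_rootsOfUnity d s).symm)]
  exact card_rootsOfUnity L d

/-- The characters of order dividing `d` are the powers of a character of order `d`. -/
theorem sum_charsOfOrderDvd_eq {d : ℕ} (hd : d ≠ 0) {χ : MulChar L Q} (hχ : orderOf χ = d)
    [DecidableEq (MulChar L Q)] (f : MulChar L Q → Q) :
    ∑ ψ ∈ (charsOfOrderDvd L Q d).filter (fun ψ => ψ ^ 3 ≠ 1), f ψ =
      ∑ k ∈ (Finset.Icc 1 (d - 1)).filter (fun k => ¬ d ∣ 3 * k), f (χ ^ k) := by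
  have hinj : Set.InjOn (fun k => χ ^ k) (Finset.range d : Set ℕ) := by
    intro i hi j hj hij
    rw [Finset.coe_range, Set.mem_Iio, ← hχ] at hi hj
    exact pow_injOn_Iio_orderOf hi hj hij
  have himg : (Finset.range d).image (fun k => χ ^ k) = charsOfOrderDvd L Q d := by
    refine Finset.eq_of_subset_of_card_le ?_ ?_
    · intro ψ hψ
      obtain ⟨k, -, rfl⟩ := Finset.mem_image.mp hψ
      rw [mem_charsOfOrderDvd, ← pow_mul, mul_comm, pow_mul, ← hχ, pow_orderOf_eq_one, one_pow]
    · rw [Finset.card_image_of_injOn hinj, Finset.card_range]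
      exact card_charsOfOrderDvd_le hd
  have h3 : ∀ k, (χ ^ k) ^ 3 ≠ 1 ↔ ¬ d ∣ 3 * k := fun k => by
    rw [← pow_mul, Ne, ← orderOf_dvd_iff_pow_eq_one, hχ, mul_comm]
  rw [← himg, Finset.filter_image, Finset.sum_image (hinj.mono
    (Finset.coe_subset.mpr (Finset.filter_subset _ _)))]
  refine Finset.sum_congr ?_ fun _ _ => rfl
  ext k
  simp only [Finset.mem_filter, Finset.mem_range, Finset.mem_Icc, h3]
  refine ⟨fun h => ⟨⟨?_, by omega⟩, h.2⟩, fun h => ⟨by omega, h.2⟩⟩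
  by_contra hk
  have : k = 0 := by omega
  subst this
  exact h.2 (dvd_zero _)

end KummerCase

end

/-! ### Teichmüller characters of finite fields -/

section

open Polynomial

theorem finite_setOf_pow_eq_self {A : Type*} [CommRing A] [IsDomain A] {N : ℕ} (hN : 1 < N) :
    {x : A | x ^ N = x}.Finite := by
  refine ((nthRootsFinset (N - 1) (1 : A)).finite_toSet.insert 0).subset fun x hx => ?_
  rw [Set.mem_insert_iff, Finset.mem_coe, Polynomial.mem_nthRootsFinset (by omega)]
  refine or_iff_not_imp_left.mpr fun h0 => mul_right_cancel₀ h0 ?_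
  rw [← pow_succ, one_mul, Nat.sub_add_cancel hN.le]
  exact hx

section Residue

variable {Q : Type*} [Field Q] (p : ℕ) (𝔓 : Ideal (integralClosure ℤ Q))
variable [CharZero Q] [IsAlgClosed Q] [Fact p.Prime] [𝔓.IsPrime]
  [𝔓.LiesOver (Ideal.span {(p : ℤ)})]

instance nontrivial_residue : Nontrivial (integralClosure ℤ Q ⧸ 𝔓) :=
  Ideal.Quotient.nontrivial_iff.mpr Ideal.IsPrime.ne_top'

instance isDomain_residue : IsDomain (integralClosure ℤ Q ⧸ 𝔓) := Ideal.Quotient.isDomain 𝔓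

variable {p 𝔓} in
omit [CharZero Q] [IsAlgClosed Q] [𝔓.IsPrime] in
theorem mem_finiteField {r : ℕ} {x : integralClosure ℤ Q ⧸ 𝔓} :
    x ∈ finiteField p 𝔓 r ↔ x ^ p ^ r = x := by
  have := charP_residue p 𝔓
  rw [finiteField, RingHom.mem_eqLocus, RingHom.id_apply, iterateFrobenius_def]

omit [CharZero Q] [IsAlgClosed Q] in
theorem finiteField_exists_inv {r : ℕ} (x : finiteField p 𝔓 r) (hx : x ≠ 0) :
    ∃ y, x * y = 1 := by
  have := isMaximal_of_liesOver p 𝔓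
  obtain ⟨y, hy⟩ := Ideal.Quotient.exists_inv (I := 𝔓) (a := (x : integralClosure ℤ Q ⧸ 𝔓))
    (fun h => hx (Subtype.ext h))
  refine ⟨⟨y, mem_finiteField.mpr ?_⟩, Subtype.ext hy⟩
  have h1 : (x : integralClosure ℤ Q ⧸ 𝔓) * y ^ p ^ r = 1 := by
    have := congrArg (· ^ p ^ r) hy
    simp only [mul_pow, one_pow, mem_finiteField.mp x.2] at this
    exact this
  calc y ^ p ^ r = (x * y) * y ^ p ^ r := by rw [hy, one_mul]
    _ = (x * y ^ p ^ r) * y := by ring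
    _ = y := by rw [h1, one_mul]

open Classical in
/-- `finiteField p 𝔓 r` is a field, with the ring structure of a subring. -/
instance finiteFieldField (r : ℕ) : Field (finiteField p 𝔓 r) :=
  { (inferInstance : CommRing (finiteField p 𝔓 r)) with
    inv := fun x => if h : x ≠ 0 then (finiteField_exists_inv p 𝔓 x h).choose else 0
    exists_pair_ne := ⟨0, 1, fun h => zero_ne_one (congrArg Subtype.val h)⟩
    mul_inv_cancel := fun x hx => by
      change x * (dite _ _ _) = 1
      rw [dif_pos hx]
      exact (finiteField_exists_inv p 𝔓 x hx).choose_spec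
    inv_zero := by
      rw [dif_neg (by simp)]
    nnqsmul := _
    nnqsmul_def := fun _ _ => rfl
    qsmul := _
    qsmul_def := fun _ _ => rfl }

instance (r : ℕ) : CharP (finiteField p 𝔓 r) p :=
  haveI := charP_residue p 𝔓
  RingHom.charP (finiteField p 𝔓 r).subtype Subtype.val_injective p

omit [CharZero Q] [IsAlgClosed Q] in
theorem finite_finiteField {r : ℕ} (hr : r ≠ 0) : Finite (finiteField p 𝔓 r) := by
  have hp1 : 1 < p ^ r := Nat.one_lt_pow hr (Fact.out : p.Prime).one_lt
  refine (finite_setOf_pow_eq_self hp1 |>.subset fun x hx => ?_).to_subtype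
  exact mem_finiteField.mp hx

/-- The Teichmüller character of the field with `p ^ r` elements, on units. -/
def teichmullerHom (r : ℕ) : (finiteField p 𝔓 r)ˣ →* Qˣ :=
  (Units.map ((integralClosure ℤ Q).val : integralClosure ℤ Q →* Q)).comp
    ((rootsOfUnityPrimeTo p (integralClosure ℤ Q)).subtype.comp
      ((teichmuller p 𝔓).toMonoidHom.comp
        (Units.map ((finiteField p 𝔓 r).subtype : finiteField p 𝔓 r →* _))))

theorem teichmullerHom_injective (r : ℕ) : Function.Injective (teichmullerHom p 𝔓 r) := by
  refine (Units.map_injective ?_).comp ((Subgroup.subtype_injective _).comp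
    ((teichmuller p 𝔓).injective.comp (Units.map_injective ?_)))
  · exact Subtype.val_injective
  · exact Subtype.val_injective

/-- The Teichmüller character of the field with `p ^ r` elements, extended by `0` at `0`. -/
def teichmullerChar (r : ℕ) : MulChar (finiteField p 𝔓 r) Q :=
  MulChar.ofUnitHom (teichmullerHom p 𝔓 r)

theorem card_finiteField {r : ℕ} (hr : r ≠ 0) : Nat.card (finiteField p 𝔓 r) = p ^ r := by
  have := finite_finiteField p 𝔓 hr
  classical
  have := Fintype.ofFinite (finiteField p 𝔓 r)
  have hp1 : 1 < p ^ r := Nat.one_lt_pow hr (Fact.out : p.Prime).one_lt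
  set N := p ^ r - 1 with hN
  have hN0 : 0 < N := by omega
  have hNp : N.Coprime p := by
    rw [Nat.coprime_comm, (Fact.out : p.Prime).coprime_iff_not_dvd, hN]
    intro h
    have h1 := (Nat.dvd_sub_iff_right hp1.le (dvd_pow_self p hr)).mp h
    exact (Fact.out : p.Prime).one_lt.ne' (Nat.dvd_one.mp h1)
  -- a primitive root of unity of order `p ^ r - 1` reduces to a unit of that order
  have : NeZero N := ⟨hN0.ne'⟩
  have : NeZero (N : Q) := ⟨Nat.cast_ne_zero.mpr hN0.ne'⟩
  obtain ⟨ζ, hζ⟩ := HasEnoughRootsOfUnity.exists_primitiveRoot Q N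
  let z : integralClosure ℤ Q := ⟨ζ, hζ.isIntegral hN0⟩
  have hz : IsPrimitiveRoot z N :=
    IsPrimitiveRoot.of_map_of_injective (f := (integralClosure ℤ Q).val) hζ
      Subtype.val_injective
  let w : rootsOfUnityPrimeTo p (integralClosure ℤ Q) :=
    ⟨(hz.isUnit hN0.ne').unit, N, hN0, hNp, Units.ext (by simpa using hz.pow_eq_one)⟩
  have hw : orderOf w = N := by
    rw [← Subgroup.orderOf_coe, ← orderOf_units]
    exact hz.eq_orderOf.symm
  have hu : orderOf (reduceRoots p 𝔓 w) = N := by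
    rw [orderOf_injective _ (reduceRoots_bijective p 𝔓).1, hw]
  have hu' : orderOf ((reduceRoots p 𝔓 w : (integralClosure ℤ Q ⧸ 𝔓)ˣ) :
      integralClosure ℤ Q ⧸ 𝔓) = N := by rw [orderOf_units, hu]
  let v : finiteField p 𝔓 r := ⟨(reduceRoots p 𝔓 w : (integralClosure ℤ Q ⧸ 𝔓)ˣ), by
    rw [mem_finiteField, show p ^ r = N + 1 by omega, pow_succ, ← hu', pow_orderOf_eq_one, one_mul]⟩
  have hv : orderOf v = N := by
    rw [← hu']
    exact (orderOf_injective (finiteField p 𝔓 r).subtype.toMonoidHom Subtype.val_injective v).symm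
  have h1 : N ∣ Fintype.card (finiteField p 𝔓 r) - 1 := by
    rw [← hv, orderOf_dvd_iff_pow_eq_one]
    refine FiniteField.pow_card_sub_one_eq_one v ?_
    intro h
    have := congrArg Subtype.val h
    exact (reduceRoots p 𝔓 w).ne_zero this
  have h2 : Fintype.card (finiteField p 𝔓 r) - 1 ∣ N := by
    obtain ⟨g, hg⟩ := IsCyclic.exists_generator (α := (finiteField p 𝔓 r)ˣ)
    rw [← Fintype.card_units, ← orderOf_eq_card_of_forall_mem_zpowers hg |>.trans
      Nat.card_eq_fintype_card, orderOf_dvd_iff_pow_eq_one]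
    have h3 := mem_finiteField.mp (g : finiteField p 𝔓 r).2
    have h4 : (g : finiteField p 𝔓 r) ^ N * g = 1 * g := by
      rw [← pow_succ, show N + 1 = p ^ r by omega, one_mul]
      exact Subtype.ext h3
    exact Units.ext (mul_right_cancel₀ g.ne_zero h4)
  have h3 := Nat.dvd_antisymm h1 h2
  have h4 : 1 < Fintype.card (finiteField p 𝔓 r) := Fintype.one_lt_card
  rw [Nat.card_eq_fintype_card]
  omega

theorem teichmullerChar_coe {r : ℕ} (u : (finiteField p 𝔓 r)ˣ) :
    teichmullerChar p 𝔓 r u = teichmullerHom p 𝔓 r u :=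
  MulChar.ofUnitHom_coe _ u

theorem orderOf_teichmullerChar {r : ℕ} (hr : r ≠ 0) :
    orderOf (teichmullerChar p 𝔓 r) = p ^ r - 1 := by
  have := finite_finiteField p 𝔓 hr
  classical
  have := Fintype.ofFinite (finiteField p 𝔓 r)
  have hc : Fintype.card (finiteField p 𝔓 r) = p ^ r := by
    rw [← Nat.card_eq_fintype_card, card_finiteField p 𝔓 hr]
  obtain ⟨g, hg⟩ := IsCyclic.exists_generator (α := (finiteField p 𝔓 r)ˣ)
  have hg' : orderOf g = p ^ r - 1 := by
    rw [orderOf_eq_card_of_forall_mem_zpowers hg, Nat.card_eq_fintype_card, Fintype.card_units, hc]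
  refine Nat.dvd_antisymm ?_ ?_
  · rw [orderOf_dvd_iff_pow_eq_one]
    ext u
    rw [MulChar.pow_apply_coe, ← map_pow, ← Units.val_pow_eq_pow_val]
    have h : u ^ (p ^ r - 1) = 1 := by
      rw [← hc, ← Fintype.card_units]
      exact pow_card_eq_one
    rw [h, Units.val_one, map_one, MulChar.one_apply_coe]
  · rw [← hg', orderOf_dvd_iff_pow_eq_one]
    apply teichmullerHom_injective p 𝔓 r
    rw [map_one]
    ext
    have h := congrArg (fun χ : MulChar (finiteField p 𝔓 r) Q => χ g)
      (pow_orderOf_eq_one (teichmullerChar p 𝔓 r))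
    simp only [MulChar.pow_apply_coe, MulChar.one_apply_coe] at h
    rw [map_pow, Units.val_pow_eq_pow_val, ← teichmullerChar_coe, h, Units.val_one]

/-- Every multiplicative character is a power of the Teichmüller character. -/
theorem exists_eq_teichmullerChar_pow {r : ℕ} (hr : r ≠ 0) (ψ : MulChar (finiteField p 𝔓 r) Q) :
    ∃ j < p ^ r - 1, ψ = teichmullerChar p 𝔓 r ^ j := by
  classical
  have := finite_finiteField p 𝔓 hr
  have := Fintype.ofFinite (finiteField p 𝔓 r)
  have := Fintype.ofFinite (MulChar (finiteField p 𝔓 r) Q)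
  have hc : Fintype.card (MulChar (finiteField p 𝔓 r) Q) = p ^ r - 1 := by
    rw [← Nat.card_eq_fintype_card, MulChar.card_eq_card_units_of_hasEnoughRootsOfUnity,
      Nat.card_eq_fintype_card, Fintype.card_units, ← Nat.card_eq_fintype_card,
      card_finiteField p 𝔓 hr]
  have himg : (Finset.range (p ^ r - 1)).image (fun j => teichmullerChar p 𝔓 r ^ j) =
      Finset.univ := by
    rw [← Finset.card_eq_iff_eq_univ, Finset.card_image_of_injOn, Finset.card_range, hc]
    rw [← orderOf_teichmullerChar p 𝔓 hr, Finset.coe_range]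
    exact pow_injOn_Iio_orderOf
  obtain ⟨j, hj, h⟩ := Finset.mem_image.mp (himg ▸ Finset.mem_univ ψ)
  exact ⟨j, Finset.mem_range.mp hj, h.symm⟩

end Residue

end

/-! ### Jacobi sums of Teichmüller characters, and orbits of multiplication by `q` -/

section

open Polynomial

section Jacobi

/-- Jacobi sums are invariant under the Frobenius automorphism. -/
theorem jacobiNeg_pow_char {L Q : Type*} [Field L] [Finite L] [Field Q] {p : ℕ} [Fact p.Prime]
    [CharP L p] (χ : MulChar L Q) (a : ℕ) : jacobiNeg (χ ^ p ^ a) = jacobiNeg χ := by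
  have := Fintype.ofFinite L
  have hb : Function.Bijective (iterateFrobenius L p a) :=
    Finite.injective_iff_bijective.mp (iterateFrobenius L p a).injective
  have hφ : ∀ z, (χ ^ p ^ a) z = χ (iterateFrobenius L p a z) := fun z => by
    rw [MulChar.pow_apply' _ (pow_ne_zero _ (Fact.out : p.Prime).ne_zero), ← map_pow,
      iterateFrobenius_def]
  rw [jacobiNeg_eq_sum, jacobiNeg_eq_sum]
  refine Fintype.sum_bijective _ hb _ _ fun x => Fintype.sum_bijective _ hb _ _ fun y => ?_
  rw [hφ]
  simp only [map_neg, map_mul, map_sub, map_one]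

variable {Q : Type*} [Field Q] (p : ℕ) (𝔓 : Ideal (integralClosure ℤ Q))
variable [CharZero Q] [IsAlgClosed Q] [Fact p.Prime] [𝔓.IsPrime]
  [𝔓.LiesOver (Ideal.span {(p : ℤ)})]

/-- `theta` is a power of the Teichmüller character, also at `0` and when the exponent is `0`. -/
theorem theta_eq {d : ℕ} [NeZero d] (a : ℕ) (m : ZMod d)
    (x : finiteField p 𝔓 (a * (orbit (p ^ a) m).card)) :
    theta p 𝔓 a m x = (teichmullerChar p 𝔓 (a * (orbit (p ^ a) m).card) ^
      (((p ^ a) ^ (orbit (p ^ a) m).card - 1) * m.val / d)) x := by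
  rw [theta]
  rcases eq_or_ne x 0 with rfl | hx
  · rw [dif_neg (by simp), MulChar.map_zero]
  · obtain ⟨u, rfl⟩ : IsUnit x := isUnit_iff_ne_zero.mpr hx
    have h : IsUnit (((u : finiteField p 𝔓 (a * (orbit (p ^ a) m).card)) :
      integralClosure ℤ Q ⧸ 𝔓)) := u.isUnit.map (finiteField p 𝔓 _).subtype
    rw [dif_pos h, MulChar.pow_apply_coe, teichmullerChar_coe]
    congr 1
    have : h.unit = Units.map ((finiteField p 𝔓 (a * (orbit (p ^ a) m).card)).subtype :
        finiteField p 𝔓 (a * (orbit (p ^ a) m).card) →* _) u := Units.ext rfl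
    rw [this]
    rfl

theorem theta_neg_one_mul_jacobi {d : ℕ} [NeZero d] {a : ℕ} {m : ZMod d}
    (h : a * (orbit (p ^ a) m).card ≠ 0) :
    theta p 𝔓 a m (-1) * jacobi p 𝔓 a m =
      jacobiNeg (teichmullerChar p 𝔓 (a * (orbit (p ^ a) m).card) ^
        (((p ^ a) ^ (orbit (p ^ a) m).card - 1) * m.val / d)) := by
  have := finite_finiteField p 𝔓 h
  have := Fintype.ofFinite {x : finiteField p 𝔓 (a * (orbit (p ^ a) m).card) ×
    finiteField p 𝔓 (a * (orbit (p ^ a) m).card) ×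
    finiteField p 𝔓 (a * (orbit (p ^ a) m).card) // x.1 + x.2.1 + x.2.2 = 1}
  rw [jacobi, jacobiSum₃, jacobiNeg, finsum_eq_sum_of_fintype, finsum_eq_sum_of_fintype,
    Finset.mul_sum]
  refine Finset.sum_congr rfl fun x _ => ?_
  simp only [theta_eq]
  rw [← map_mul, ← map_mul, ← map_mul, neg_one_mul]

omit [CharZero Q] [IsAlgClosed Q] [𝔓.IsPrime] in
theorem finiteField_le {r s : ℕ} (h : r ∣ s) : finiteField p 𝔓 r ≤ finiteField p 𝔓 s := by
  obtain ⟨j, rfl⟩ := h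
  intro x hx
  rw [mem_finiteField] at hx ⊢
  induction j with
  | zero => simp
  | succ j ih => rw [mul_add, mul_one, pow_add, pow_mul, ih, hx]

/-- The norm of an extension of finite fields lifts the Teichmüller character to a power of the
Teichmüller character, because it is itself the power map with exponent
`(p ^ s - 1) / (p ^ r - 1)`. -/
theorem jacobiNeg_teichmullerChar_pow {r s : ℕ} (hr : r ≠ 0) (hs : s ≠ 0) (h : r ∣ s) {j : ℕ}
    (hj : (teichmullerChar p 𝔓 r ^ j) ^ 3 ≠ 1) :
    jacobiNeg (teichmullerChar p 𝔓 s ^ ((p ^ s - 1) / (p ^ r - 1) * j)) =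
      jacobiNeg (teichmullerChar p 𝔓 r ^ j) ^ (s / r) := by
  have hle := finiteField_le p 𝔓 h
  have := finite_finiteField p 𝔓 hr
  have := finite_finiteField p 𝔓 hs
  have := Fintype.ofFinite (finiteField p 𝔓 r)
  let : Algebra (finiteField p 𝔓 r) (finiteField p 𝔓 s) := (Subring.inclusion hle).toAlgebra
  have hfin : Module.Finite (finiteField p 𝔓 r) (finiteField p 𝔓 s) := Module.Finite.of_finite
  have hrank : Module.finrank (finiteField p 𝔓 r) (finiteField p 𝔓 s) = s / r := by
    have h1 := Module.natCard_eq_pow_finrank (K := finiteField p 𝔓 r) (V := finiteField p 𝔓 s)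
    rw [card_finiteField p 𝔓 hr, card_finiteField p 𝔓 hs, ← pow_mul] at h1
    exact (Nat.div_eq_of_eq_mul_right (Nat.pos_of_ne_zero hr)
      (Nat.pow_right_injective (Fact.out : p.Prime).two_le h1)).symm
  rw [← hrank, ← jacobiNeg_normLift hj, ← normLift_pow, pow_mul]
  congr 2
  ext u
  rw [MulChar.pow_apply_coe, normLift_apply]
  have hu : IsUnit (Algebra.norm (finiteField p 𝔓 r) (u : finiteField p 𝔓 s)) :=
    u.isUnit.map (Algebra.norm _)
  obtain ⟨v, hv⟩ := hu
  have hn := FiniteField.algebraMap_norm_eq_pow (K := finiteField p 𝔓 r) (x := (u : finiteField p 𝔓 s))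
  rw [card_finiteField p 𝔓 hr, card_finiteField p 𝔓 hs, ← hv] at hn
  rw [← hv, teichmullerChar_coe, teichmullerChar_coe, ← Units.val_pow_eq_pow_val, ← map_pow]
  congr 1
  rw [teichmullerHom, teichmullerHom]
  simp only [MonoidHom.comp_apply]
  congr 3
  ext
  exact (congrArg Subtype.val hn).symm

end Jacobi

section Algebra

/-- A field with `q ^ n` elements is an extension of degree `n` of any field with `q` elements. -/
theorem exists_algebra_finrank_eq {p a : ℕ} [Fact p.Prime] (ha : a ≠ 0) {F L : Type*} [Field F]
    [Finite F] [Field L] [Finite L] {n : ℕ} (hF : Nat.card F = p ^ a)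
    (hL : Nat.card L = p ^ (a * n)) : ∃ _ : Algebra F L, Module.finrank F L = n := by
  have := Fintype.ofFinite F
  have := Fintype.ofFinite L
  have : CharP F p := charP_of_card_eq_prime_pow (f := a) (by rw [← hF, Nat.card_eq_fintype_card])
  have : CharP L p :=
    charP_of_card_eq_prime_pow (f := a * n) (by rw [← hL, Nat.card_eq_fintype_card])
  let := ZMod.algebra F p
  let := ZMod.algebra L p
  have h1 := Module.natCard_eq_pow_finrank (K := ZMod p) (V := F)
  have h2 := Module.natCard_eq_pow_finrank (K := ZMod p) (V := L)
  rw [Nat.card_zmod] at h1 h2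
  have e1 := Nat.pow_right_injective (Fact.out : p.Prime).two_le (hF.symm.trans h1)
  have e2 := Nat.pow_right_injective (Fact.out : p.Prime).two_le (hL.symm.trans h2)
  obtain ⟨f⟩ := FiniteField.nonempty_algHom_of_finrank_dvd (F := ZMod p) (K := F) (L := L)
    (by rw [← e1, ← e2]; exact dvd_mul_right _ _)
  refine ⟨f.toRingHom.toAlgebra, ?_⟩
  let := f.toRingHom.toAlgebra
  have h3 := Module.natCard_eq_pow_finrank (K := F) (V := L)
  rw [hF, hL, ← pow_mul] at h3
  exact (Nat.eq_of_mul_eq_mul_left (Nat.pos_of_ne_zero ha)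
    (Nat.pow_right_injective (Fact.out : p.Prime).two_le h3)).symm

end Algebra

section Orbits

variable {d : ℕ} [NeZero d] {q : ℕ}

omit [NeZero d] in
theorem iterate_mul_eq (m : ZMod d) (n : ℕ) :
    (fun x => (q : ZMod d) * x)^[n] m = (q : ZMod d) ^ n * m := by
  rw [mul_left_iterate]

theorem mem_orbit {m x : ZMod d} : x ∈ orbit q m ↔ ∃ i : ℕ, x = (q : ZMod d) ^ i * m := by
  simp [orbit]

theorem mem_orbit_self (m : ZMod d) : m ∈ orbit q m := mem_orbit.mpr ⟨0, by simp⟩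

omit [NeZero d] in
theorem mul_injective (hq : d.Coprime q) : Function.Injective fun x : ZMod d => (q : ZMod d) * x := by
  have : IsUnit (q : ZMod d) := (ZMod.isUnit_iff_coprime q d).mpr hq.symm
  exact this.isRegular.left

open Function in
theorem minimalPeriod_pos (hq : d.Coprime q) (m : ZMod d) :
    0 < minimalPeriod (fun x => (q : ZMod d) * x) m :=
  minimalPeriod_pos_of_mem_periodicPts ((mul_injective hq).mem_periodicPts m)

open Function in
/-- The size of an orbit is the period of multiplication by `q`, which is a permutation. -/
theorem card_orbit (hq : d.Coprime q) (m : ZMod d) :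
    (orbit q m).card = minimalPeriod (fun x => (q : ZMod d) * x) m := by
  classical
  have h : orbit q m = (Finset.range (minimalPeriod (fun x => (q : ZMod d) * x) m)).image
      (fun i => (fun x => (q : ZMod d) * x)^[i] m) := by
    ext x
    rw [mem_orbit, Finset.mem_image]
    constructor
    · rintro ⟨i, rfl⟩
      refine ⟨i % _, Finset.mem_range.mpr (Nat.mod_lt i (minimalPeriod_pos hq m)), ?_⟩
      rw [iterate_mod_minimalPeriod_eq, iterate_mul_eq]
    · rintro ⟨i, -, rfl⟩
      exact ⟨i, iterate_mul_eq m i⟩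
  rw [h, Finset.card_image_of_injOn, Finset.card_range]
  rw [Finset.coe_range]
  exact iterate_injOn_Iio_minimalPeriod

theorem card_orbit_ne_zero (m : ZMod d) : (orbit q m).card ≠ 0 :=
  Finset.card_ne_zero_of_mem (mem_orbit_self m)

/-- `(q ^ n - 1) m` is divisible by `d` if and only if `q ^ n` fixes the class of `m`. -/
theorem dvd_mul_val_iff (hq : d.Coprime q) (hq0 : q ≠ 0) (m : ZMod d) (n : ℕ) :
    d ∣ (q ^ n - 1) * m.val ↔ (orbit q m).card ∣ n := by
  rw [card_orbit hq, ← Function.isPeriodicPt_iff_minimalPeriod_dvd, Function.IsPeriodicPt,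
    Function.IsFixedPt, iterate_mul_eq, ← ZMod.natCast_eq_zero_iff, Nat.cast_mul,
    ZMod.natCast_zmod_val, Nat.cast_sub (Nat.one_le_pow _ _ (Nat.pos_of_ne_zero hq0)), Nat.cast_pow,
    Nat.cast_one, sub_mul, one_mul, sub_eq_zero]

theorem orbit_eq_of_mem (hq : d.Coprime q) {m x : ZMod d} (hx : x ∈ orbit q m) :
    orbit q x = orbit q m := by
  have hsub : ∀ {m x : ZMod d}, x ∈ orbit q m → orbit q x ⊆ orbit q m := by
    intro m x hx y hy
    obtain ⟨i, rfl⟩ := mem_orbit.mp hx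
    obtain ⟨j, rfl⟩ := mem_orbit.mp hy
    exact mem_orbit.mpr ⟨j + i, by ring⟩
  refine (hsub hx).antisymm (hsub ?_)
  obtain ⟨i, rfl⟩ := mem_orbit.mp hx
  set P := Function.minimalPeriod (fun x => (q : ZMod d) * x) m with hP
  have hPpos := minimalPeriod_pos hq m
  refine mem_orbit.mpr ⟨P * i - i, ?_⟩
  have hle : i ≤ P * i := Nat.le_mul_of_pos_left i hPpos
  rw [← mul_assoc, ← pow_add, Nat.sub_add_cancel hle, ← iterate_mul_eq]
  exact ((Function.isPeriodicPt_minimalPeriod _ m).mul_const i).symm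

/-- The elements of `zSet d` are those which are not killed by `3`. -/
theorem mem_zSet {m : ZMod d} : m ∈ zSet d ↔ ¬ d ∣ 3 * m.val := by
  have hlt := ZMod.val_lt m
  have hd0 := NeZero.pos d
  have hval : ∀ k : ℕ, k < d → (m = (k : ZMod d) ↔ m.val = k) := fun k hk =>
    ⟨fun h => by rw [h, ZMod.val_cast_of_lt hk], fun h => by rw [← h, ZMod.natCast_zmod_val]⟩
  have h0 := hval 0 hd0
  rw [Nat.cast_zero] at h0
  rw [zSet]
  split_ifs with h3
  · obtain ⟨k, hk⟩ := h3
    have hk1 : d / 3 = k := by omega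
    have hk2 : 2 * d / 3 = 2 * k := by omega
    simp only [Finset.mem_sdiff, Finset.mem_univ, true_and, Finset.mem_insert,
      Finset.mem_singleton, hk1, hk2]
    rw [h0, hval k (by omega), hval (2 * k) (by omega)]
    refine not_congr ⟨?_, ?_⟩
    · rintro (h | h | h) <;> rw [h]
      · simp
      · exact ⟨1, by omega⟩
      · exact ⟨2, by omega⟩
    · rintro ⟨j, hj⟩
      have h1 : 3 * m.val = 3 * (k * j) :=
        hj.trans ((congrArg (· * j) hk).trans (mul_assoc 3 k j))
      have h2 : m.val = k * j := Nat.eq_of_mul_eq_mul_left three_pos h1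
      have hj3 : j < 3 := by
        by_contra hc
        have : k * 3 ≤ k * j := Nat.mul_le_mul_left k (by omega)
        omega
      interval_cases j <;> omega
  · simp only [Finset.mem_sdiff, Finset.mem_univ, true_and, Finset.mem_singleton]
    rw [h0]
    refine not_congr ⟨fun h => by rw [h]; simp, fun h => ?_⟩
    have hcop : d.Coprime 3 := (Nat.coprime_comm.mp ((Nat.prime_three.coprime_iff_not_dvd).mpr h3))
    exact Nat.eq_zero_of_dvd_of_lt (hcop.dvd_of_dvd_mul_left h) hlt

theorem mem_zSet_iff_three_mul {m : ZMod d} : m ∈ zSet d ↔ 3 * m ≠ 0 := by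
  rw [mem_zSet, ← ZMod.natCast_eq_zero_iff, Nat.cast_mul, ZMod.natCast_zmod_val]
  rfl

theorem orbit_subset_zSet (hq : d.Coprime q) {m x : ZMod d} (hm : m ∈ zSet d)
    (hx : x ∈ orbit q m) : x ∈ zSet d := by
  obtain ⟨i, rfl⟩ := mem_orbit.mp hx
  rw [mem_zSet_iff_three_mul] at hm ⊢
  have hu : IsUnit ((q : ZMod d) ^ i) := ((ZMod.isUnit_iff_coprime q d).mpr hq.symm).pow i
  rw [mul_left_comm]
  intro h
  exact hm ((hu.mul_right_eq_zero).mp h)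

theorem filter_orbit_eq (hq : d.Coprime q) {o : Finset (ZMod d)} (ho : o ∈ orbits d q) :
    (zSet d).filter (fun m => orbit q m = o) = o := by
  classical
  obtain ⟨m, hm, rfl⟩ := Finset.mem_image.mp ho
  ext x
  rw [Finset.mem_filter]
  exact ⟨fun h => h.2 ▸ mem_orbit_self x,
    fun h => ⟨orbit_subset_zSet hq hm h, orbit_eq_of_mem hq h⟩⟩

end Orbits

end

/-! ### Power sums indexed by orbits, and the factorizations -/

section

open Polynomial

section OrbitSum

variable {Q : Type*} [Field Q] {p : ℕ} (𝔓 : Ideal (integralClosure ℤ Q))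
variable [CharZero Q] [IsAlgClosed Q] [Fact p.Prime] [𝔓.IsPrime]
  [𝔓.LiesOver (Ideal.span {(p : ℤ)})]
variable {d : ℕ} [NeZero d] {a : ℕ}

/-- The Jacobi sum of the character `θ ^ ((q ^ n - 1) m / d)` of the field with `q ^ n` elements,
where `q = p ^ a`. -/
def jacobiTeichmuller (p : ℕ) [Fact p.Prime] (𝔓 : Ideal (integralClosure ℤ Q)) [𝔓.IsPrime]
    [𝔓.LiesOver (Ideal.span {(p : ℤ)})] (a n : ℕ) (m : ZMod d) : Q :=
  jacobiNeg (teichmullerChar p 𝔓 (a * n) ^ (((p ^ a) ^ n - 1) * m.val / d))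

theorem one_lt_pow_pow (ha : a ≠ 0) {n : ℕ} (hn : n ≠ 0) : 1 < (p ^ a) ^ n := by
  rw [← pow_mul]
  exact Nat.one_lt_pow (Nat.mul_ne_zero ha hn) (Fact.out : p.Prime).one_lt

theorem orderOf_teichmullerChar_mul (ha : a ≠ 0) {n : ℕ} (hn : n ≠ 0) :
    orderOf (teichmullerChar p 𝔓 (a * n)) = (p ^ a) ^ n - 1 := by
  rw [orderOf_teichmullerChar p 𝔓 (Nat.mul_ne_zero ha hn), pow_mul]

theorem teichmullerChar_pow_three_ne_one (ha : a ≠ 0) {n : ℕ} (hn : n ≠ 0) {m : ZMod d}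
    (hm : m ∈ zSet d) (h : d ∣ ((p ^ a) ^ n - 1) * m.val) :
    (teichmullerChar p 𝔓 (a * n) ^ (((p ^ a) ^ n - 1) * m.val / d)) ^ 3 ≠ 1 := by
  rw [← pow_mul, Ne, ← orderOf_dvd_iff_pow_eq_one, orderOf_teichmullerChar_mul 𝔓 ha hn]
  obtain ⟨j, hj⟩ := h
  have hN := one_lt_pow_pow (p := p) ha hn
  rw [hj, Nat.mul_div_cancel_left _ (NeZero.pos d)]
  intro hdvd
  refine mem_zSet.mp hm ?_
  have h1 : ((p ^ a) ^ n - 1) * d ∣ ((p ^ a) ^ n - 1) * (3 * m.val) := by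
    have := mul_dvd_mul_right hdvd d
    rwa [show j * 3 * d = ((p ^ a) ^ n - 1) * (3 * m.val) by
      rw [mul_left_comm, hj]; ring] at this
  exact Nat.dvd_of_mul_dvd_mul_left (by omega) h1

/-- The characters `ψ` of the field with `q ^ n` elements such that `ψ ^ d = 1` and `ψ ^ 3 ≠ 1`
correspond to the elements of `zSet d` fixed by `q ^ n`. -/
theorem sum_jacobiNeg_eq_sum_zSet (ha : a ≠ 0) (hdq : d.Coprime (p ^ a)) {n : ℕ} (hn : n ≠ 0)
    [Fintype (finiteField p 𝔓 (a * n))] [DecidableEq (MulChar (finiteField p 𝔓 (a * n)) Q)] :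
    ∑ ψ ∈ (charsOfOrderDvd (finiteField p 𝔓 (a * n)) Q d).filter (fun ψ => ψ ^ 3 ≠ 1),
        jacobiNeg ψ =
      ∑ m ∈ (zSet d).filter (fun m => (orbit (p ^ a) m).card ∣ n), jacobiTeichmuller p 𝔓 a n m := by
  have hN := one_lt_pow_pow (p := p) ha hn
  have hq0 : p ^ a ≠ 0 := pow_ne_zero _ (Fact.out : p.Prime).ne_zero
  have hdpos := NeZero.pos d
  symm
  refine Finset.sum_nbij
    (fun m => teichmullerChar p 𝔓 (a * n) ^ (((p ^ a) ^ n - 1) * m.val / d)) ?_ ?_ ?_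
    (fun m _ => rfl)
  · intro m hm
    rw [Finset.mem_filter, ← dvd_mul_val_iff hdq hq0] at hm
    rw [Finset.mem_filter, mem_charsOfOrderDvd]
    refine ⟨?_, teichmullerChar_pow_three_ne_one 𝔓 ha hn hm.1 hm.2⟩
    rw [← pow_mul, Nat.div_mul_cancel hm.2, ← orderOf_dvd_iff_pow_eq_one,
      orderOf_teichmullerChar_mul 𝔓 ha hn]
    exact dvd_mul_right _ _
  · intro m hm m' hm' h
    rw [Finset.mem_coe, Finset.mem_filter, ← dvd_mul_val_iff hdq hq0] at hm hm'
    have hlt : ∀ x : ZMod d, ((p ^ a) ^ n - 1) * x.val / d <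
        orderOf (teichmullerChar p 𝔓 (a * n)) := fun x => by
      rw [orderOf_teichmullerChar_mul 𝔓 ha hn, Nat.div_lt_iff_lt_mul hdpos]
      exact Nat.mul_lt_mul_of_pos_left (ZMod.val_lt x) (by omega)
    have h1 := pow_injOn_Iio_orderOf (hlt m) (hlt m') h
    have h2 : ((p ^ a) ^ n - 1) * m.val = ((p ^ a) ^ n - 1) * m'.val := by
      rw [← Nat.div_mul_cancel hm.2, ← Nat.div_mul_cancel hm'.2]
      exact congrArg (· * d) h1
    exact ZMod.val_injective d (Nat.eq_of_mul_eq_mul_left (by omega) h2)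
  · intro ψ hψ
    rw [Finset.mem_coe, Finset.mem_filter, mem_charsOfOrderDvd] at hψ
    obtain ⟨j, hj, rfl⟩ := exists_eq_teichmullerChar_pow p 𝔓 (Nat.mul_ne_zero ha hn) ψ
    rw [pow_mul p a n] at hj
    have h1 := hψ.1
    rw [← pow_mul, ← orderOf_dvd_iff_pow_eq_one, orderOf_teichmullerChar_mul 𝔓 ha hn] at h1
    obtain ⟨m, hm⟩ := h1
    have hmd : m < d := by
      have : ((p ^ a) ^ n - 1) * m < ((p ^ a) ^ n - 1) * d := by
        rw [← hm]
        exact Nat.mul_lt_mul_of_pos_right hj hdpos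
      exact lt_of_mul_lt_mul_left this (Nat.zero_le _)
    have hval : ((m : ZMod d)).val = m := ZMod.val_cast_of_lt hmd
    refine ⟨(m : ZMod d), ?_, ?_⟩
    · rw [Finset.mem_coe, Finset.mem_filter, ← dvd_mul_val_iff hdq hq0, hval, ← hm, mem_zSet, hval]
      refine ⟨fun h => hψ.2 ?_, dvd_mul_left _ _⟩
      rw [← pow_mul, ← orderOf_dvd_iff_pow_eq_one, orderOf_teichmullerChar_mul 𝔓 ha hn]
      refine Nat.dvd_of_mul_dvd_mul_right hdpos ?_
      rw [show j * 3 * d = ((p ^ a) ^ n - 1) * (3 * m) by rw [mul_right_comm, hm]; ring]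
      exact mul_dvd_mul_left _ h
    · simp only [hval]
      rw [← hm, Nat.mul_div_cancel _ hdpos]

/-- The Jacobi sum over the field with `q ^ n` elements is a power of that over the field with `q ^ e`
elements, where `e` is the size of the orbit of `m`. -/
theorem jacobiTeichmuller_eq_pow (ha : a ≠ 0) (hdq : d.Coprime (p ^ a)) {n : ℕ} (hn : n ≠ 0)
    {m : ZMod d} (hm : m ∈ zSet d) (h : (orbit (p ^ a) m).card ∣ n) :
    jacobiTeichmuller p 𝔓 a n m =
      jacobiTeichmuller p 𝔓 a (orbit (p ^ a) m).card m ^ (n / (orbit (p ^ a) m).card) := by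
  have hq0 : p ^ a ≠ 0 := pow_ne_zero _ (Fact.out : p.Prime).ne_zero
  have he := card_orbit_ne_zero (q := p ^ a) m
  have hdvd : d ∣ ((p ^ a) ^ (orbit (p ^ a) m).card - 1) * m.val :=
    (dvd_mul_val_iff hdq hq0 m _).mpr dvd_rfl
  set e := (orbit (p ^ a) m).card
  have h1 := jacobiNeg_teichmullerChar_pow p 𝔓 (Nat.mul_ne_zero ha he) (Nat.mul_ne_zero ha hn)
    (mul_dvd_mul_left a h) (teichmullerChar_pow_three_ne_one 𝔓 ha he hm hdvd)
  rw [Nat.mul_div_mul_left _ _ (Nat.pos_of_ne_zero ha)] at h1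
  rw [jacobiTeichmuller, jacobiTeichmuller, ← h1]
  congr 2
  rw [pow_mul, pow_mul, ← Nat.mul_div_assoc _ hdvd, ← mul_assoc, Nat.div_mul_cancel]
  obtain ⟨k, rfl⟩ := h
  rw [pow_mul]
  simpa using Nat.sub_dvd_pow_sub_pow ((p ^ a) ^ e) 1 k

/-- Replacing `m` by `q m` raises the character to the power `q`, which does not change the Jacobi
sum. -/
theorem jacobiTeichmuller_mul (ha : a ≠ 0) {e : ℕ} (he : e ≠ 0) {m : ZMod d}
    (h : d ∣ ((p ^ a) ^ e - 1) * m.val) :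
    jacobiTeichmuller p 𝔓 a e (((p ^ a : ℕ) : ZMod d) * m) = jacobiTeichmuller p 𝔓 a e m := by
  have := finite_finiteField p 𝔓 (Nat.mul_ne_zero ha he)
  symm
  rw [jacobiTeichmuller, jacobiTeichmuller,
    ← jacobiNeg_pow_char (teichmullerChar p 𝔓 (a * e) ^ _) a, ← pow_mul]
  congr 1
  rw [pow_eq_pow_iff_modEq, orderOf_teichmullerChar_mul 𝔓 ha he]
  set N := (p ^ a) ^ e - 1
  have hval : (((p ^ a : ℕ) : ZMod d) * m).val = p ^ a * m.val % d := by
    conv_lhs => rw [← ZMod.natCast_zmod_val m, ← Nat.cast_mul, ZMod.val_natCast]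
  obtain ⟨j, hj⟩ := h
  rw [hj, Nat.mul_div_cancel_left _ (NeZero.pos d), hval]
  have h1 : N * (p ^ a * m.val % d) + d * (N * (p ^ a * m.val / d)) = d * (j * p ^ a) := by
    calc _ = N * (p ^ a * m.val % d + d * (p ^ a * m.val / d)) := by ring
      _ = (N * m.val) * p ^ a := by rw [Nat.mod_add_div]; ring
      _ = _ := by rw [hj]; ring
  have h2 : d ∣ N * (p ^ a * m.val % d) :=
    (Nat.dvd_add_left (dvd_mul_right d _)).mp (h1 ▸ dvd_mul_right _ _)
  obtain ⟨i, hi⟩ := h2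
  rw [hi, Nat.mul_div_cancel_left _ (NeZero.pos d)]
  rw [hi, ← mul_add] at h1
  rw [← Nat.eq_of_mul_eq_mul_left (NeZero.pos d) h1]
  simp [Nat.ModEq]

/-- The Jacobi sum attached to `m` only depends on the orbit of `m`. -/
theorem jacobiTeichmuller_eq_of_mem_orbit (ha : a ≠ 0) (hdq : d.Coprime (p ^ a)) {m x : ZMod d}
    (hx : x ∈ orbit (p ^ a) m) :
    jacobiTeichmuller p 𝔓 a (orbit (p ^ a) m).card x =
      jacobiTeichmuller p 𝔓 a (orbit (p ^ a) m).card m := by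
  have hq0 : p ^ a ≠ 0 := pow_ne_zero _ (Fact.out : p.Prime).ne_zero
  obtain ⟨i, rfl⟩ := mem_orbit.mp hx
  clear hx
  induction i with
  | zero => rw [pow_zero, one_mul]
  | succ i ih =>
    rw [← ih, pow_succ', mul_assoc]
    refine jacobiTeichmuller_mul 𝔓 ha (card_orbit_ne_zero m) ?_
    rw [dvd_mul_val_iff hdq hq0, orbit_eq_of_mem hdq (mem_orbit.mpr ⟨i, rfl⟩)]

/-- The sum of the Jacobi sums over the field with `q ^ n` elements is the `n`-th power sum of the
factorization indexed by the orbits. -/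
theorem sum_jacobiNeg_eq_sum_orbits (ha : a ≠ 0) (hdq : d.Coprime (p ^ a)) {n : ℕ} (hn : n ≠ 0)
    [Fintype (finiteField p 𝔓 (a * n))] [DecidableEq (MulChar (finiteField p 𝔓 (a * n)) Q)]
    {rep : Finset (ZMod d) → ZMod d} (hrep : ∀ o ∈ orbits d (p ^ a), rep o ∈ o) :
    ∑ ψ ∈ (charsOfOrderDvd (finiteField p 𝔓 (a * n)) Q d).filter (fun ψ => ψ ^ 3 ≠ 1),
        jacobiNeg ψ =
      ∑ o ∈ orbits d (p ^ a), if o.card ∣ n then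
        (o.card : Q) * (theta p 𝔓 a (rep o) (-1) * jacobi p 𝔓 a (rep o)) ^ (n / o.card) else 0 := by
  rw [sum_jacobiNeg_eq_sum_zSet 𝔓 ha hdq hn, Finset.sum_filter, ← Finset.sum_fiberwise_of_maps_to
    (t := orbits d (p ^ a)) (g := orbit (p ^ a)) (fun m hm => Finset.mem_image_of_mem _ hm)]
  refine Finset.sum_congr rfl fun o ho => ?_
  rw [filter_orbit_eq hdq ho]
  obtain ⟨m₀, hm₀, h₀⟩ := Finset.mem_image.mp ho
  have ho' : ∀ x ∈ o, x ∈ zSet d ∧ orbit (p ^ a) x = o := fun x hx => by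
    rw [← filter_orbit_eq hdq ho, Finset.mem_filter] at hx
    exact hx
  have hro := (ho' _ (hrep o ho)).2
  have hne : a * (orbit (p ^ a) (rep o)).card ≠ 0 := Nat.mul_ne_zero ha (card_orbit_ne_zero _)
  rw [theta_neg_one_mul_jacobi p 𝔓 hne]
  change _ = if _ then _ * jacobiTeichmuller p 𝔓 a (orbit (p ^ a) (rep o)).card (rep o) ^ _ else _
  have hterm : ∀ x ∈ o, (if (orbit (p ^ a) x).card ∣ n then jacobiTeichmuller p 𝔓 a n x else 0) =
      if o.card ∣ n then
        jacobiTeichmuller p 𝔓 a (orbit (p ^ a) (rep o)).card (rep o) ^ (n / o.card) else 0 := by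
    intro x hx
    obtain ⟨hxz, hxo⟩ := ho' x hx
    rw [hxo]
    split_ifs with hdvd
    · rw [jacobiTeichmuller_eq_pow 𝔓 ha hdq hn hxz (hxo.symm ▸ hdvd), hxo, hro]
      congr 1
      have := jacobiTeichmuller_eq_of_mem_orbit 𝔓 ha hdq (m := rep o) (x := x) (by rwa [hro])
      rwa [hro] at this
    · rfl
  rw [Finset.sum_congr rfl hterm, Finset.sum_const, nsmul_eq_mul]
  split_ifs <;> simp

end OrbitSum

section Polynomials

variable {Q : Type*} [Field Q] [CharZero Q]

/-- An integral power series which becomes a polynomial over a field of characteristic zero is a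
polynomial. -/
theorem exists_polynomial_eq {f : PowerSeries ℤ} {g : Q[X]}
    (h : PowerSeries.map (Int.castRingHom Q) f = (g : PowerSeries Q)) :
    ∃ P : ℤ[X], f = (P : PowerSeries ℤ) := by
  refine ⟨PowerSeries.trunc (g.natDegree + 1) f, ?_⟩
  ext n
  rw [Polynomial.coeff_coe, PowerSeries.coeff_trunc]
  split_ifs with hn
  · rfl
  · have h1 := congrArg (PowerSeries.coeff n) h
    rw [PowerSeries.coeff_map, Polynomial.coeff_coe,
      Polynomial.coeff_eq_zero_of_natDegree_lt (by omega), eq_intCast, Int.cast_eq_zero] at h1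
    exact h1

omit [CharZero Q] in
theorem map_eq_of_coe {P : ℤ[X]} {g : Q[X]}
    (h : PowerSeries.map (Int.castRingHom Q) (P : PowerSeries ℤ) = (g : PowerSeries Q)) :
    P.map (Int.castRingHom Q) = g := by
  apply Polynomial.coe_injective
  rw [← h, Polynomial.polynomial_map_coe]

omit [CharZero Q] in
theorem coe_prod_binomial {ι : Type*} (s : Finset ι) (c : ι → Q) (e : ι → ℕ) :
    ((∏ i ∈ s, (1 - C (c i) * X ^ e i) : Q[X]) : PowerSeries Q) =
      ∏ i ∈ s, (1 - PowerSeries.C (c i) * PowerSeries.X ^ e i) := by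
  rw [← Polynomial.coeToPowerSeries.ringHom_apply, map_prod]
  simp

end Polynomials

/-- The factorization of the `L`-function indexed by the powers of a character of order `d` of the
constant field. -/
theorem map_lFunction_eq_prod_char {F Q : Type*} [Field F] [Finite F] [Field Q] [CharZero Q]
    [IsAlgClosed Q] {p : ℕ} [Fact p.Prime] [CharP F p] (h2 : (2 : F) ≠ 0) (h3 : (3 : F) ≠ 0)
    {d : ℕ} (hd : d ≠ 0) {χ : MulChar F Q} (hχ : orderOf χ = d) :
    PowerSeries.map (Int.castRingHom Q) (lFunction (hessianCurve F d)) =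
      ∏ k ∈ (Finset.Icc 1 (d - 1)).filter (fun k => ¬ d ∣ 3 * k),
        (1 - PowerSeries.C (jacobiNeg (χ ^ k)) * PowerSeries.X ^ 1) := by
  classical
  refine map_lFunction_eq_prod.{_, _, _, 0} h2 h3 hd _ _ (fun _ _ => one_ne_zero) fun n hn => ?_
  have : NeZero n := ⟨hn⟩
  have := Fintype.ofFinite F
  have hrank := FiniteField.finrank_extension F p n
  have := Fintype.ofFinite (FiniteField.Extension F p n)
  have hord : orderOf (normLift χ (FiniteField.Extension F p n)) = d := by
    rw [← hχ]
    refine orderOf_eq_orderOf_iff.mpr fun m => ?_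
    rw [normLift_pow, ← normLift_one (k := F) (L := FiniteField.Extension F p n)]
    exact normLift_injective.eq_iff
  refine ⟨FiniteField.Extension F p n, inferInstance, inferInstance, inferInstance, inferInstance,
    hrank, ?_⟩
  rw [sum_charsOfOrderDvd_eq hd hord]
  refine Finset.sum_congr rfl fun k hk => ?_
  have h3k : (χ ^ k) ^ 3 ≠ 1 := by
    rw [← pow_mul, Ne, ← orderOf_dvd_iff_pow_eq_one, hχ, mul_comm]
    exact (Finset.mem_filter.mp hk).2
  rw [if_pos (one_dvd n), normLift_pow, jacobiNeg_normLift h3k, hrank, Nat.cast_one, one_mul,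
    Nat.div_one]

/-- The factorization of the `L`-function indexed by orbits. -/
theorem map_lFunction_eq_prod_orbits {p a : ℕ} [Fact p.Prime] {F Q : Type*} [Field F] [Finite F]
    (hF : Nat.card F = p ^ a) (h2 : (2 : F) ≠ 0) (h3 : (3 : F) ≠ 0) [Field Q] [CharZero Q]
    [IsAlgClosed Q] (𝔓 : Ideal (integralClosure ℤ Q)) [𝔓.IsPrime]
    [𝔓.LiesOver (Ideal.span {(p : ℤ)})] {d : ℕ} [NeZero d] (hdq : d.Coprime (p ^ a))
    {rep : Finset (ZMod d) → ZMod d} (hrep : ∀ o ∈ orbits d (p ^ a), rep o ∈ o) :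
    PowerSeries.map (Int.castRingHom Q) (lFunction (hessianCurve F d)) =
      ∏ o ∈ orbits d (p ^ a),
        (1 - PowerSeries.C (theta p 𝔓 a (rep o) (-1) * jacobi p 𝔓 a (rep o)) *
          PowerSeries.X ^ o.card) := by
  classical
  have ha : a ≠ 0 := by
    rintro rfl
    rw [pow_zero] at hF
    exact Finite.one_lt_card.ne' hF
  refine map_lFunction_eq_prod h2 h3 (NeZero.ne d) _ _
    (fun o ho => (Finset.card_ne_zero_of_mem (hrep o ho))) fun n hn => ?_
  have := finite_finiteField p 𝔓 (Nat.mul_ne_zero ha hn)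
  have := Fintype.ofFinite (finiteField p 𝔓 (a * n))
  obtain ⟨_, hrank⟩ := exists_algebra_finrank_eq (L := finiteField p 𝔓 (a * n)) ha hF
    (card_finiteField p 𝔓 (Nat.mul_ne_zero ha hn))
  exact ⟨finiteField p 𝔓 (a * n), inferInstance, inferInstance, inferInstance, inferInstance,
    hrank, sum_jacobiNeg_eq_sum_orbits 𝔓 ha hdq hn hrep⟩

end

end

end Hessian

open Hessian Polynomial in
theorem theorem3p1 {p a : ℕ} [Fact p.Prime] (hp : 5 ≤ p)
    {F : Type*} [Field F] [Finite F] (hF : Nat.card F = p ^ a)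
    {Q : Type*} [Field Q] [Algebra ℚ Q] [CharZero Q] [IsAlgClosed Q] [Algebra.IsAlgebraic ℚ Q]
    (𝔓 : Ideal (integralClosure ℤ Q)) [𝔓.IsPrime] [𝔓.LiesOver (Ideal.span {(p : ℤ)})]
    (d : ℕ) [NeZero d] (hd : 2 ≤ d) (hdq : d.Coprime (p ^ a)) :
    Multipliable (eulerFactor (hessianCurve F d)) ∧
    ∃ P : ℤ[X], lFunction (hessianCurve F d) = (P : PowerSeries ℤ) ∧
      -- the product over the orbits, with an arbitrary choice of representatives
      (∀ rep : Finset (ZMod d) → ZMod d, (∀ o ∈ orbits d (p ^ a), rep o ∈ o) →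
        P.map (Int.castRingHom Q) = ∏ o ∈ orbits d (p ^ a),
          (1 - C (theta p 𝔓 a (rep o) (-1) * jacobi p 𝔓 a (rep o)) * X ^ o.card)) ∧
      -- the case where `d` divides `q - 1`
      (d ∣ p ^ a - 1 → ∀ χ : MulChar F Q, orderOf χ = d →
        P.map (Int.castRingHom Q) =
          ∏ k ∈ (Finset.Icc 1 (d - 1)).filter (fun k => ¬ d ∣ 3 * k),
            (1 - C (jacobiNeg (χ ^ k)) * X)) := by
  have hchar : CharP F p := by
    have := Fintype.ofFinite F
    exact charP_of_card_eq_prime_pow (f := a) (by rw [← hF, Nat.card_eq_fintype_card])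
  have hne : ∀ n : ℕ, n ≠ 0 → n < 5 → (n : F) ≠ 0 := fun n h0 h5 h => by
    rw [CharP.cast_eq_zero_iff F p] at h
    have := Nat.le_of_dvd (Nat.pos_of_ne_zero h0) h
    omega
  have h2 : (2 : F) ≠ 0 := by exact_mod_cast hne 2 (by omega) (by omega)
  have h3 : (3 : F) ≠ 0 := by exact_mod_cast hne 3 (by omega) (by omega)
  have horb : ∀ rep : Finset (ZMod d) → ZMod d, (∀ o ∈ orbits d (p ^ a), rep o ∈ o) →
      PowerSeries.map (Int.castRingHom Q) (lFunction (hessianCurve F d)) =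
        ((∏ o ∈ orbits d (p ^ a), (1 - C (theta p 𝔓 a (rep o) (-1) * jacobi p 𝔓 a (rep o)) *
          X ^ o.card) : Q[X]) : PowerSeries Q) := fun rep hrep => by
    rw [map_lFunction_eq_prod_orbits hF h2 h3 𝔓 hdq hrep, coe_prod_binomial]
  have hrep₀ : ∃ rep : Finset (ZMod d) → ZMod d, ∀ o ∈ orbits d (p ^ a), rep o ∈ o := by
    classical
    refine ⟨fun o => if h : o.Nonempty then h.choose else 0, fun o ho => ?_⟩
    obtain ⟨m, -, rfl⟩ := Finset.mem_image.mp ho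
    have hm : (orbit (p ^ a) m).Nonempty := ⟨m, mem_orbit_self m⟩
    simp only [dif_pos hm]
    exact hm.choose_spec
  obtain ⟨rep₀, hrep₀⟩ := hrep₀
  obtain ⟨P, hP⟩ := exists_polynomial_eq (horb rep₀ hrep₀)
  refine ⟨(exists_lFunction_series.{_, 0} h2 h3 (NeZero.ne d)).1, P, hP, fun rep hrep => ?_,
    fun _ χ hχ => ?_⟩
  · exact map_eq_of_coe (hP ▸ horb rep hrep)
  · refine map_eq_of_coe ?_
    rw [← hP, map_lFunction_eq_prod_char (p := p) h2 h3 (NeZero.ne d) hχ, ← coe_prod_binomial _ _ fun _ => 1]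
    simp only [pow_one]
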